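/- Let $T$ be a triangulation of a convex $(n+3)$-gon, with diagonals $\tau_1,\dots,\tau_n$ and boundary segments $\tau_{n+1},\dots,\tau_{2n+3}$. Let $Q_T$ be the quiver with a vertex for each $\tau_i$ (mutable if $\tau_i$ is a diagonal, frozen if it is a boundary segment) and, in each triangle of $T$, arrows joining its sides in clockwise order. Let $\mathcal A(Q_T)$ be the cluster algebra with initial cluster variables $x_1,\dots,x_n$, coefficient variables $x_{n+1},\dots,x_{2n+3}$ and initial quiver $Q_T$. Its cluster variables correspond to the diagonals of the polygon (mutations correspond to flips of triangulations). Let $\gamma$ be a diagonal of the polygon that is not in $T$, and let $x_\gamma$ be the corresponding cluster variable; it is a Laurent polynomial in $x_1,\dots,x_{2n+3}$, called its $T$-expansion. Let $D(\gamma)$ be the set of diagonals of $T$ crossed by $\gamma$; list them as $\tau_{i_1},\dots,\tau_{i_d}$ in the order in which $\gamma$, with a chosen orientation, crosses them. The snake graph $G_{T,\gamma}$ is the planar edge-labelled graph made of $d$ unit square tiles, as follows. The sides of the $k$-th tile are labelled by the sides of the quadrilateral formed by the two triangles of $T$ adjacent to $\tau_{i_k}$, in such a way that $\tau_{i_k}$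 becomes the northwest–southeast diagonal of the square (this diagonal is not an edge of $G_{T,\gamma}$). The first tile is embedded preserving orientation, with the starting point of $\gamma$ at its southwest corner, and consecutive tiles have opposite orientations. Tile $k+1$ is glued to the north or east side of tile $k$ along the edge labelled by the third side of the triangle of $T$ having $\tau_{i_k}$ and $\tau_{i_{k+1}}$ as sides. Let $N(T,\gamma)\subset\mathbb R^{2n+3}$ be the Newton polytope of the $T$-expansion of $x_\gamma$, that is, the convex hull of the exponent vectors of the Laurent monomials appearing with nonzero coefficient. Let $P(G_{T,\gamma})\subset\mathbb R^{2n+3}$ be the convex hull of the characteristic vectors of all perfect matchings $M$ of $G_{T,\gamma}$, where the $i$-th coordinate of the characteristic vector of $M$ is the number of edges of $M$ labelled $i$. Then $$\dim N(T,\gamma)=\dim P(G_{T,\gamma})=|D(\gamma)|.$$ -/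

import Mathlib

namespace SnakePolytope

/-! ### Triangulated polygons

The vertices of the convex `(n+3)`-gon are `0, 1, …, n+2`, in counterclockwise order. An arc
(boundary segment or diagonal) is an unordered pair of vertices. -/

/-- A diagonal: an arc between two distinct vertices that are not cyclically adjacent. -/
def IsDiagonal {n : ℕ} (e : Sym2 (Fin (n + 3))) : Prop :=
  ¬ e.IsDiag ∧ ∀ i : Fin (n + 3), e ≠ s(i, i + 1)

/-- Two arcs cross (in the interior of the polygon) when their endpoints interleave. -/
def Crosses {n : ℕ} (e f : Sym2 (Fin (n + 3))) : Prop :=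
  ∃ a b c d : Fin (n + 3), a < b ∧ b < c ∧ c < d ∧
    ((e = s(a, c) ∧ f = s(b, d)) ∨ (e = s(b, d) ∧ f = s(a, c)))

/-- A triangulation of the `(n+3)`-gon with its `n` diagonals listed as `τ_1, …, τ_n`:
a maximal collection of pairwise noncrossing diagonals. -/
structure Triangulation (n : ℕ) where
  diag : Fin n → Sym2 (Fin (n + 3))
  injective : Function.Injective diag
  isDiagonal : ∀ i, IsDiagonal (diag i)
  noncrossing : ∀ i j, ¬ Crosses (diag i) (diag j)
  maximal : ∀ e, IsDiagonal e → (∀ i, ¬ Crosses e (diag i)) → ∃ i, diag i = e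

/-- Labels of the `2n+3` edges of a triangulation: `Sum.inl` for the `n` diagonals (mutable),
`Sum.inr` for the `n+3` boundary segments (frozen). -/
abbrev Label (n : ℕ) := Fin n ⊕ Fin (n + 3)

/-- The edge of the triangulation with a given label; the boundary segment with index `i` joins
the vertices `i` and `i + 1` (cyclically). -/
def Triangulation.edge {n : ℕ} (T : Triangulation n) : Label n → Sym2 (Fin (n + 3)) :=
  Sum.elim T.diag fun i => s(i, i + 1)

/-- `D(γ)`: the (indices of the) diagonals of `T` that are crossed by `γ`. -/
noncomputable def Triangulation.crossed {n : ℕ} (T : Triangulation n)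
    (γ : Sym2 (Fin (n + 3))) : Finset (Fin n) := by
  classical exact Finset.univ.filter fun i => Crosses γ (T.diag i)

/-! ### The cluster algebra of the quiver of a triangulation -/

/-- There is an arrow `i → j` in the quiver `Q_T`: `i` and `j` are two sides of a triangle
`a b c` of `T` (listed counterclockwise), and `j` follows `i` in the clockwise order of the sides
`ab, ca, bc`. Two distinct edges are sides of at most one common triangle, so `Q_T` has no
multiple arrows. -/
def Triangulation.Arrow {n : ℕ} (T : Triangulation n) (i j : Label n) : Prop :=
  ∃ a b c : Fin (n + 3), a < b ∧ b < c ∧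
    (∃ l, T.edge l = s(a, b)) ∧ (∃ l, T.edge l = s(b, c)) ∧ (∃ l, T.edge l = s(c, a)) ∧
    ((T.edge i = s(a, b) ∧ T.edge j = s(c, a)) ∨
     (T.edge i = s(c, a) ∧ T.edge j = s(b, c)) ∨
     (T.edge i = s(b, c) ∧ T.edge j = s(a, b)))

/-- The ambient field `ℚ(x_1, …, x_{2n+3})` of rational functions. -/
abbrev RatFun (n : ℕ) := FractionRing (MvPolynomial (Label n) ℚ)

/-- The initial variable with a given label. -/
noncomputable def initialVar {n : ℕ} (i : Label n) : RatFun n :=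
  algebraMap (MvPolynomial (Label n) ℚ) (RatFun n) (MvPolynomial.X i)

/-- A labelled seed: a quiver, encoded by its signed adjacency matrix
`B i j = #(arrows i → j) - #(arrows j → i)`, and an extended cluster. -/
structure Seed (n : ℕ) where
  B : Label n → Label n → ℤ
  x : Label n → RatFun n

/-- The initial seed of `A(Q_T)`: the quiver `Q_T` and the initial variables. -/
noncomputable def initialSeed {n : ℕ} (T : Triangulation n) : Seed n := by
  classical exact
    { B := fun i j => (if T.Arrow i j then 1 else 0) - (if T.Arrow j i then 1 else 0)
      x := initialVar }

/-- Seed mutation in the mutable direction `k`: quiver mutation, and the exchange relation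
`x_k' x_k = ∏_{i → k} x_i + ∏_{k → i} x_i`. -/
noncomputable def Seed.mutate {n : ℕ} (S : Seed n) (k : Fin n) : Seed n where
  B i j := if i = Sum.inl k ∨ j = Sum.inl k then - S.B i j
    else S.B i j + max (S.B i (Sum.inl k)) 0 * max (S.B (Sum.inl k) j) 0
      - max (- S.B i (Sum.inl k)) 0 * max (- S.B (Sum.inl k) j) 0
  x := Function.update S.x (Sum.inl k)
    ((∏ i, S.x i ^ (S.B i (Sum.inl k)).toNat + ∏ i, S.x i ^ (S.B (Sum.inl k) i).toNat)
      / S.x (Sum.inl k))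

/-- `T'` is obtained from `T` by flipping the `k`-th diagonal: that diagonal is replaced by a
different one, and the others stay. -/
def IsFlip {n : ℕ} (k : Fin n) (T T' : Triangulation n) : Prop :=
  T'.diag k ≠ T.diag k ∧ ∀ j, j ≠ k → T'.diag j = T.diag j

/-- `SeedAt T T' S`: some sequence of flips from `T` to `T'` carries the initial seed of `A(Q_T)`
to `S` when each flip is accompanied by the seed mutation in the same direction. -/
inductive SeedAt {n : ℕ} (T : Triangulation n) : Triangulation n → Seed n → Prop
  | initial : SeedAt T T (initialSeed T)
  | mutate {T' T'' : Triangulation n} {S : Seed n} (k : Fin n) :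
      SeedAt T T' S → IsFlip k T' T'' → SeedAt T T'' (S.mutate k)

/-- `x` is a cluster variable of `A(Q_T)` that corresponds to the diagonal `γ`. -/
def IsClusterVariable {n : ℕ} (T : Triangulation n) (γ : Sym2 (Fin (n + 3)))
    (x : RatFun n) : Prop :=
  ∃ (T' : Triangulation n) (S : Seed n) (k : Fin n),
    SeedAt T T' S ∧ T'.diag k = γ ∧ S.x (Sum.inl k) = x

/-- Laurent polynomials over `ℚ` in the variables `x_1, …, x_{2n+3}`. -/
abbrev Laurent (n : ℕ) := AddMonoidAlgebra ℚ (Label n → ℤ)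

/-- A Laurent polynomial as a rational function. -/
noncomputable def Laurent.toRatFun {n : ℕ} (f : Laurent n) : RatFun n :=
  ∑ c ∈ f.coeff.support, algebraMap ℚ (RatFun n) (f.coeff c) * ∏ i, initialVar i ^ c i

/-- `f` is the `T`-expansion of `x_γ`: the diagonal `γ` corresponds to exactly one cluster
variable of `A(Q_T)`, and that cluster variable equals the Laurent polynomial `f`. -/
def IsTExpansion {n : ℕ} (T : Triangulation n) (γ : Sym2 (Fin (n + 3))) (f : Laurent n) : Prop :=
  ∀ x : RatFun n, IsClusterVariable T γ x ↔ x = f.toRatFun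

/-- The Newton polytope of a Laurent polynomial: the convex hull of the exponent vectors of the
monomials with nonzero coefficient. -/
def newtonPolytope {n : ℕ} (f : Laurent n) : Set (Label n → ℝ) :=
  convexHull ℝ {v | ∃ c ∈ f.coeff.support, v = fun i => (c i : ℝ)}

/-! ### The snake graph

The diagonal `γ` is oriented from `p` to `q`. For a vertex `v`, the number `(v - p).val` is the
number of counterclockwise steps from `p` to `v`. -/

/-- `v` lies strictly to the right of `γ`. -/
def IsRight {n : ℕ} (p q v : Fin (n + 3)) : Prop :=
  0 < (v - p).val ∧ (v - p).val < (q - p).val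

/-- `v` lies strictly to the left of `γ`. -/
def IsLeft {n : ℕ} (p q v : Fin (n + 3)) : Prop :=
  (q - p).val < (v - p).val

/-- The `k`-th diagonal of `T` crosses `γ`, with right end `r` and left end `l`. -/
def Triangulation.Ends {n : ℕ} (T : Triangulation n) (p q : Fin (n + 3)) (k : Fin n)
    (r l : Fin (n + 3)) : Prop :=
  T.diag k = s(r, l) ∧ IsRight p q r ∧ IsLeft p q l

/-- Going along `γ` from `p` to `q`, the `j`-th diagonal of `T` is crossed before the `k`-th:
its right end is not farther and its left end not nearer, counterclockwise from `p`. -/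
def Triangulation.Precedes {n : ℕ} (T : Triangulation n) (p q : Fin (n + 3))
    (j k : Fin n) : Prop :=
  j ≠ k ∧ ∃ r l r' l' : Fin (n + 3), T.Ends p q j r l ∧ T.Ends p q k r' l' ∧
    (r - p).val ≤ (r' - p).val ∧ (l' - p).val ≤ (l - p).val

/-- The crossed diagonals that precede the `k`-th diagonal along `γ`. Their number is the
position of the tile of the `k`-th diagonal in the snake graph, starting from `0`. -/
noncomputable def Triangulation.before {n : ℕ} (T : Triangulation n) (p q : Fin (n + 3))
    (k : Fin n) : Finset (Fin n) := by
  classical exact Finset.univ.filter fun j => T.Precedes p q j k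

/-- The four corners of the tile of a crossed diagonal `τ_k`, as vertices of the polygon. The two
triangles of `T` at `τ_k` have their third vertices at `sw` (on the side of `p`) and `ne` (on the
side of `q`). The diagonal of the tile goes from `nw` to `se`; the embedding of the quadrilateral
is orientation-preserving for the first tile, and the orientations alternate. -/
def Triangulation.IsTile {n : ℕ} (T : Triangulation n) (p q : Fin (n + 3)) (k : Fin n)
    (sw se ne nw : Fin (n + 3)) : Prop :=
  ∃ r l : Fin (n + 3), T.Ends p q k r l ∧
    (if Even (T.before p q k).card then se = r ∧ nw = l else se = l ∧ nw = r) ∧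
    (∃ i, T.edge i = s(sw, se)) ∧ (∃ i, T.edge i = s(sw, nw)) ∧
    (∃ i, T.edge i = s(se, ne)) ∧ (∃ i, T.edge i = s(nw, ne)) ∧
    ((sw - p).val < (r - p).val ∨ (l - p).val < (sw - p).val) ∧
    ((r - p).val < (ne - p).val ∧ (ne - p).val < (l - p).val)

/-- The displacement from the tile of `τ_k` to the next tile. They are glued along the side of the
triangle `se, ne, nw` of `T` that is neither `τ_k` nor the next crossed diagonal: the next tile
lies to the north if that side is `nw, ne` (so that `γ` leaves through `se, ne`), and to the east
if that side is `se, ne`. -/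
noncomputable def Triangulation.step {n : ℕ} (T : Triangulation n) (p q : Fin (n + 3))
    (k : Fin n) : ℤ × ℤ := by
  classical exact
    if ∃ sw se ne nw, T.IsTile p q k sw se ne nw ∧ Crosses s(p, q) s(se, ne) then (0, 1)
    else (1, 0)

/-- The position in the plane of the south-west corner of the tile of `τ_k`. -/
noncomputable def Triangulation.pos {n : ℕ} (T : Triangulation n) (p q : Fin (n + 3))
    (k : Fin n) : ℤ × ℤ :=
  ∑ j ∈ T.before p q k, T.step p q j

/-- The unit segment `e` of the plane is a side, labelled `i`, of some tile. -/
def Triangulation.SnakeEdge {n : ℕ} (T : Triangulation n) (p q : Fin (n + 3))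
    (e : Sym2 (ℤ × ℤ)) (i : Label n) : Prop :=
  ∃ (k : Fin n) (sw se ne nw : Fin (n + 3)), T.IsTile p q k sw se ne nw ∧
    ((e = s(T.pos p q k, T.pos p q k + (1, 0)) ∧ T.edge i = s(sw, se)) ∨
     (e = s(T.pos p q k + (1, 0), T.pos p q k + (1, 1)) ∧ T.edge i = s(se, ne)) ∨
     (e = s(T.pos p q k + (0, 1), T.pos p q k + (1, 1)) ∧ T.edge i = s(nw, ne)) ∨
     (e = s(T.pos p q k, T.pos p q k + (0, 1)) ∧ T.edge i = s(sw, nw)))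

/-- The vertices of the snake graph: the corners of the tiles. -/
abbrev Triangulation.SnakeVertex {n : ℕ} (T : Triangulation n) (p q : Fin (n + 3)) :=
  {v : ℤ × ℤ // ∃ e i, T.SnakeEdge p q e i ∧ v ∈ e}

/-- The snake graph `G_{T,γ}`; its edges carry the labels given by `SnakeEdge`. -/
def Triangulation.snakeGraph {n : ℕ} (T : Triangulation n) (p q : Fin (n + 3)) :
    SimpleGraph (T.SnakeVertex p q) :=
  SimpleGraph.fromEdgeSet {e | ∃ i, T.SnakeEdge p q (e.map Subtype.val) i}

/-- The characteristic vector of a set of edges of `G_{T,γ}`, given as a subgraph: the coordinate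
`i` is the number of its edges with label `i`. -/
noncomputable def Triangulation.charVec {n : ℕ} (T : Triangulation n) (p q : Fin (n + 3))
    (M : (T.snakeGraph p q).Subgraph) : Label n → ℝ :=
  fun i => ({e ∈ M.edgeSet | T.SnakeEdge p q (e.map Subtype.val) i}.ncard : ℝ)

/-- `P(G_{T,γ})`: the convex hull of the characteristic vectors of all perfect matchings. -/
def Triangulation.matchingPolytope {n : ℕ} (T : Triangulation n) (p q : Fin (n + 3)) :
    Set (Label n → ℝ) :=
  convexHull ℝ {v | ∃ M : (T.snakeGraph p q).Subgraph, M.IsPerfectMatching ∧ v = T.charVec p q M}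

/-- The dimension of a polytope: the dimension of its affine hull. -/
noncomputable def polytopeDim {n : ℕ} (P : Set (Label n → ℝ)) : ℕ :=
  Module.finrank ℝ (affineSpan ℝ P).direction

end SnakePolytope

/-!
The proof reduces both polytopes to one recursion along the arc `γ = pq`.

*Cluster variables are lambda lengths.* Vectors in the plane over the field of rational functions
can be attached to the vertices of the polygon so that their determinants along the edges of `T`
are the initial variables (`exists_isLambdaLength`). The determinants `L e` attached to all arcs
satisfy the Ptolemy relations, which are the Plücker relations. A flip of a triangulation takes
place in a quadrilateral; it mutates the quiver into the quiver of the new triangulation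
(`IsFlip.mutate_B`), and the exchange relation is the Ptolemy relation (`IsFlip.mutate_x`). Hence
every cluster variable that corresponds to `γ` is `L γ` (`IsClusterVariable.eq`). The division in
the mutation rule is legitimate because the rule is subtraction-free (`IsPos`). Conversely, `γ` is
reached by flips, since flipping the first diagonal crossed by `γ` lowers the number of crossings
(`exists_isClusterVariable`).

*The recursion.* Let `τ_0, …, τ_{d-1}` be the crossed diagonals in order. The Ptolemy relation in
the quadrilateral formed by `p` and the triangle beyond `τ_j` expresses `L (p, ne)` by `L (p, se)`
and `L (p, nw)`, where `se`, `ne`, `nw` are corners of the `j`-th tile. No cancellation occurs, so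
the exponents that appear, after multiplication by the variables of the `τ_i`, obey the recursion
`SnakeLabels.weights` (`IsSnake.isExpansion`). The weights of the perfect matchings of the snake
graph obey the same recursion (`IsSnake.matchingPolytope_eq`): a perfect matching contains exactly
one edge between any two consecutive antidiagonals, and it is built up from the south-west corner by
adding one such edge at a time. So the two polytopes are translates of each other.

*The dimension.* In each step of the recursion, the new set is the union of shifted copies of two
sets, one of which contains a translate of the other, and the shifts differ in the coordinate
of a label that has not occurred before. Hence the dimension grows by exactly one
(`latticeDim_union`, `SnakeLabels.IsFresh.latticeDim_totalWeights`).
-/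

namespace SnakePolytope

/-! ### Arcs of the polygon in cyclic coordinates -/

/-- The coordinate of `v` counted from the base vertex `p`, in terms of values. -/
lemma sub_val_eq {n : ℕ} (p v : Fin (n + 3)) :
    (v - p).val = if p.val ≤ v.val then v.val - p.val else v.val + (n + 3) - p.val := by
  have hv := v.isLt
  have hp := p.isLt
  change (n + 3 - p.val + v.val) % (n + 3) = _
  split_ifs with h
  · rw [show n + 3 - p.val + v.val = (v.val - p.val) + (n + 3) by omega, Nat.add_mod_right]
    exact Nat.mod_eq_of_lt (by omega)
  · exact (Nat.mod_eq_of_lt (by omega)).trans (by omega)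

lemma sub_val_lt {n : ℕ} (p v : Fin (n + 3)) : (v - p).val < n + 3 := (v - p).isLt

lemma sub_val_self {n : ℕ} (p : Fin (n + 3)) : (p - p).val = 0 := by simp

lemma sub_val_inj {n : ℕ} {p u v : Fin (n + 3)} : (u - p).val = (v - p).val ↔ u = v := by
  rw [← Fin.ext_iff, sub_left_inj]

/-- Change of the base vertex from `p` to `a`. -/
lemma sub_val_rebase {n : ℕ} (p a v : Fin (n + 3)) :
    (v - a).val = if (a - p).val ≤ (v - p).val then (v - p).val - (a - p).val
      else (v - p).val + (n + 3) - (a - p).val := by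
  rw [← sub_val_eq, sub_sub_sub_cancel_right]

/-- The pairs `{x, y}` and `{u, w}` interleave on the line. -/
def Interleave (x y u w : ℕ) : Prop :=
  (x < u ∧ u < y ∧ (w < x ∨ y < w)) ∨ (y < u ∧ u < x ∧ (w < y ∨ x < w)) ∨
  (x < w ∧ w < y ∧ (u < x ∨ y < u)) ∨ (y < w ∧ w < x ∧ (u < y ∨ x < u))

lemma crosses_iff_val {n : ℕ} (x y u w : Fin (n + 3)) :
    Crosses s(x, y) s(u, w) ↔ Interleave x.val y.val u.val w.val := by
  constructor
  · rintro ⟨a, b, c, d, hab, hbc, hcd, h⟩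
    simp only [Fin.lt_def] at hab hbc hcd
    simp only [Sym2.eq_iff] at h
    unfold Interleave
    rcases h with ⟨⟨rfl, rfl⟩ | ⟨rfl, rfl⟩, ⟨rfl, rfl⟩ | ⟨rfl, rfl⟩⟩ |
      ⟨⟨rfl, rfl⟩ | ⟨rfl, rfl⟩, ⟨rfl, rfl⟩ | ⟨rfl, rfl⟩⟩ <;> omega
  · have key : ∀ x y u w : Fin (n + 3), x < u → u < y → (w < x ∨ y < w) →
        Crosses s(x, y) s(u, w) := by
      intro x y u w h1 h2 h3
      rcases h3 with h3 | h3
      · exact ⟨w, x, u, y, h3, h1, h2, Or.inr ⟨rfl, Sym2.eq_swap⟩⟩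
      · exact ⟨x, u, y, w, h1, h2, h3, Or.inl ⟨rfl, rfl⟩⟩
    rintro (⟨h1, h2, h3⟩ | ⟨h1, h2, h3⟩ | ⟨h1, h2, h3⟩ | ⟨h1, h2, h3⟩)
    · exact key x y u w h1 h2 h3
    · rw [Sym2.eq_swap (a := x)]; exact key y x u w h1 h2 h3
    · rw [Sym2.eq_swap (a := u)]; exact key x y w u h1 h2 h3
    · rw [Sym2.eq_swap (a := u), Sym2.eq_swap (a := x)]; exact key y x w u h1 h2 h3

/-- Crossing of arcs can be read off from the coordinates with respect to any base vertex. -/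
lemma crosses_iff {n : ℕ} (p x y u w : Fin (n + 3)) :
    Crosses s(x, y) s(u, w) ↔
      Interleave (x - p).val (y - p).val (u - p).val (w - p).val := by
  rw [crosses_iff_val]
  have := x.isLt; have := y.isLt; have := u.isLt; have := w.isLt; have := p.isLt
  simp only [sub_val_eq p]
  unfold Interleave
  split_ifs <;> omega

lemma crosses_symm {n : ℕ} {e f : Sym2 (Fin (n + 3))} (h : Crosses e f) : Crosses f e := by
  obtain ⟨a, b, c, d, h1, h2, h3, h⟩ := h
  exact ⟨a, b, c, d, h1, h2, h3, h.symm.imp And.symm And.symm⟩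

lemma succ_sub_val {n : ℕ} (i : Fin (n + 3)) : ((i + 1) - i).val = 1 := by
  simp

lemma not_crosses_boundary {n : ℕ} (e : Sym2 (Fin (n + 3))) (i : Fin (n + 3)) :
    ¬ Crosses e s(i, i + 1) := by
  induction e with | _ x y
  rw [crosses_iff i, succ_sub_val, sub_val_self]
  unfold Interleave
  omega

namespace Triangulation

variable {n : ℕ} (T : Triangulation n)

/-- The segment joining `x` and `y` is a diagonal of `T` or a boundary segment. -/
def IsEdge (x y : Fin (n + 3)) : Prop := ∃ i, T.edge i = s(x, y)

variable {T}

lemma IsEdge.symm {x y : Fin (n + 3)} (h : T.IsEdge x y) : T.IsEdge y x := by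
  obtain ⟨i, hi⟩ := h
  exact ⟨i, hi.trans Sym2.eq_swap⟩

lemma isEdge_succ (i : Fin (n + 3)) : T.IsEdge i (i + 1) := ⟨Sum.inr i, rfl⟩

lemma not_crosses_edge (i j : Label n) : ¬ Crosses (T.edge i) (T.edge j) := by
  rcases j with j | j
  · rcases i with i | i
    · exact T.noncrossing i j
    · exact fun h => not_crosses_boundary _ i (crosses_symm h)
  · exact not_crosses_boundary _ j

/-- Edges of a triangulation do not cross, in coordinates. -/
lemma IsEdge.not_interleave {x y u w : Fin (n + 3)} (h : T.IsEdge x y) (h' : T.IsEdge u w)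
    (p : Fin (n + 3)) :
    ¬ Interleave (x - p).val (y - p).val (u - p).val (w - p).val := by
  obtain ⟨i, hi⟩ := h
  obtain ⟨j, hj⟩ := h'
  rw [← crosses_iff, ← hi, ← hj]
  exact T.not_crosses_edge i j

lemma IsEdge.not_separated {x y u w : Fin (n + 3)} (h : T.IsEdge x y) (h' : T.IsEdge u w)
    (p : Fin (n + 3)) : ¬ ((x - p).val < (u - p).val ∧ (u - p).val < (y - p).val ∧
      ((w - p).val < (x - p).val ∨ (y - p).val < (w - p).val)) :=
  fun hc => h.not_interleave h' p (Or.inl hc)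

lemma ne_of_edge (i : Label n) {x y : Fin (n + 3)} (h : T.edge i = s(x, y)) : x ≠ y := by
  rintro rfl
  rcases i with i | i
  · exact (T.isDiagonal i).1 (by simp [show T.diag i = s(x, x) from h])
  · have h : s(i, i + 1) = s(x, x) := h
    have h1 : i = x ∧ i + 1 = x := by simpa using h
    have := succ_sub_val i
    rw [h1.2, h1.1] at this
    simp at this

lemma IsEdge.ne {x y : Fin (n + 3)} (h : T.IsEdge x y) : x ≠ y := by
  obtain ⟨i, hi⟩ := h
  exact T.ne_of_edge i hi

variable (T)

lemma edge_injective : Function.Injective T.edge := by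
  rintro (i | i) (j | j) h
  · exact congrArg _ (T.injective h)
  · exact absurd h ((T.isDiagonal i).2 j)
  · exact absurd h.symm ((T.isDiagonal j).2 i)
  · have h : s(i, i + 1) = s(j, j + 1) := h
    congr 1
    rw [Sym2.eq_iff] at h
    rcases h with h | ⟨h1, h2⟩
    · exact h.1
    · exfalso
      have h3 := sub_val_rebase j i (i + 1)
      rw [succ_sub_val, h2, h1, succ_sub_val, sub_val_self] at h3
      simp at h3

lemma isEdge_or_crosses {x y : Fin (n + 3)} (h : x ≠ y) :
    T.IsEdge x y ∨ ∃ i, Crosses s(x, y) (T.diag i) := by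
  by_cases hd : IsDiagonal s(x, y)
  · by_cases hc : ∃ i, Crosses s(x, y) (T.diag i)
    · exact Or.inr hc
    · left
      obtain ⟨i, hi⟩ := T.maximal _ hd (not_exists.1 hc)
      exact ⟨Sum.inl i, hi⟩
  · left
    have : ∃ i, s(x, y) = s(i, i + 1) := by
      by_contra hc
      exact hd ⟨by simpa using h, not_exists.1 hc⟩
    obtain ⟨i, hi⟩ := this
    exact ⟨Sum.inr i, hi.symm⟩

variable {T}

/-- Every edge `ab` with further vertices on its right is the side of a triangle of `T` on that
side. The third vertex is the last neighbour of `a` before `b`. -/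
lemma IsEdge.exists_apex {a b : Fin (n + 3)} (h : T.IsEdge a b) (hab : 1 < (b - a).val) :
    ∃ c, 0 < (c - a).val ∧ (c - a).val < (b - a).val ∧ T.IsEdge a c ∧ T.IsEdge c b := by
  classical
  let S : Finset (Fin (n + 3)) := Finset.univ.filter fun c =>
    0 < (c - a).val ∧ (c - a).val < (b - a).val ∧ T.IsEdge a c
  have hS : S.Nonempty := ⟨a + 1, by
    simp only [S, Finset.mem_filter, Finset.mem_univ, true_and, succ_sub_val]
    exact ⟨one_pos, hab, isEdge_succ a⟩⟩
  obtain ⟨c, hc, hmax⟩ := S.exists_max_image (fun c => (c - a).val) hS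
  simp only [S, Finset.mem_filter, Finset.mem_univ, true_and] at hc hmax
  refine ⟨c, hc.1, hc.2.1, hc.2.2, ?_⟩
  have hcb : c ≠ b := fun e => by rw [e] at hc; exact lt_irrefl _ hc.2.1
  rcases T.isEdge_or_crosses hcb with he | ⟨i, hi⟩
  · exact he
  · exfalso
    obtain ⟨u, w, hi'⟩ : ∃ u w, T.diag i = s(u, w) := by
      induction h : T.diag i with | _ u w
      exact ⟨u, w, rfl⟩
    rw [hi', crosses_iff a] at hi
    have key : ∀ u w, T.IsEdge u w → (c - a).val < (u - a).val → (u - a).val < (b - a).val →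
        ((w - a).val < (c - a).val ∨ (b - a).val < (w - a).val) → False := by
      intro u w huw h1 h2 h3
      have h4 := h.not_separated huw a
      have h5 := hc.2.2.not_separated huw.symm a
      have h6 := sub_val_self a
      have h7 : w ≠ a := by
        rintro rfl
        have := hmax u ⟨by omega, h2, huw.symm⟩
        omega
      rw [Ne, ← sub_val_inj (p := a)] at h7
      omega
    have huw : T.IsEdge u w := ⟨Sum.inl i, hi'⟩
    rcases hi with hi | hi | hi | hi
    · exact key u w huw hi.1 hi.2.1 hi.2.2
    · omega
    · exact key w u huw.symm hi.1 hi.2.1 hi.2.2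
    · omega

/-- Two triangles of `T` on the same side of a common edge coincide. -/
lemma apex_unique {a b c c' : Fin (n + 3)} (h1 : T.IsEdge a c) (h2 : T.IsEdge c b)
    (h1' : T.IsEdge a c') (h2' : T.IsEdge c' b)
    (hc : (c - a).val < (b - a).val) (hc' : (c' - a).val < (b - a).val) : c = c' := by
  rw [← sub_val_inj (p := a)]
  have h3 := h1.not_interleave h2' a
  have h4 := h2.not_interleave h1' a
  have h5 := h1.ne; have h6 := h1'.ne
  rw [Ne, ← sub_val_inj (p := a), sub_val_self] at h5 h6
  rw [sub_val_self] at h3 h4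
  unfold Interleave at h3 h4
  omega

end Triangulation

/-! ### Lambda lengths -/

/-- A system of lambda lengths on the arcs of the polygon: the edges of `T` have the lengths `x`,
and every quadrilateral satisfies the Ptolemy relation. -/
structure IsLambdaLength {n : ℕ} {K : Type*} [Field K] (T : Triangulation n) (x : Label n → K)
    (L : Sym2 (Fin (n + 3)) → K) : Prop where
  edge : ∀ i, L (T.edge i) = x i
  ptolemy : ∀ p a b c d : Fin (n + 3), (a - p).val < (b - p).val → (b - p).val < (c - p).val →
    (c - p).val < (d - p).val →
    L s(a, c) * L s(b, d) = L s(a, b) * L s(c, d) + L s(b, c) * L s(a, d)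

/-- The determinant of two plane vectors. -/
def det₂ {K : Type*} [Field K] (v w : K × K) : K := v.1 * w.2 - v.2 * w.1

/-- Vectors at the vertices from `a` to `b` whose determinants along the edges of `T` are
prescribed: the vector at the apex of the triangle on `ab` is determined by its determinants with
the vectors at `a` and `b`, and the two remaining sides are treated in the same way. -/
lemma exists_vectors_between {n : ℕ} {K : Type*} [Field K] (T : Triangulation n)
    (x : Label n → K) (hx : ∀ i, x i ≠ 0) (m : ℕ) :
    ∀ (a b : Fin (n + 3)) (i : Label n), a < b → b.val - a.val ≤ m → T.edge i = s(a, b) →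
      ∀ va vb : K × K, det₂ va vb = x i →
        ∃ v : Fin (n + 3) → K × K, v a = va ∧ v b = vb ∧
          ∀ j u w, a ≤ u → u < w → w ≤ b → T.edge j = s(u, w) → det₂ (v u) (v w) = x j := by
  induction m with
  | zero => intro a b i hab h; omega
  | succ m ih =>
    intro a b i hab hm hi va vb hdet
    have hsub : ∀ v : Fin (n + 3), a ≤ v → (v - a).val = v.val - a.val := fun v hv => by
      rw [sub_val_eq, if_pos (Fin.le_def.1 hv)]
    have hb := hsub b hab.le
    have hedge : T.IsEdge a b := ⟨i, hi⟩
    rcases Nat.lt_or_ge 1 (b - a).val with h1 | h1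
    · obtain ⟨c, hc1, hc2, ⟨i₁, hac⟩, ⟨i₂, hcb⟩⟩ := hedge.exists_apex h1
      have hc : a < c ∧ c < b := by
        rw [sub_val_eq] at hc1 hc2
        split_ifs at hc1 hc2 <;> constructor <;> omega
      let vc : K × K := (x i)⁻¹ • (x i₂ • va + x i₁ • vb)
      have hac' : det₂ va vc = x i₁ := by
        have : det₂ va vc = (x i)⁻¹ * (x i₁ * det₂ va vb) := by
          simp only [vc, det₂, Prod.smul_fst, Prod.smul_snd, Prod.fst_add, Prod.snd_add,
            smul_eq_mul]
          ring
        rw [this, hdet]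
        field_simp [hx i]
      have hcb' : det₂ vc vb = x i₂ := by
        have : det₂ vc vb = (x i)⁻¹ * (x i₂ * det₂ va vb) := by
          simp only [vc, det₂, Prod.smul_fst, Prod.smul_snd, Prod.fst_add, Prod.snd_add,
            smul_eq_mul]
          ring
        rw [this, hdet]
        field_simp [hx i]
      obtain ⟨v₁, hv₁a, hv₁c, hv₁⟩ := ih a c i₁ hc.1 (by omega) hac va vc hac'
      obtain ⟨v₂, hv₂c, hv₂b, hv₂⟩ := ih c b i₂ hc.2 (by omega) hcb vc vb hcb'
      refine ⟨fun u => if u ≤ c then v₁ u else v₂ u, by simp [hc.1.le, hv₁a],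
        by simp [not_le.2 hc.2, hv₂b], ?_⟩
      intro j u w hau huw hwb hj
      have huwE : T.IsEdge u w := ⟨j, hj⟩
      rcases le_or_gt w c with hwc | hwc
      · simp only [(huw.le.trans hwc), hwc, if_true]
        exact hv₁ j u w hau huw hwc hj
      rcases le_or_gt c u with hcu | hcu
      · have hu : (if u ≤ c then v₁ u else v₂ u) = v₂ u := by
          split_ifs with h
          · rw [le_antisymm h hcu, hv₁c, hv₂c]
          · rfl
        simp only [hu, not_le.2 hwc, if_false]
        exact hv₂ j u w hcu huw hwb hj
      -- An edge separated by `c` does not cross `ac` and `cb`, hence joins `a` to `b`.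
      · have h2 : u = a := by
          have := Triangulation.IsEdge.not_separated (T := T) (⟨i₁, hac⟩ : T.IsEdge a c) huwE a
          rw [hsub u hau, hsub w (hau.trans huw.le), hsub c hc.1.le, sub_val_self] at this
          omega
        have h3 : w = b := by
          have := Triangulation.IsEdge.not_separated (T := T) (⟨i₂, hcb⟩ : T.IsEdge c b) huwE.symm a
          rw [hsub u hau, hsub w (hau.trans huw.le), hsub c hc.1.le, hsub b hab.le] at this
          omega
        subst h2 h3
        have : j = i := T.edge_injective (hj.trans hi.symm)
        simp only [hc.1.le, not_le.2 hwc, if_true, if_false, hv₁a, hv₂b, this, hdet]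
    · refine ⟨fun u => if u = a then va else vb, by simp, by simp [hab.ne'], ?_⟩
      intro j u w hau huw hwb hj
      have h2 : u = a := by omega
      have h3 : w = b := by omega
      subst h2 h3
      have : j = i := T.edge_injective (hj.trans hi.symm)
      simp [hab.ne', this, hdet]

/-- Lambda lengths with prescribed nonzero values on `T` exist; they are determinants of pairs of
plane vectors, so that the Ptolemy relation is the Plücker relation. -/
lemma exists_isLambdaLength {n : ℕ} {K : Type*} [Field K] (T : Triangulation n)
    (x : Label n → K) (hx : ∀ i, x i ≠ 0) : ∃ L, IsLambdaLength T x L := by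
  have hlast : T.edge (Sum.inr (Fin.last (n + 2))) = s(0, Fin.last (n + 2)) := by
    change s(Fin.last (n + 2), Fin.last (n + 2) + 1) = _
    rw [Fin.last_add_one, Sym2.eq_swap]
  obtain ⟨v, -, -, hv⟩ := exists_vectors_between T x hx (n + 3) 0 (Fin.last (n + 2)) _
    (by simp [Fin.lt_def]) (by simp) hlast (x (Sum.inr (Fin.last (n + 2))), 0) (0, 1)
    (by simp [det₂])
  let L : Sym2 (Fin (n + 3)) → K := fun e => det₂ (v e.inf) (v e.sup)
  have hL : ∀ a b, a < b → L s(a, b) = det₂ (v a) (v b) := fun a b h => by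
    simp [L, inf_of_le_left h.le, sup_of_le_right h.le]
  have hpt : ∀ a b c d, a < b → b < c → c < d →
      L s(a, c) * L s(b, d) = L s(a, b) * L s(c, d) + L s(b, c) * L s(a, d) := by
    intro a b c d h1 h2 h3
    rw [hL a c (h1.trans h2), hL b d (h2.trans h3), hL a b h1, hL c d h3, hL b c h2,
      hL a d (h1.trans (h2.trans h3))]
    simp only [det₂]
    ring
  refine ⟨L, ?_, ?_⟩
  · intro i
    obtain ⟨a, b, hab⟩ : ∃ a b, T.edge i = s(a, b) := by
      induction h : T.edge i with | _ u w
      exact ⟨u, w, rfl⟩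
    have key : ∀ a b, a < b → T.edge i = s(a, b) → L (T.edge i) = x i := fun a b h hab => by
      rw [hab, hL a b h]
      exact hv i a b (Fin.zero_le _) h (Fin.le_last _) hab
    rcases lt_or_gt_of_ne (T.ne_of_edge i hab) with h | h
    · exact key a b h hab
    · exact key b a h (hab.trans Sym2.eq_swap)
  · intro p a b c d h1 h2 h3
    -- The four vertices are in increasing order up to a cyclic rotation.
    have : (a < b ∧ b < c ∧ c < d) ∨ (b < c ∧ c < d ∧ d < a) ∨ (c < d ∧ d < a ∧ a < b) ∨
        (d < a ∧ a < b ∧ b < c) := by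
      have := a.isLt; have := b.isLt; have := c.isLt; have := d.isLt; have := p.isLt
      simp only [sub_val_eq p] at h1 h2 h3
      split_ifs at h1 h2 h3 <;> omega
    rcases this with ⟨h1, h2, h3⟩ | ⟨h1, h2, h3⟩ | ⟨h1, h2, h3⟩ | ⟨h1, h2, h3⟩
    · exact hpt a b c d h1 h2 h3
    · have := hpt b c d a h1 h2 h3
      rw [Sym2.eq_swap (a := a) (b := c), Sym2.eq_swap (a := a) (b := b),
        Sym2.eq_swap (a := a) (b := d)]
      linear_combination this
    · have := hpt c d a b h1 h2 h3
      rw [Sym2.eq_swap (a := a) (b := c), Sym2.eq_swap (a := b) (b := d),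
        Sym2.eq_swap (a := b) (b := c), Sym2.eq_swap (a := a) (b := d)]
      linear_combination this
    · have := hpt d a b c h1 h2 h3
      rw [Sym2.eq_swap (a := b) (b := d), Sym2.eq_swap (a := c) (b := d),
        Sym2.eq_swap (a := a) (b := d)]
      linear_combination this

lemma IsLambdaLength.eq_of_edge {n : ℕ} {K : Type*} [Field K] {T : Triangulation n}
    {x : Label n → K} {L : Sym2 (Fin (n + 3)) → K} (hL : IsLambdaLength T x L) {i : Label n}
    {u w : Fin (n + 3)} (h : T.edge i = s(u, w)) : L s(u, w) = x i := by
  rw [← h, hL.edge]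

/-! ### Flips -/

lemma sym2_eq_iff_coord {n : ℕ} (p x y u w : Fin (n + 3)) : s(x, y) = s(u, w) ↔
    ((x - p).val = (u - p).val ∧ (y - p).val = (w - p).val) ∨
      ((x - p).val = (w - p).val ∧ (y - p).val = (u - p).val) := by
  simp only [sub_val_inj, Sym2.eq_iff]

/-- The edges `e₁, …, e₄` of `T` are the sides `ab`, `bc`, `cd`, `da` of a convex quadrilateral,
with vertices in counterclockwise order, whose diagonal `ac` is the `k`-th diagonal of `T`. -/
structure IsQuad {n : ℕ} (T : Triangulation n) (k : Fin n) (a b c d : Fin (n + 3))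
    (e₁ e₂ e₃ e₄ : Label n) : Prop where
  lt₁ : 0 < (b - a).val
  lt₂ : (b - a).val < (c - a).val
  lt₃ : (c - a).val < (d - a).val
  diag : T.diag k = s(a, c)
  edge₁ : T.edge e₁ = s(a, b)
  edge₂ : T.edge e₂ = s(b, c)
  edge₃ : T.edge e₃ = s(c, d)
  edge₄ : T.edge e₄ = s(d, a)

/-- A diagonal is not a side of the polygon, hence has vertices on either side. -/
lemma one_lt_of_diag {n : ℕ} {a c : Fin (n + 3)} (h : IsDiagonal s(a, c)) :
    1 < (c - a).val := by
  by_contra hc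
  have h0 : (c - a).val ≠ 0 := by
    rw [← sub_val_self a, Ne, sub_val_inj]
    rintro rfl
    exact h.1 (by simp)
  apply h.2 a
  rw [sym2_eq_iff_coord a, succ_sub_val]
  exact Or.inl ⟨rfl, by omega⟩

lemma exists_isQuad {n : ℕ} (T : Triangulation n) (k : Fin n) :
    ∃ a b c d e₁ e₂ e₃ e₄, IsQuad T k a b c d e₁ e₂ e₃ e₄ := by
  obtain ⟨a, c, hac⟩ : ∃ a c, T.diag k = s(a, c) := by
    induction h : T.diag k with | _ u w
    exact ⟨u, w, rfl⟩
  have hE : T.IsEdge a c := ⟨Sum.inl k, hac⟩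
  have h1 := one_lt_of_diag (hac ▸ T.isDiagonal k)
  have h2 := one_lt_of_diag ((hac.trans Sym2.eq_swap) ▸ T.isDiagonal k)
  obtain ⟨b, hb0, hb1, ⟨e₁, he₁⟩, ⟨e₂, he₂⟩⟩ := hE.exists_apex h1
  obtain ⟨d, hd0, hd1, ⟨e₃, he₃⟩, ⟨e₄, he₄⟩⟩ := hE.symm.exists_apex h2
  refine ⟨a, b, c, d, e₁, e₂, e₃, e₄, hb0, hb1, ?_, hac, he₁, he₂, he₃, he₄⟩
  rw [sub_val_rebase a c d] at hd0 hd1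
  rw [sub_val_rebase a c a, sub_val_self] at hd1
  split_ifs at hd0 hd1 <;> omega

namespace IsQuad

variable {n : ℕ} {T T' : Triangulation n} {k : Fin n} {a b c d : Fin (n + 3)}
  {e₁ e₂ e₃ e₄ : Label n}

/-- A quadrilateral may be read from the other end of its diagonal. -/
lemma halfTurn (h : IsQuad T k a b c d e₁ e₂ e₃ e₄) : IsQuad T k c d a b e₃ e₄ e₁ e₂ := by
  have h1 := h.lt₁; have h2 := h.lt₂; have h3 := h.lt₃
  have h4 := sub_val_lt a d
  refine ⟨?_, ?_, ?_, h.diag.trans Sym2.eq_swap, h.edge₃, h.edge₄, h.edge₁, h.edge₂⟩ <;>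
    simp only [sub_val_rebase a c, sub_val_self] <;> split_ifs <;> omega

/-- The other diagonal of the quadrilateral is the only diagonal of the polygon that crosses the
first one and none of the sides. -/
lemma eq_of_crosses (h : IsQuad T k a b c d e₁ e₂ e₃ e₄) {e : Sym2 (Fin (n + 3))}
    (hc : Crosses e (T.diag k)) (h1 : ¬ Crosses e (T.edge e₁)) (h2 : ¬ Crosses e (T.edge e₂))
    (h3 : ¬ Crosses e (T.edge e₃)) (h4 : ¬ Crosses e (T.edge e₄)) : e = s(b, d) := by
  induction e with | _ u w
  rw [h.edge₁, crosses_iff a] at h1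
  rw [h.edge₂, crosses_iff a] at h2
  rw [h.edge₃, crosses_iff a] at h3
  rw [h.edge₄, crosses_iff a] at h4
  rw [h.diag, crosses_iff a] at hc
  have := h.lt₁; have := h.lt₂; have := h.lt₃
  rw [sym2_eq_iff_coord a]
  have h0 := sub_val_self a
  unfold Interleave at *
  rcases hc with hc | hc | hc | hc
  · right; omega
  · left; omega
  · left; omega
  · right; omega

lemma crosses_other (h : IsQuad T k a b c d e₁ e₂ e₃ e₄) : Crosses s(b, d) s(a, c) := by
  rw [crosses_iff a]
  have := h.lt₁; have := h.lt₂; have := h.lt₃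
  have h0 := sub_val_self a
  unfold Interleave
  omega

lemma labels_ne (h : IsQuad T k a b c d e₁ e₂ e₃ e₄) :
    e₁ ≠ Sum.inl k ∧ e₂ ≠ Sum.inl k ∧ e₁ ≠ e₂ ∧ e₁ ≠ e₃ ∧ e₁ ≠ e₄ ∧ e₂ ≠ e₃ := by
  have := h.lt₁; have := h.lt₂; have := h.lt₃
  have h0 := sub_val_self a
  have hk : T.edge (Sum.inl k) = s(a, c) := h.diag
  refine ⟨?_, ?_, ?_, ?_, ?_, ?_⟩ <;> intro he <;> have he := congrArg T.edge he <;>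
    simp only [h.edge₁, h.edge₂, h.edge₃, h.edge₄, hk] at he <;>
    rw [sym2_eq_iff_coord a] at he <;> omega

lemma isDiagonal_other (h : IsQuad T k a b c d e₁ e₂ e₃ e₄) : IsDiagonal s(b, d) := by
  have hc := h.crosses_other
  refine ⟨?_, fun i hi => not_crosses_boundary _ i (hi ▸ crosses_symm hc)⟩
  intro hd
  have hd : b = d := by simpa using hd
  have h2 := h.lt₂; have h3 := h.lt₃
  rw [hd] at h2
  omega

/-- The other diagonal crosses no other diagonal of `T`. -/
lemma not_crosses_other (h : IsQuad T k a b c d e₁ e₂ e₃ e₄) {i : Label n}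
    (hi : i ≠ Sum.inl k) : ¬ Crosses s(b, d) (T.edge i) := by
  obtain ⟨u, w, huw⟩ : ∃ u w, T.edge i = s(u, w) := by
    induction h : T.edge i with | _ u w
    exact ⟨u, w, rfl⟩
  have key : ∀ u w, T.edge i = s(u, w) →
      ¬ ((b - a).val < (u - a).val ∧ (u - a).val < (d - a).val ∧
        ((w - a).val < (b - a).val ∨ (d - a).val < (w - a).val)) := by
    rintro u w huw ⟨g1, g2, g3⟩
    have hu : T.IsEdge u w := ⟨i, huw⟩
    have h1 := Triangulation.IsEdge.not_separated ⟨_, h.edge₂⟩ hu a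
    have h2 := Triangulation.IsEdge.not_separated ⟨_, h.edge₃⟩ hu a
    have h3 := Triangulation.IsEdge.not_separated (T := T) ⟨_, h.edge₁⟩ hu.symm a
    have h4 := hu.not_interleave ⟨_, h.edge₄⟩ a
    have := h.lt₁; have := h.lt₂; have := h.lt₃
    have h0 := sub_val_self a
    have h5 : s(u, w) ≠ s(a, c) := fun hh =>
      hi (T.edge_injective (huw.trans (hh.trans h.diag.symm)))
    rw [Ne, sym2_eq_iff_coord a] at h5
    have h6 : (u - a).val = (c - a).val := by omega
    unfold Interleave at h4
    omega
  have := h.lt₂; have := h.lt₃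
  rw [huw, crosses_iff a]
  rintro (hc | hc | hc | hc)
  · exact key u w huw hc
  · omega
  · exact key w u (huw.trans Sym2.eq_swap) hc
  · omega

end IsQuad

lemma IsFlip.edge_eq {n : ℕ} {T T' : Triangulation n} {k : Fin n} (hf : IsFlip k T T')
    {i : Label n} (hi : i ≠ Sum.inl k) : T'.edge i = T.edge i := by
  rcases i with i | i
  · exact hf.2 i fun h => hi (congrArg _ h)
  · rfl

/-- A flip replaces one diagonal of a quadrilateral by the other one. -/
lemma IsFlip.diag_eq {n : ℕ} {T T' : Triangulation n} {k : Fin n} (hf : IsFlip k T T')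
    {a b c d : Fin (n + 3)} {e₁ e₂ e₃ e₄ : Label n} (h : IsQuad T k a b c d e₁ e₂ e₃ e₄) :
    T'.diag k = s(b, d) := by
  have hcross : ∀ i, i ≠ Sum.inl k → ¬ Crosses (T'.diag k) (T.edge i) := fun i hi => by
    rw [← hf.edge_eq hi]
    exact T'.not_crosses_edge (Sum.inl k) i
  have hne := h.labels_ne
  have hne' := h.halfTurn.labels_ne
  refine h.eq_of_crosses ?_ (hcross _ hne.1) (hcross _ hne.2.1) (hcross _ hne'.1)
    (hcross _ hne'.2.1)
  by_contra hc
  obtain ⟨i, hi⟩ := T.maximal (T'.diag k) (T'.isDiagonal k) (fun i => by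
    by_cases hik : i = k
    · rwa [hik]
    · exact hcross (Sum.inl i) (by simpa using hik))
  by_cases hik : i = k
  · exact hf.1 (hik ▸ hi.symm)
  · exact hik (T'.injective ((hf.2 i hik).trans hi))

lemma IsQuad.flip {n : ℕ} {T T' : Triangulation n} {k : Fin n} (hf : IsFlip k T T')
    {a b c d : Fin (n + 3)} {e₁ e₂ e₃ e₄ : Label n} (h : IsQuad T k a b c d e₁ e₂ e₃ e₄) :
    IsQuad T' k b c d a e₂ e₃ e₄ e₁ := by
  have hne := h.labels_ne
  have hne' := h.halfTurn.labels_ne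
  have h1 := h.lt₁; have h2 := h.lt₂; have h3 := h.lt₃
  have h4 := sub_val_lt a d
  refine ⟨?_, ?_, ?_, hf.diag_eq h, (hf.edge_eq hne.2.1).trans h.edge₂,
    (hf.edge_eq hne'.1).trans h.edge₃, (hf.edge_eq hne'.2.1).trans h.edge₄,
    (hf.edge_eq hne.1).trans h.edge₁⟩ <;>
    simp only [sub_val_rebase a b, sub_val_self] <;> split_ifs <;> omega

/-- Every diagonal can be flipped. -/
lemma IsQuad.exists_flip {n : ℕ} {T : Triangulation n} {k : Fin n}
    {a b c d : Fin (n + 3)} {e₁ e₂ e₃ e₄ : Label n} (h : IsQuad T k a b c d e₁ e₂ e₃ e₄) :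
    ∃ T' : Triangulation n, IsFlip k T T' := by
  classical
  have hother : ∀ i, s(b, d) ≠ T.diag i := fun i hi =>
    T.noncrossing i k (hi ▸ h.diag ▸ h.crosses_other)
  have hup : ∀ i, i ≠ k → Function.update T.diag k s(b, d) i = T.diag i := fun i hi =>
    Function.update_of_ne hi _ _
  have hupk : Function.update T.diag k s(b, d) k = s(b, d) := Function.update_self _ _ _
  have hnc : ∀ i, i ≠ k → ¬ Crosses s(b, d) (T.diag i) := fun i hi =>
    h.not_crosses_other (i := Sum.inl i) (by simpa using hi)
  have hself : ¬ Crosses s(b, d) s(b, d) := by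
    rw [crosses_iff a]
    unfold Interleave
    omega
  have hne := h.labels_ne
  have hne' := h.halfTurn.labels_ne
  refine ⟨⟨Function.update T.diag k s(b, d), ?_, ?_, ?_, ?_⟩, ?_, fun j hj => hup j hj⟩
  · intro i j hij
    by_cases hi : i = k <;> by_cases hj : j = k
    · rw [hi, hj]
    · rw [hi, hupk, hup j hj] at hij
      exact absurd hij (hother j)
    · rw [hj, hupk, hup i hi] at hij
      exact absurd hij.symm (hother i)
    · rw [hup i hi, hup j hj] at hij
      exact T.injective hij
  · intro i
    by_cases hi : i = k
    · rw [hi, hupk]; exact h.isDiagonal_other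
    · rw [hup i hi]; exact T.isDiagonal i
  · intro i j
    by_cases hi : i = k <;> by_cases hj : j = k
    · rw [hi, hj, hupk]; exact hself
    · rw [hi, hupk, hup j hj]; exact hnc j hj
    · rw [hj, hupk, hup i hi]; exact fun hc => hnc i hi (crosses_symm hc)
    · rw [hup i hi, hup j hj]; exact T.noncrossing i j
  · intro e he hec
    have hE : ∀ i, i ≠ Sum.inl k → ¬ Crosses e (T.edge i) := by
      rintro (i | i) hi
      · have hik : i ≠ k := by simpa using hi
        have := hec i
        rwa [hup i hik] at this
      · exact not_crosses_boundary e i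
    by_cases hc : Crosses e (T.diag k)
    · exact ⟨k, hupk.trans
        (h.eq_of_crosses hc (hE _ hne.1) (hE _ hne.2.1) (hE _ hne'.1) (hE _ hne'.2.1)).symm⟩
    · obtain ⟨i, hi⟩ := T.maximal e he fun i => by
        by_cases hi : i = k
        · rwa [hi]
        · exact hE (Sum.inl i) (by simpa using hi)
      by_cases hik : i = k
      · have hcr := hec k
        rw [hupk, ← hi, hik, h.diag] at hcr
        exact absurd (crosses_symm h.crosses_other) hcr
      · exact ⟨i, (hup i hik).trans hi⟩
  · change Function.update T.diag k s(b, d) k ≠ T.diag k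
    rw [hupk]
    exact hother k

/-! ### Quiver mutation and flips -/

section Arrows

variable {n : ℕ} {T T' : Triangulation n}

/-- `T.Tri i j l`: the edges `i`, `j`, `l` are the sides `xy`, `xz`, `yz` of a triangle `x y z` with
vertices in counterclockwise order. -/
def Triangulation.Tri (T : Triangulation n) (i j l : Label n) : Prop :=
  ∃ x y z : Fin (n + 3), 0 < (y - x).val ∧ (y - x).val < (z - x).val ∧
    T.edge i = s(x, y) ∧ T.edge j = s(x, z) ∧ T.edge l = s(y, z)

lemma arrow_iff (i j : Label n) : T.Arrow i j ↔ ∃ l, T.Tri i j l := by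
  constructor
  · rintro ⟨a, b, c, hab, hbc, ⟨l₁, h₁⟩, ⟨l₂, h₂⟩, ⟨l₃, h₃⟩, h⟩
    simp only [Fin.lt_def] at hab hbc
    have ha := a.isLt; have hb := b.isLt; have hc := c.isLt
    rcases h with ⟨hi, hj⟩ | ⟨hi, hj⟩ | ⟨hi, hj⟩
    · refine ⟨l₂, a, b, c, ?_, ?_, hi, hj.trans Sym2.eq_swap, h₂⟩ <;>
        simp only [sub_val_eq] <;> split_ifs <;> omega
    · refine ⟨l₁, c, a, b, ?_, ?_, hi, hj.trans Sym2.eq_swap, h₁⟩ <;>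
        simp only [sub_val_eq] <;> split_ifs <;> omega
    · refine ⟨l₃, b, c, a, ?_, ?_, hi, hj.trans Sym2.eq_swap, h₃⟩ <;>
        simp only [sub_val_eq] <;> split_ifs <;> omega
  · rintro ⟨l, x, y, z, h0, h1, hi, hj, hl⟩
    have hx := x.isLt; have hy := y.isLt; have hz := z.isLt
    have : (x < y ∧ y < z) ∨ (y < z ∧ z < x) ∨ (z < x ∧ x < y) := by
      simp only [sub_val_eq] at h0 h1
      split_ifs at h0 h1 <;> omega
    rcases this with ⟨g0, g1⟩ | ⟨g0, g1⟩ | ⟨g0, g1⟩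
    · exact ⟨x, y, z, g0, g1, ⟨i, hi⟩, ⟨l, hl⟩, ⟨j, hj.trans Sym2.eq_swap⟩,
        Or.inl ⟨hi, hj.trans Sym2.eq_swap⟩⟩
    · exact ⟨y, z, x, g0, g1, ⟨l, hl⟩, ⟨j, hj.trans Sym2.eq_swap⟩, ⟨i, hi⟩,
        Or.inr (Or.inl ⟨hi, hj.trans Sym2.eq_swap⟩)⟩
    · exact ⟨z, x, y, g0, g1, ⟨j, hj.trans Sym2.eq_swap⟩, ⟨i, hi⟩, ⟨l, hl⟩,
        Or.inr (Or.inr ⟨hi, hj.trans Sym2.eq_swap⟩)⟩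

lemma Triangulation.Tri.rotate {i j l : Label n} (h : T.Tri i j l) : T.Tri j l i := by
  obtain ⟨x, y, z, h0, h1, hi, hj, hl⟩ := h
  have h2 := sub_val_lt x z
  refine ⟨z, x, y, ?_, ?_, hj.trans Sym2.eq_swap, hl.trans Sym2.eq_swap, hi⟩ <;>
    simp only [sub_val_rebase x z, sub_val_self] <;> split_ifs <;> omega

variable {k : Fin n} {a b c d : Fin (n + 3)} {e₁ e₂ e₃ e₄ : Label n}

/-- The triangles at the diagonal of a quadrilateral are the two halves of the quadrilateral. -/
lemma IsQuad.tri_iff (h : IsQuad T k a b c d e₁ e₂ e₃ e₄) (i l : Label n) :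
    T.Tri i (Sum.inl k) l ↔ (i = e₁ ∧ l = e₂) ∨ (i = e₃ ∧ l = e₄) := by
  have main : ∀ {a b c d : Fin (n + 3)} {e₁ e₂ e₃ e₄ : Label n},
      IsQuad T k a b c d e₁ e₂ e₃ e₄ → ∀ y, 0 < (y - a).val → (y - a).val < (c - a).val →
        T.edge i = s(a, y) → T.edge l = s(y, c) → i = e₁ ∧ l = e₂ := by
    intro a b c d e₁ e₂ e₃ e₄ h y h0 h1 hi hl
    have hy : y = b := Triangulation.apex_unique (T := T) ⟨_, hi⟩ ⟨_, hl⟩ ⟨_, h.edge₁⟩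
      ⟨_, h.edge₂⟩ h1 h.lt₂
    subst hy
    exact ⟨T.edge_injective (hi.trans h.edge₁.symm), T.edge_injective (hl.trans h.edge₂.symm)⟩
  constructor
  · rintro ⟨x, y, z, h0, h1, hi, hj, hl⟩
    rw [show T.edge (Sum.inl k) = s(a, c) from h.diag, Sym2.eq_iff] at hj
    rcases hj with ⟨rfl, rfl⟩ | ⟨rfl, rfl⟩
    · exact Or.inl (main h y h0 h1 hi hl)
    · exact Or.inr (main h.halfTurn y h0 h1 hi hl)
  · rintro (⟨rfl, rfl⟩ | ⟨rfl, rfl⟩)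
    · exact ⟨a, b, c, h.lt₁, h.lt₂, h.edge₁, h.diag, h.edge₂⟩
    · have := h.halfTurn
      exact ⟨c, d, a, this.lt₁, this.lt₂, this.edge₁, this.diag, this.edge₂⟩

lemma IsQuad.arrow_to (h : IsQuad T k a b c d e₁ e₂ e₃ e₄) (i : Label n) :
    T.Arrow i (Sum.inl k) ↔ i = e₁ ∨ i = e₃ := by
  simp [arrow_iff, h.tri_iff, exists_or]

lemma IsQuad.arrow_from (h : IsQuad T k a b c d e₁ e₂ e₃ e₄) (i : Label n) :
    T.Arrow (Sum.inl k) i ↔ i = e₂ ∨ i = e₄ := by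
  have : ∀ l, T.Tri (Sum.inl k) i l ↔ T.Tri l (Sum.inl k) i := fun l =>
    ⟨fun h => h.rotate.rotate, fun h => h.rotate⟩
  simp [arrow_iff, this, h.tri_iff, exists_or]

/-- An arrow between two edges other than `k` either comes from a triangle at `k`, or it comes
from a triangle without `k`. -/
lemma IsQuad.arrow_cases (h : IsQuad T k a b c d e₁ e₂ e₃ e₄) {i j : Label n} :
    T.Arrow i j ↔ ((i = e₂ ∧ j = e₁) ∨ (i = e₄ ∧ j = e₃)) ∨
      ∃ l, l ≠ Sum.inl k ∧ T.Tri i j l := by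
  have hk : T.Tri i j (Sum.inl k) ↔ (i = e₂ ∧ j = e₁) ∨ (i = e₄ ∧ j = e₃) := by
    have : T.Tri i j (Sum.inl k) ↔ T.Tri j (Sum.inl k) i :=
      ⟨fun h => h.rotate, fun h => h.rotate.rotate⟩
    rw [this, h.tri_iff]
    tauto
  rw [arrow_iff, ← hk]
  constructor
  · rintro ⟨l, hl⟩
    by_cases hlk : l = Sum.inl k
    · exact Or.inl (hlk ▸ hl)
    · exact Or.inr ⟨l, hlk, hl⟩
  · rintro (h | ⟨l, -, hl⟩)
    · exact ⟨_, h⟩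
    · exact ⟨l, hl⟩

lemma IsFlip.tri_iff (hf : IsFlip k T T') {i j l : Label n} (hi : i ≠ Sum.inl k)
    (hj : j ≠ Sum.inl k) (hl : l ≠ Sum.inl k) : T'.Tri i j l ↔ T.Tri i j l := by
  unfold Triangulation.Tri
  rw [hf.edge_eq hi, hf.edge_eq hj, hf.edge_eq hl]

/-- No triangle other than the halves of a quadrilateral has two of its sides. -/
lemma IsQuad.not_tri (h : IsQuad T k a b c d e₁ e₂ e₃ e₄) {i j l : Label n}
    (hi : i = e₁ ∨ i = e₂ ∨ i = e₃ ∨ i = e₄) (hj : j = e₁ ∨ j = e₂ ∨ j = e₃ ∨ j = e₄)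
    (hl : l ≠ Sum.inl k) : ¬ T.Tri i j l := by
  rintro ⟨x, y, z, h0, h1, hxy, hxz, hyz⟩
  have g1 := h.lt₁; have g2 := h.lt₂; have g3 := h.lt₃
  have g0 := sub_val_self a
  have h2 : T.edge l ≠ s(a, c) := fun hh => hl (T.edge_injective (hh.trans h.diag.symm))
  have h3 := T.not_crosses_edge l (Sum.inl k)
  rw [hyz, show T.edge (Sum.inl k) = s(a, c) from h.diag, crosses_iff a] at h3
  rw [hyz, Ne, sym2_eq_iff_coord a] at h2
  have h4 : ((x - a).val < (y - a).val ∧ (y - a).val < (z - a).val) ∨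
      ((y - a).val < (z - a).val ∧ (z - a).val < (x - a).val) ∨
      ((z - a).val < (x - a).val ∧ (x - a).val < (y - a).val) := by
    have := sub_val_lt a y; have := sub_val_lt a z
    rw [sub_val_rebase a x y] at h0 h1
    rw [sub_val_rebase a x z] at h1
    split_ifs at h0 h1 <;> omega
  rcases hi with rfl | rfl | rfl | rfl <;> rcases hj with rfl | rfl | rfl | rfl <;>
    simp only [h.edge₁, h.edge₂, h.edge₃, h.edge₄] at hxy hxz <;>
    rw [sym2_eq_iff_coord a] at hxy hxz <;>
    unfold Interleave at h3 <;>
    rcases hxy with ⟨hxy, hxy'⟩ | ⟨hxy, hxy'⟩ <;> rcases hxz with ⟨hxz, hxz'⟩ | ⟨hxz, hxz'⟩ <;>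
    omega

end Arrows

lemma initialSeed_B {n : ℕ} (T : Triangulation n) (i j : Label n) [Decidable (T.Arrow i j)]
    [Decidable (T.Arrow j i)] : (initialSeed T).B i j =
      (if T.Arrow i j then 1 else 0) - (if T.Arrow j i then 1 else 0) := by
  unfold initialSeed
  simp only
  congr

set_option maxHeartbeats 1000000 in
/-- The quiver of a flipped triangulation is the mutated quiver. -/
lemma IsFlip.mutate_B {n : ℕ} {T T' : Triangulation n} {k : Fin n} (hf : IsFlip k T T')
    {S : Seed n} (hS : S.B = (initialSeed T).B) : (S.mutate k).B = (initialSeed T').B := by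
  classical
  obtain ⟨a, b, c, d, e₁, e₂, e₃, e₄, h⟩ := exists_isQuad T k
  have h' := h.flip hf
  have hne := h.labels_ne
  have hne' := h.halfTurn.labels_ne
  have h'from : ∀ i, T'.Arrow (Sum.inl k) i ↔ i = e₁ ∨ i = e₃ := fun i =>
    (h'.arrow_from i).trans or_comm
  funext i j
  have hB : ∀ i j, S.B i j = (if T.Arrow i j then 1 else 0) - (if T.Arrow j i then 1 else 0) :=
    fun i j => by rw [hS, initialSeed_B]
  rw [initialSeed_B]
  change (if i = Sum.inl k ∨ j = Sum.inl k then - S.B i j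
    else S.B i j + max (S.B i (Sum.inl k)) 0 * max (S.B (Sum.inl k) j) 0
      - max (- S.B i (Sum.inl k)) 0 * max (- S.B (Sum.inl k) j) 0) = _
  by_cases hi : i = Sum.inl k
  · subst hi
    simp only [true_or, if_true, hB, h.arrow_to, h.arrow_from, h'.arrow_to, h'from, neg_sub]
  by_cases hj : j = Sum.inl k
  · subst hj
    simp only [or_true, if_true, hB, h.arrow_to, h.arrow_from, h'.arrow_to, h'from, neg_sub]
  rw [if_neg (by simp [hi, hj])]
  by_cases hside : (i = e₁ ∨ i = e₂ ∨ i = e₃ ∨ i = e₄) ∧ (j = e₁ ∨ j = e₂ ∨ j = e₃ ∨ j = e₄)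
  · obtain ⟨hi', hj'⟩ := hside
    have hi'' : i = e₂ ∨ i = e₃ ∨ i = e₄ ∨ i = e₁ := by tauto
    have hj'' : j = e₂ ∨ j = e₃ ∨ j = e₄ ∨ j = e₁ := by tauto
    have r1 : ¬ ∃ l, l ≠ Sum.inl k ∧ T.Tri i j l := fun ⟨l, hl, ht⟩ => h.not_tri hi' hj' hl ht
    have r2 : ¬ ∃ l, l ≠ Sum.inl k ∧ T.Tri j i l := fun ⟨l, hl, ht⟩ => h.not_tri hj' hi' hl ht
    have r3 : ¬ ∃ l, l ≠ Sum.inl k ∧ T'.Tri i j l := fun ⟨l, hl, ht⟩ =>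
      h'.not_tri hi'' hj'' hl ht
    have r4 : ¬ ∃ l, l ≠ Sum.inl k ∧ T'.Tri j i l := fun ⟨l, hl, ht⟩ =>
      h'.not_tri hj'' hi'' hl ht
    simp only [hB, h.arrow_to, h.arrow_from, h.arrow_cases (i := i) (j := j),
      h.arrow_cases (i := j) (j := i), h'.arrow_cases (i := i) (j := j),
      h'.arrow_cases (i := j) (j := i), r1, r2, r3, r4, or_false]
    obtain ⟨-, -, n12, n13, n14, n23⟩ := hne
    obtain ⟨-, -, n34, -, n32, n41⟩ := hne'
    have n24 : e₂ ≠ e₄ := h'.labels_ne.2.2.2.1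
    clear r1 r2 r3 r4 hi'' hj'' h'from h h' hB
    rcases hi' with rfl | rfl | rfl | rfl <;> rcases hj' with rfl | rfl | rfl | rfl <;>
      simp [n12, n13, n14, n23, n24, n34, n12.symm, n13.symm, n14.symm, n23.symm, n24.symm,
        n34.symm]
  · have hT : ∀ i j, i ≠ Sum.inl k → j ≠ Sum.inl k →
        ¬ ((i = e₁ ∨ i = e₂ ∨ i = e₃ ∨ i = e₄) ∧ (j = e₁ ∨ j = e₂ ∨ j = e₃ ∨ j = e₄)) →
        (T'.Arrow i j ↔ T.Arrow i j) := by
      intro i j hi hj hs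
      rw [h.arrow_cases, h'.arrow_cases, or_iff_right (by tauto), or_iff_right (by tauto)]
      exact exists_congr fun l => and_congr_right fun hl => hf.tri_iff hi hj hl
    rw [hT i j hi hj hside, hT j i hj hi (by tauto), hB i j, hB i (Sum.inl k),
      hB (Sum.inl k) j]
    simp only [h.arrow_to, h.arrow_from]
    by_cases hi' : i = e₁ ∨ i = e₂ ∨ i = e₃ ∨ i = e₄
    · have hj' : ¬ (j = e₁ ∨ j = e₂ ∨ j = e₃ ∨ j = e₄) := by tauto
      simp only [not_or] at hj'
      simp [hj']
    · simp only [not_or] at hi'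
      simp [hi']

/-! ### Positive elements -/

/-- Quotients of polynomials that are positive at the point `(1, …, 1)`. The mutation rule is
subtraction-free, so cluster variables are of this kind, and therefore nonzero. -/
def IsPos {n : ℕ} (x : RatFun n) : Prop :=
  ∃ f g : MvPolynomial (Label n) ℚ, 0 < MvPolynomial.eval 1 f ∧ 0 < MvPolynomial.eval 1 g ∧
    x * algebraMap _ _ g = algebraMap _ _ f

namespace IsPos

variable {n : ℕ} {x y : RatFun n}

lemma algebraMap_ne_zero {f : MvPolynomial (Label n) ℚ} (hf : 0 < MvPolynomial.eval 1 f) :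
    algebraMap (MvPolynomial (Label n) ℚ) (RatFun n) f ≠ 0 := by
  intro h
  have : f = 0 := (FaithfulSMul.algebraMap_eq_zero_iff _ _).1 h
  simp [this] at hf

lemma ne_zero (hx : IsPos x) : x ≠ 0 := by
  obtain ⟨f, g, hf, hg, h⟩ := hx
  rintro rfl
  rw [zero_mul] at h
  exact algebraMap_ne_zero hf h.symm

lemma initialVar (i : Label n) : IsPos (initialVar i) :=
  ⟨MvPolynomial.X i, 1, by simp, by simp, by simp [SnakePolytope.initialVar]⟩

lemma one : IsPos (1 : RatFun n) := ⟨1, 1, by simp, by simp, by simp⟩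

lemma mul (hx : IsPos x) (hy : IsPos y) : IsPos (x * y) := by
  obtain ⟨f, g, hf, hg, h⟩ := hx
  obtain ⟨f', g', hf', hg', h'⟩ := hy
  refine ⟨f * f', g * g', by simp [hf, hf'], by simp [hg, hg'], ?_⟩
  rw [map_mul, map_mul, ← h, ← h']
  ring

lemma add (hx : IsPos x) (hy : IsPos y) : IsPos (x + y) := by
  obtain ⟨f, g, hf, hg, h⟩ := hx
  obtain ⟨f', g', hf', hg', h'⟩ := hy
  refine ⟨f * g' + f' * g, g * g', ?_, by simp [hg, hg'], ?_⟩
  · simp only [map_add, map_mul]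
    positivity
  · rw [map_mul, map_add, map_mul, map_mul, ← h, ← h']
    ring

lemma div (hx : IsPos x) (hy : IsPos y) : IsPos (x / y) := by
  have hy0 := hy.ne_zero
  obtain ⟨f, g, hf, hg, h⟩ := hx
  obtain ⟨f', g', hf', hg', h'⟩ := hy
  refine ⟨f * g', g * f', by simp [hf, hg'], by simp [hg, hf'], ?_⟩
  rw [map_mul, map_mul, ← h, ← h']
  field_simp

lemma pow (hx : IsPos x) (m : ℕ) : IsPos (x ^ m) := by
  induction m with
  | zero => simpa using one
  | succ m ih => rw [pow_succ]; exact ih.mul hx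

lemma prod {ι : Type*} (s : Finset ι) (f : ι → RatFun n) (h : ∀ i, IsPos (f i)) :
    IsPos (∏ i ∈ s, f i) :=
  Finset.prod_induction f IsPos (fun _ _ => mul) one fun i _ => h i

end IsPos

/-! ### Cluster variables are lambda lengths -/

/-- If the cluster variables of a seed are the lambda lengths of a triangulation, mutation replaces
them by those of the flipped triangulation: the exchange relation is the Ptolemy relation. -/
lemma IsFlip.mutate_x {n : ℕ} {T₀ T T' : Triangulation n} {k : Fin n} (hf : IsFlip k T T')
    {L : Sym2 (Fin (n + 3)) → RatFun n} (hL : IsLambdaLength T₀ initialVar L) {S : Seed n}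
    (hB : S.B = (initialSeed T).B) (hx : ∀ i, S.x i = L (T.edge i))
    (hk : S.x (Sum.inl k) ≠ 0) (i : Label n) : (S.mutate k).x i = L (T'.edge i) := by
  classical
  change Function.update S.x _ _ i = _
  by_cases hi : i = Sum.inl k
  swap
  · rw [Function.update_of_ne hi, hf.edge_eq hi, hx]
  subst hi
  obtain ⟨a, b, c, d, e₁, e₂, e₃, e₄, h⟩ := exists_isQuad T k
  have hne := h.labels_ne
  have hne' := h.halfTurn.labels_ne
  have n24 : e₂ ≠ e₄ := (h.flip hf).labels_ne.2.2.2.1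
  obtain ⟨-, -, n12, n13, n14, n23⟩ := hne
  obtain ⟨-, -, n34, -, n32, n41⟩ := hne'
  have prod_two : ∀ (u v : Label n) (m : Label n → ℕ), u ≠ v → m u = 1 → m v = 1 →
      (∀ i, i ≠ u ∧ i ≠ v → m i = 0) → ∏ i, S.x i ^ m i = S.x u * S.x v := by
    intro u v m huv hu hv h0
    rw [Finset.prod_eq_mul u v huv (fun i _ hi => by rw [h0 i hi, pow_zero]) (by simp)
      (by simp), hu, hv, pow_one, pow_one]
  rw [Function.update_self, show T'.edge (Sum.inl k) = s(b, d) from hf.diag_eq h,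
    prod_two e₁ e₃ _ n13, prod_two e₂ e₄ _ n24, div_eq_iff hk, hx, hx, hx, hx, hx,
    h.edge₁, h.edge₂, h.edge₃, h.edge₄, show T.edge (Sum.inl k) = s(a, c) from h.diag]
  · have := hL.ptolemy a a b c d (by rw [sub_val_self]; exact h.lt₁) h.lt₂ h.lt₃
    rw [Sym2.eq_swap (a := d)]
    linear_combination -this
  all_goals
    rw [hB]
    simp only [initialSeed_B, h.arrow_to, h.arrow_from]
  · simp [n12.symm, n23]
  · simp [n14.symm, n34.symm]
  · rintro i ⟨h1, h2⟩
    simp only [h1, h2, or_self, if_false]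
    split_ifs <;> simp
  · simp [n12, n14]
  · simp [n34, n23.symm]
  · rintro i ⟨h1, h2⟩
    simp only [h1, h2, or_self, if_false, zero_sub]
    split_ifs <;> simp

/-- The seed at a triangulation consists of its quiver and the lambda lengths of its edges. -/
lemma SeedAt.spec {n : ℕ} {T T' : Triangulation n} {S : Seed n} (h : SeedAt T T' S)
    {L : Sym2 (Fin (n + 3)) → RatFun n} (hL : IsLambdaLength T initialVar L) :
    S.B = (initialSeed T').B ∧ (∀ i, S.x i = L (T'.edge i)) ∧ ∀ i, IsPos (S.x i) := by
  induction h with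
  | initial => exact ⟨rfl, fun i => (hL.edge i).symm, IsPos.initialVar⟩
  | @mutate T' T'' S k hS hf ih =>
    obtain ⟨hB, hx, hpos⟩ := ih
    refine ⟨hf.mutate_B hB, hf.mutate_x hL hB hx (hpos _).ne_zero, fun i => ?_⟩
    change IsPos (Function.update S.x _ _ i)
    by_cases hi : i = Sum.inl k
    · subst hi
      rw [Function.update_self]
      exact ((IsPos.prod _ _ fun i => (hpos i).pow _).add
        (IsPos.prod _ _ fun i => (hpos i).pow _)).div (hpos _)
    · rw [Function.update_of_ne hi]
      exact hpos i

lemma IsClusterVariable.eq {n : ℕ} {T : Triangulation n} {γ : Sym2 (Fin (n + 3))} {x : RatFun n}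
    (h : IsClusterVariable T γ x) {L : Sym2 (Fin (n + 3)) → RatFun n}
    (hL : IsLambdaLength T initialVar L) : x = L γ := by
  obtain ⟨T', S, k, hS, rfl, rfl⟩ := h
  exact (hS.spec hL).2.1 _

/-! ### The crossed diagonals and their order along the arc -/

namespace Triangulation

variable {n : ℕ} {T : Triangulation n} {p q : Fin (n + 3)}

lemma Ends.not_boundary {r l : Fin (n + 3)} {i : Label n} (hi : T.edge i = s(r, l))
    (hr : IsRight p q r) (hl : IsLeft p q l) : ∃ k, i = Sum.inl k ∧ T.Ends p q k r l := by
  rcases i with k | k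
  · exact ⟨k, rfl, hi, hr, hl⟩
  · exfalso
    apply not_crosses_boundary s(p, q) k
    rw [show s(k, k + 1) = s(r, l) from hi, crosses_iff p, sub_val_self]
    unfold IsRight IsLeft at *
    unfold Interleave
    omega

lemma mem_crossed {k : Fin n} : k ∈ T.crossed s(p, q) ↔ ∃ r l, T.Ends p q k r l := by
  simp only [crossed, Finset.mem_filter, Finset.mem_univ, true_and]
  constructor
  · intro h
    obtain ⟨u, w, huw⟩ : ∃ u w, T.diag k = s(u, w) := by
      induction h : T.diag k with | _ u w
      exact ⟨u, w, rfl⟩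
    rw [huw, crosses_iff p, sub_val_self] at h
    rcases h with h | h | h | h
    · exact ⟨u, w, huw, ⟨h.1, h.2.1⟩, by unfold IsLeft; omega⟩
    · omega
    · exact ⟨w, u, huw.trans Sym2.eq_swap, ⟨h.1, h.2.1⟩, by unfold IsLeft; omega⟩
    · omega
  · rintro ⟨r, l, h, hr, hl⟩
    rw [h, crosses_iff p, sub_val_self]
    unfold IsRight IsLeft at *
    unfold Interleave
    omega

lemma Ends.unique {k : Fin n} {r l r' l' : Fin (n + 3)} (h : T.Ends p q k r l)
    (h' : T.Ends p q k r' l') : r = r' ∧ l = l' := by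
  obtain ⟨h, hr, hl⟩ := h
  obtain ⟨h', hr', hl'⟩ := h'
  rw [h', sym2_eq_iff_coord p] at h
  unfold IsRight IsLeft at *
  rw [← sub_val_inj (p := p), ← sub_val_inj (p := p) (u := l)]
  omega

lemma Ends.isEdge {k : Fin n} {r l : Fin (n + 3)} (h : T.Ends p q k r l) : T.IsEdge r l :=
  ⟨Sum.inl k, h.1⟩

lemma mem_before {j k : Fin n} : j ∈ T.before p q k ↔ T.Precedes p q j k := by
  simp [before]

lemma Ends.precedes_iff {j k : Fin n} {r l r' l' : Fin (n + 3)} (h : T.Ends p q j r l)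
    (h' : T.Ends p q k r' l') : T.Precedes p q j k ↔
      j ≠ k ∧ (r - p).val ≤ (r' - p).val ∧ (l' - p).val ≤ (l - p).val := by
  constructor
  · rintro ⟨hjk, r₁, l₁, r₂, l₂, h₁, h₂, g⟩
    obtain ⟨rfl, rfl⟩ := h.unique h₁
    obtain ⟨rfl, rfl⟩ := h'.unique h₂
    exact ⟨hjk, g⟩
  · rintro ⟨hjk, g⟩
    exact ⟨hjk, r, l, r', l', h, h', g⟩

lemma Precedes.trans {i j k : Fin n} (h : T.Precedes p q i j) (h' : T.Precedes p q j k) :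
    T.Precedes p q i k := by
  obtain ⟨hij, r, l, r₁, l₁, h₁, h₂, g⟩ := h
  obtain ⟨hjk, r₂, l₂, r₃, l₃, h₃, h₄, g'⟩ := h'
  obtain ⟨rfl, rfl⟩ := h₂.unique h₃
  refine ⟨?_, r, l, r₃, l₃, h₁, h₄, by omega, by omega⟩
  rintro rfl
  obtain ⟨rfl, rfl⟩ := h₁.unique h₄
  apply hij
  apply T.injective
  rw [h₁.1, h₂.1, sym2_eq_iff_coord p]
  omega

lemma Precedes.total {j k : Fin n} (hj : j ∈ T.crossed s(p, q)) (hk : k ∈ T.crossed s(p, q))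
    (hjk : j ≠ k) : T.Precedes p q j k ∨ T.Precedes p q k j := by
  obtain ⟨r, l, h⟩ := mem_crossed.1 hj
  obtain ⟨r', l', h'⟩ := mem_crossed.1 hk
  rw [h.precedes_iff h', h'.precedes_iff h]
  have := h.isEdge.not_interleave h'.isEdge p
  obtain ⟨-, hr, hl⟩ := h
  obtain ⟨-, hr', hl'⟩ := h'
  refine (?_ : _ ∨ _).imp (And.intro hjk) (And.intro hjk.symm)
  unfold IsRight IsLeft at *
  unfold Interleave at this
  omega

lemma before_subset (k : Fin n) : T.before p q k ⊆ (T.crossed s(p, q)).erase k := by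
  intro j hj
  obtain ⟨hjk, r, l, r', l', h, h', -⟩ := mem_before.1 hj
  exact Finset.mem_erase.2 ⟨hjk, mem_crossed.2 ⟨r, l, h⟩⟩

lemma not_mem_before (k : Fin n) : k ∉ T.before p q k := fun h =>
  (Finset.mem_erase.1 (before_subset k h)).1 rfl

lemma card_before_lt {k : Fin n} (hk : k ∈ T.crossed s(p, q)) :
    (T.before p q k).card < (T.crossed s(p, q)).card :=
  (Finset.card_le_card (before_subset k)).trans_lt (Finset.card_erase_lt_of_mem hk)

lemma Precedes.card_lt {j k : Fin n} (h : T.Precedes p q j k) :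
    (T.before p q j).card < (T.before p q k).card :=
  Finset.card_lt_card ⟨fun _ hi => mem_before.2 ((mem_before.1 hi).trans h),
    fun hs => not_mem_before j (hs (mem_before.2 h))⟩

lemma card_before_injOn : Set.InjOn (fun k => (T.before p q k).card) (T.crossed s(p, q)) := by
  intro j hj k hk h
  by_contra hjk
  rcases Precedes.total hj hk hjk with h' | h' <;> exact absurd h (by have := h'.card_lt; grind)

/-- Every position smaller than the number of crossed diagonals is attained. -/
lemma exists_card_before {j : ℕ} (hj : j < (T.crossed s(p, q)).card) :
    ∃ k ∈ T.crossed s(p, q), (T.before p q k).card = j := by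
  have := Finset.surj_on_of_inj_on_of_card_le (s := T.crossed s(p, q))
    (t := Finset.range (T.crossed s(p, q)).card) (fun k _ => (T.before p q k).card)
    (fun k hk => Finset.mem_range.2 (card_before_lt hk))
    (fun j k hj hk h => card_before_injOn hj hk h) (by simp) j (Finset.mem_range.2 hj)
  obtain ⟨k, hk, h⟩ := this
  exact ⟨k, hk, h.symm⟩

lemma crossed_nonempty (hγ : IsDiagonal s(p, q)) (hT : ∀ i, T.diag i ≠ s(p, q)) :
    (T.crossed s(p, q)).Nonempty := by
  by_contra h
  rw [Finset.not_nonempty_iff_eq_empty] at h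
  obtain ⟨i, hi⟩ := T.maximal _ hγ fun i hc => by
    have : i ∈ T.crossed s(p, q) := by simp [crossed, hc]
    rw [h] at this
    simp at this
  exact hT i hi

/-- The two triangles at the crossed diagonal `k` with right end `r` and left end `l`; their third
vertices are `sw` on the side of `p` and `ne` on the side of `q`. -/
structure Cell (T : Triangulation n) (p q : Fin (n + 3)) (k : Fin n)
    (r l sw ne : Fin (n + 3)) : Prop where
  ends : T.Ends p q k r l
  swr : T.IsEdge sw r
  swl : T.IsEdge sw l
  rne : T.IsEdge r ne
  lne : T.IsEdge l ne
  near : (sw - p).val < (r - p).val ∨ (l - p).val < (sw - p).val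
  far₁ : (r - p).val < (ne - p).val
  far₂ : (ne - p).val < (l - p).val

lemma Ends.exists_cell {k : Fin n} {r l : Fin (n + 3)} (h : T.Ends p q k r l) :
    ∃ sw ne, T.Cell p q k r l sw ne := by
  have hE := h.isEdge
  have hd := T.isDiagonal k
  rw [h.1] at hd
  obtain ⟨ne, hn0, hn1, hn2, hn3⟩ := hE.exists_apex (one_lt_of_diag hd)
  rw [Sym2.eq_swap] at hd
  obtain ⟨sw, hs0, hs1, hs2, hs3⟩ := hE.symm.exists_apex (one_lt_of_diag hd)
  have hr := h.2.1
  have hl := h.2.2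
  unfold IsRight at hr
  unfold IsLeft at hl
  have := sub_val_lt p ne; have := sub_val_lt p sw; have := sub_val_lt p l
  have g1 : (l - r).val = (l - p).val - (r - p).val := by
    rw [sub_val_rebase p r l, if_pos (by omega)]
  have g2 : (r - l).val = (r - p).val + (n + 3) - (l - p).val := by
    rw [sub_val_rebase p l r, if_neg (by omega)]
  rw [g1, sub_val_rebase p r ne] at hn1
  rw [g2, sub_val_rebase p l sw] at hs1
  rw [sub_val_rebase p r ne] at hn0
  rw [sub_val_rebase p l sw] at hs0
  refine ⟨sw, ne, h, hs3, hs2.symm, hn2, hn3.symm, ?_, ?_, ?_⟩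
  · split_ifs at hs0 hs1 <;> omega
  · split_ifs at hn0 hn1 <;> omega
  · split_ifs at hn0 hn1 <;> omega

lemma Cell.unique {k : Fin n} {r l sw ne r' l' sw' ne' : Fin (n + 3)}
    (h : T.Cell p q k r l sw ne) (h' : T.Cell p q k r' l' sw' ne') :
    r = r' ∧ l = l' ∧ sw = sw' ∧ ne = ne' := by
  obtain ⟨rfl, rfl⟩ := h.ends.unique h'.ends
  have hr := h.ends.2.1
  have hl := h.ends.2.2
  unfold IsRight at hr
  unfold IsLeft at hl
  have := sub_val_lt p l
  refine ⟨rfl, rfl, ?_, ?_⟩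
  · have aux : ∀ v, ((v - p).val < (r - p).val ∨ (l - p).val < (v - p).val) →
        (v - l).val < (r - l).val := fun v hv => by
      have := sub_val_lt p v
      rw [sub_val_rebase p l v, sub_val_rebase p l r]
      split_ifs <;> omega
    exact apex_unique h.swl.symm h.swr h'.swl.symm h'.swr (aux _ h.near) (aux _ h'.near)
  · have aux : ∀ v, (r - p).val < (v - p).val → (v - p).val < (l - p).val →
        (v - r).val < (l - r).val := fun v hv hv' => by
      rw [sub_val_rebase p r v, sub_val_rebase p r l]
      split_ifs <;> omega
    exact apex_unique h.rne h.lne.symm h'.rne h'.lne.symm (aux _ h.far₁ h.far₂)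
      (aux _ h'.far₁ h'.far₂)

/-- A diagonal that crosses `pq` before the `k`-th one has its ends beyond `sw`. -/
lemma Cell.precedes_aux {j k : Fin n} {r l sw ne u w : Fin (n + 3)}
    (h : T.Cell p q k r l sw ne) (hj : T.Ends p q j u w) (hjk : T.Precedes p q j k) :
    ((sw - p).val < (r - p).val → (u - p).val ≤ (sw - p).val) ∧
      ((l - p).val < (sw - p).val → (sw - p).val ≤ (w - p).val) := by
  rw [hj.precedes_iff h.ends] at hjk
  obtain ⟨hne, h1, h2⟩ := hjk
  have h3 : ¬ ((u - p).val = (r - p).val ∧ (w - p).val = (l - p).val) := by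
    rintro ⟨g1, g2⟩
    rw [sub_val_inj] at g1 g2
    exact hne (T.injective (by rw [hj.1, h.ends.1, g1, g2]))
  have hr := h.ends.2.1; have hl := h.ends.2.2; have hu := hj.2.1; have hw := hj.2.2
  have c1 := hj.isEdge.not_interleave h.swr p
  have c2 := hj.isEdge.not_interleave h.swl p
  unfold IsRight IsLeft at *
  unfold Interleave at c1 c2
  constructor <;> intro h4 <;> by_contra h5 <;> omega

lemma Cell.before_eq_empty {k : Fin n} {r l ne : Fin (n + 3)} (h : T.Cell p q k r l p ne) :
    T.before p q k = ∅ := by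
  rw [Finset.eq_empty_iff_forall_notMem]
  intro j hj
  have hj' := mem_before.1 hj
  obtain ⟨-, u, w, -, -, hu, -⟩ := id hj'
  have h1 := (h.precedes_aux hu hj').1
  have hr := h.ends.2.1
  have hu' := hu.2.1
  unfold IsRight at hr hu'
  rw [sub_val_self] at h1
  omega

/-- The diagonal crossed immediately before `k` joins `sw` to `l` if `sw` lies on the right. -/
lemma Cell.pred_right {k : Fin n} {r l sw ne : Fin (n + 3)} (h : T.Cell p q k r l sw ne)
    (h0 : sw ≠ p) (h1 : (sw - p).val < (r - p).val) :
    ∃ k' sw', T.Cell p q k' sw l sw' r ∧ T.before p q k = insert k' (T.before p q k') := by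
  have hr := h.ends.2.1; have hl := h.ends.2.2
  obtain ⟨i, hi⟩ := h.swl
  have hsw : IsRight p q sw := by
    rw [Ne, ← sub_val_inj (p := p), sub_val_self] at h0
    unfold IsRight at *
    omega
  obtain ⟨k', -, hk'⟩ := Ends.not_boundary hi hsw hl
  obtain ⟨sw', ne', hc⟩ := hk'.exists_cell
  have hne' : ne' = r := by
    unfold IsRight IsLeft at *
    have aux : ∀ v, (sw - p).val < (v - p).val → (v - p).val < (l - p).val →
        (v - sw).val < (l - sw).val := fun v hv hv' => by
      rw [sub_val_rebase p sw v, sub_val_rebase p sw l]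
      split_ifs <;> omega
    exact apex_unique hc.rne hc.lne.symm h.swr h.ends.isEdge (aux _ hc.far₁ hc.far₂)
      (aux _ h1 (by omega))
  subst hne'
  refine ⟨k', sw', hc, ?_⟩
  have hkk' : k' ≠ k := by
    rintro rfl
    rw [(hk'.unique h.ends).1] at h1
    exact lt_irrefl _ h1
  have hpre : T.Precedes p q k' k := (hk'.precedes_iff h.ends).2 ⟨hkk', h1.le, le_rfl⟩
  ext j
  rw [Finset.mem_insert, mem_before, mem_before]
  constructor
  · intro hj
    by_cases hjk' : j = k'
    · exact Or.inl hjk'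
    · right
      obtain ⟨-, u, w, -, -, hu, -⟩ := id hj
      rw [hu.precedes_iff hk']
      exact ⟨hjk', (h.precedes_aux hu hj).1 h1, ((hu.precedes_iff h.ends).1 hj).2.2⟩
  · rintro (rfl | hj)
    · exact hpre
    · exact hj.trans hpre

/-- The diagonal crossed immediately before `k` joins `r` to `sw` if `sw` lies on the left. -/
lemma Cell.pred_left {k : Fin n} {r l sw ne : Fin (n + 3)} (h : T.Cell p q k r l sw ne)
    (h1 : (l - p).val < (sw - p).val) :
    ∃ k' sw', T.Cell p q k' r sw sw' l ∧ T.before p q k = insert k' (T.before p q k') := by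
  have hr := h.ends.2.1; have hl := h.ends.2.2
  obtain ⟨i, hi⟩ := h.swr.symm
  have hsw : IsLeft p q sw := by
    unfold IsLeft at *
    omega
  obtain ⟨k', -, hk'⟩ := Ends.not_boundary hi hr hsw
  obtain ⟨sw', ne', hc⟩ := hk'.exists_cell
  have hne' : ne' = l := by
    unfold IsRight IsLeft at *
    have aux : ∀ v, (r - p).val < (v - p).val → (v - p).val < (sw - p).val →
        (v - r).val < (sw - r).val := fun v hv hv' => by
      rw [sub_val_rebase p r v, sub_val_rebase p r sw]
      split_ifs <;> omega
    exact apex_unique hc.rne hc.lne.symm h.ends.isEdge h.swl.symm (aux _ hc.far₁ hc.far₂)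
      (aux _ (by omega) h1)
  subst hne'
  refine ⟨k', sw', hc, ?_⟩
  have hkk' : k' ≠ k := by
    rintro rfl
    rw [(hk'.unique h.ends).2] at h1
    exact lt_irrefl _ h1
  have hpre : T.Precedes p q k' k := (hk'.precedes_iff h.ends).2 ⟨hkk', le_rfl, h1.le⟩
  ext j
  rw [Finset.mem_insert, mem_before, mem_before]
  constructor
  · intro hj
    by_cases hjk' : j = k'
    · exact Or.inl hjk'
    · right
      obtain ⟨-, u, w, -, -, hu, -⟩ := id hj
      rw [hu.precedes_iff hk']
      exact ⟨hjk', ((hu.precedes_iff h.ends).1 hj).2.1, (h.precedes_aux hu hj).2 h1⟩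
  · rintro (rfl | hj)
    · exact hpre
    · exact hj.trans hpre

/-- The first crossed diagonal spans a triangle with `p`. -/
lemma Cell.eq_of_before_eq_empty {k : Fin n} {r l sw ne : Fin (n + 3)}
    (h : T.Cell p q k r l sw ne) (h0 : T.before p q k = ∅) : sw = p := by
  by_contra hsw
  rcases h.near with h1 | h1
  · obtain ⟨k', -, -, hb⟩ := h.pred_right hsw h1
    simp [hb] at h0
  · obtain ⟨k', -, -, hb⟩ := h.pred_left h1
    simp [hb] at h0

/-- The last crossed diagonal spans a triangle with `q`. -/
lemma Cell.eq_of_card {k : Fin n} {r l sw ne : Fin (n + 3)} (h : T.Cell p q k r l sw ne)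
    (hk : (T.before p q k).card + 1 = (T.crossed s(p, q)).card) : ne = q := by
  by_contra hne
  rw [← sub_val_inj (p := p)] at hne
  have hr := h.ends.2.1; have hl := h.ends.2.2
  have h1 := h.far₁; have h2 := h.far₂
  have key : ∀ k' r' l', T.Ends p q k' r' l' → (r - p).val ≤ (r' - p).val →
      (l' - p).val ≤ (l - p).val →
      ((r - p).val < (r' - p).val ∨ (l' - p).val < (l - p).val) → False := by
    intro k' r' l' hk' g1 g2 g3
    have hkk' : k ≠ k' := by
      rintro rfl
      obtain ⟨rfl, rfl⟩ := hk'.unique h.ends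
      omega
    have := ((h.ends.precedes_iff hk').2 ⟨hkk', g1, g2⟩).card_lt
    have := card_before_lt (mem_crossed.2 ⟨r', l', hk'⟩)
    omega
  rcases lt_or_gt_of_ne hne with h3 | h3
  · obtain ⟨i, hi⟩ := h.lne.symm
    obtain ⟨k', -, hk'⟩ := Ends.not_boundary hi ⟨by omega, h3⟩ hl
    exact key k' _ _ hk' h1.le le_rfl (Or.inl h1)
  · obtain ⟨i, hi⟩ := h.rne
    obtain ⟨k', -, hk'⟩ := Ends.not_boundary hi hr h3
    exact key k' _ _ hk' le_rfl h2.le (Or.inr h2)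

end Triangulation

/-! ### Connectedness under flips -/

/-- Every diagonal corresponds to some cluster variable: flipping the first diagonal crossed by
`pq`, which spans triangles with `p` and with `ne`, replaces it by a diagonal from `p` to `ne`,
so that `pq` crosses fewer diagonals. -/
lemma exists_isClusterVariable {n : ℕ} (T : Triangulation n) {p q : Fin (n + 3)}
    (hγ : IsDiagonal s(p, q)) : ∃ x, IsClusterVariable T s(p, q) x := by
  suffices H : ∀ m, ∀ T' S, SeedAt T T' S → (T'.crossed s(p, q)).card ≤ m →
      ∃ x, IsClusterVariable T s(p, q) x from H _ T _ SeedAt.initial le_rfl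
  intro m
  induction m with
  | zero =>
    intro T' S hS hm
    by_contra hx
    have : (T'.crossed s(p, q)).Nonempty := Triangulation.crossed_nonempty hγ fun k hk =>
      hx ⟨_, T', S, k, hS, hk, rfl⟩
    exact absurd (Finset.card_pos.2 this) (by omega)
  | succ m ih =>
    intro T' S hS hm
    rcases (T'.crossed s(p, q)).eq_empty_or_nonempty with he | hne
    · exact ih T' S hS (by simp [he])
    obtain ⟨k, hk, hk0⟩ := Triangulation.exists_card_before (Finset.card_pos.2 hne)
    obtain ⟨r, l, hkrl⟩ := Triangulation.mem_crossed.1 hk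
    obtain ⟨sw, v, hc⟩ := hkrl.exists_cell
    obtain rfl := hc.eq_of_before_eq_empty (Finset.card_eq_zero.1 hk0)
    obtain ⟨e₁, he₁⟩ := hc.rne; obtain ⟨e₂, he₂⟩ := hc.lne.symm
    obtain ⟨e₃, he₃⟩ := hc.swl.symm; obtain ⟨e₄, he₄⟩ := hc.swr
    have hquad : IsQuad T' k r v l sw e₁ e₂ e₃ e₄ := by
      have hr := hc.ends.2.1; have hl := hc.ends.2.2
      have h1 := hc.far₁; have h2 := hc.far₂
      have := sub_val_lt sw l
      unfold IsRight at hr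
      unfold IsLeft at hl
      refine ⟨?_, ?_, ?_, hkrl.1, he₁, he₂, he₃, he₄⟩ <;>
        simp only [sub_val_rebase sw r, sub_val_self] <;> split_ifs <;> omega
    obtain ⟨T'', hf⟩ := hquad.exists_flip
    refine ih T'' _ (SeedAt.mutate k hS hf) ?_
    have hsub : T''.crossed s(sw, q) ⊆ (T'.crossed s(sw, q)).erase k := by
      intro j hj
      by_cases hjk : j = k
      · exfalso
        subst hjk
        simp only [Triangulation.crossed, Finset.mem_filter, hf.diag_eq hquad,
          crosses_iff sw, sub_val_self] at hj
        obtain ⟨-, hj⟩ := hj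
        unfold Interleave at hj
        omega
      · simp only [Triangulation.crossed, Finset.mem_filter, hf.2 j hjk] at hj
        simpa [Triangulation.crossed, hjk] using hj
    have := Finset.card_le_card hsub
    rw [Finset.card_erase_of_mem hk] at this
    omega

/-! ### The sequence of tiles -/

namespace Triangulation

variable {n : ℕ} {T : Triangulation n} {p q : Fin (n + 3)}

lemma isTile_iff {k : Fin n} {sw se ne nw : Fin (n + 3)} : T.IsTile p q k sw se ne nw ↔
    ∃ r l, T.Cell p q k r l sw ne ∧
      if Even (T.before p q k).card then se = r ∧ nw = l else se = l ∧ nw = r := by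
  constructor
  · rintro ⟨r, l, h, hif, h1, h2, h3, h4, h5, h6, h7⟩
    refine ⟨r, l, ?_, hif⟩
    split_ifs at hif <;> obtain ⟨rfl, rfl⟩ := hif
    · exact ⟨h, h1, h2, h3, h4, h5, h6, h7⟩
    · exact ⟨h, h2, h1, h4, h3, h5, h6, h7⟩
  · rintro ⟨r, l, h, hif⟩
    refine ⟨r, l, h.ends, hif, ?_⟩
    split_ifs at hif <;> obtain ⟨rfl, rfl⟩ := hif
    · exact ⟨h.swr, h.swl, h.rne, h.lne, h.near, h.far₁, h.far₂⟩
    · exact ⟨h.swl, h.swr, h.lne, h.rne, h.near, h.far₁, h.far₂⟩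

lemma IsTile.unique {k : Fin n} {sw se ne nw sw' se' ne' nw' : Fin (n + 3)}
    (h : T.IsTile p q k sw se ne nw) (h' : T.IsTile p q k sw' se' ne' nw') :
    sw = sw' ∧ se = se' ∧ ne = ne' ∧ nw = nw' := by
  obtain ⟨r, l, hc, hif⟩ := isTile_iff.1 h
  obtain ⟨r', l', hc', hif'⟩ := isTile_iff.1 h'
  obtain ⟨rfl, rfl, rfl, rfl⟩ := hc.unique hc'
  split_ifs at hif hif' <;> simp [hif, hif']

lemma IsTile.mem_crossed {k : Fin n} {sw se ne nw : Fin (n + 3)}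
    (h : T.IsTile p q k sw se ne nw) : k ∈ T.crossed s(p, q) := by
  obtain ⟨r, l, h, -⟩ := h
  exact Triangulation.mem_crossed.2 ⟨r, l, h⟩

lemma exists_isTile {k : Fin n} (hk : k ∈ T.crossed s(p, q)) :
    ∃ sw se ne nw, T.IsTile p q k sw se ne nw := by
  obtain ⟨r, l, h⟩ := Triangulation.mem_crossed.1 hk
  obtain ⟨sw, ne, hc⟩ := h.exists_cell
  by_cases he : Even (T.before p q k).card
  · exact ⟨sw, r, ne, l, isTile_iff.2 ⟨r, l, hc, by simp [he]⟩⟩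
  · exact ⟨sw, l, ne, r, isTile_iff.2 ⟨r, l, hc, by simp [he]⟩⟩

/-- Two consecutive tiles: if the second one lies to the north, they share the side joining `nw`
and `ne` of the first one, and if it lies to the east, the side joining `se` and `ne`. -/
lemma IsTile.consecutive {k k' : Fin n} {sw se ne nw sw' se' ne' nw' : Fin (n + 3)}
    (h : T.IsTile p q k sw se ne nw) (h' : T.IsTile p q k' sw' se' ne' nw')
    (hk : (T.before p q k').card = (T.before p q k).card + 1) :
    T.before p q k' = insert k (T.before p q k) ∧
    ((Crosses s(p, q) s(se, ne) ∧ sw' = nw ∧ se' = ne ∧ nw' = se) ∨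
      (¬ Crosses s(p, q) s(se, ne) ∧ sw' = se ∧ nw' = ne ∧ se' = nw)) := by
  obtain ⟨r', l', hc', hif'⟩ := isTile_iff.1 h'
  obtain ⟨r, l, hc, hif⟩ := isTile_iff.1 h
  have hp : sw' ≠ p := by
    rintro rfl
    rw [hc'.before_eq_empty] at hk
    simp at hk
  simp only [hk, Nat.even_add_one] at hif'
  have huniq : ∀ k'', k'' ∈ T.crossed s(p, q) →
      T.before p q k' = insert k'' (T.before p q k'') → k'' = k := by
    intro k'' hk'' hb
    refine card_before_injOn hk'' h.mem_crossed ?_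
    have := congrArg Finset.card hb
    rw [Finset.card_insert_of_notMem (not_mem_before k''), hk] at this
    change (T.before p q k'').card = (T.before p q k).card
    omega
  have cross : ∀ u w, IsRight p q u → IsLeft p q w → Crosses s(p, q) s(u, w) := by
    intro u w hu hw
    unfold IsRight IsLeft at *
    rw [crosses_iff p, sub_val_self]
    unfold Interleave
    omega
  have hr' := hc'.ends.2.1; have hl' := hc'.ends.2.2
  rcases hc'.near with h1 | h1
  · obtain ⟨k'', sw'', hc'', hb⟩ := hc'.pred_right hp h1
    obtain rfl := huniq k'' (Triangulation.mem_crossed.2 ⟨_, _, hc''.ends⟩) hb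
    obtain ⟨rfl, rfl, rfl, rfl⟩ := hc.unique hc''
    refine ⟨hb, ?_⟩
    have hr := hc.ends.2.1
    by_cases he : Even (T.before p q k'').card
    · simp only [he, if_true, not_true, if_false] at hif hif'
      obtain ⟨rfl, rfl⟩ := hif; obtain ⟨rfl, rfl⟩ := hif'
      refine Or.inr ⟨?_, rfl, rfl, rfl⟩
      unfold IsRight at *
      rw [crosses_iff p, sub_val_self]
      unfold Interleave
      omega
    · simp only [he, if_true, not_false_eq_true, if_false] at hif hif'
      obtain ⟨rfl, rfl⟩ := hif; obtain ⟨rfl, rfl⟩ := hif'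
      refine Or.inl ⟨?_, rfl, rfl, rfl⟩
      exact (congrArg (Crosses _) Sym2.eq_swap).mp (cross _ _ hr' hl')
  · obtain ⟨k'', sw'', hc'', hb⟩ := hc'.pred_left h1
    obtain rfl := huniq k'' (Triangulation.mem_crossed.2 ⟨_, _, hc''.ends⟩) hb
    obtain ⟨rfl, rfl, rfl, rfl⟩ := hc.unique hc''
    refine ⟨hb, ?_⟩
    have hl := hc.ends.2.2
    by_cases he : Even (T.before p q k'').card
    · simp only [he, if_true, not_true, if_false] at hif hif'
      obtain ⟨rfl, rfl⟩ := hif; obtain ⟨rfl, rfl⟩ := hif'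
      exact Or.inl ⟨cross _ _ hr' hl', rfl, rfl, rfl⟩
    · simp only [he, if_true, not_false_eq_true, if_false] at hif hif'
      obtain ⟨rfl, rfl⟩ := hif; obtain ⟨rfl, rfl⟩ := hif'
      refine Or.inr ⟨?_, rfl, rfl, rfl⟩
      unfold IsLeft at *
      rw [crosses_iff p, sub_val_self]
      unfold Interleave
      omega

end Triangulation

/-- Labels of the sides of a sequence of square tiles; the tile with index `j + 1` lies to the
north of the tile with index `j` if `up j`, and to the east of it otherwise. -/
structure SnakeLabels (ι : Type*) where
  south : ℕ → ι
  east : ℕ → ι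
  north : ℕ → ι
  west : ℕ → ι
  up : ℕ → Prop

/-- The tiles of the snake graph of `pq` in the order in which the diagonals `K 0, …, K (d - 1)`
are crossed, with their corners and the labels of their sides. -/
structure IsSnake {n : ℕ} (T : Triangulation n) (p q : Fin (n + 3)) (d : ℕ) (K : ℕ → Fin n)
    (sw se ne nw : ℕ → Fin (n + 3)) (X : SnakeLabels (Label n)) : Prop where
  pos : 0 < d
  card : (T.crossed s(p, q)).card = d
  tile : ∀ j < d, T.IsTile p q (K j) (sw j) (se j) (ne j) (nw j)
  before : ∀ j < d, T.before p q (K j) = (Finset.range j).image K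
  inj : Set.InjOn K (Set.Iio d)
  first : sw 0 = p
  last : ne (d - 1) = q
  step : ∀ j, j + 1 < d →
    (X.up j ∧ sw (j + 1) = nw j ∧ se (j + 1) = ne j ∧ nw (j + 1) = se j) ∨
      (¬ X.up j ∧ sw (j + 1) = se j ∧ nw (j + 1) = ne j ∧ se (j + 1) = nw j)
  up_iff : ∀ j, X.up j ↔ Crosses s(p, q) s(se j, ne j)
  south : ∀ j < d, T.edge (X.south j) = s(sw j, se j)
  east : ∀ j < d, T.edge (X.east j) = s(se j, ne j)
  north : ∀ j < d, T.edge (X.north j) = s(nw j, ne j)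
  west : ∀ j < d, T.edge (X.west j) = s(sw j, nw j)

lemma exists_isSnake {n : ℕ} (T : Triangulation n) {p q : Fin (n + 3)}
    (hne : (T.crossed s(p, q)).Nonempty) :
    ∃ d K sw se ne nw X, IsSnake T p q d K sw se ne nw X := by
  have hk : ∀ j, ∃ k, j < (T.crossed s(p, q)).card →
      k ∈ T.crossed s(p, q) ∧ (T.before p q k).card = j := fun j => by
    by_cases hj : j < (T.crossed s(p, q)).card
    · obtain ⟨k, hk, h⟩ := Triangulation.exists_card_before hj
      exact ⟨k, fun _ => ⟨hk, h⟩⟩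
    · exact ⟨hne.choose, fun h => absurd h hj⟩
  choose K hK using hk
  have htile : ∀ j, ∃ sw se ne nw, j < (T.crossed s(p, q)).card →
      T.IsTile p q (K j) sw se ne nw := fun j => by
    by_cases hj : j < (T.crossed s(p, q)).card
    · obtain ⟨sw, se, ne, nw, h⟩ := Triangulation.exists_isTile (hK j hj).1
      exact ⟨sw, se, ne, nw, fun _ => h⟩
    · exact ⟨p, p, p, p, fun h => absurd h hj⟩
  choose sw se ne nw htile using htile
  have hlab : ∀ j, ∃ S E N W, j < (T.crossed s(p, q)).card →
      T.edge S = s(sw j, se j) ∧ T.edge E = s(se j, ne j) ∧ T.edge N = s(nw j, ne j) ∧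
        T.edge W = s(sw j, nw j) := fun j => by
    by_cases hj : j < (T.crossed s(p, q)).card
    · obtain ⟨r, l, -, -, ⟨S, hS⟩, ⟨W, hW⟩, ⟨E, hE⟩, ⟨N, hN⟩, -⟩ := htile j hj
      exact ⟨S, E, N, W, fun _ => ⟨hS, hE, hN, hW⟩⟩
    · let i : Label n := Sum.inr 0
      exact ⟨i, i, i, i, fun h => absurd h hj⟩
  choose S E N W hlab using hlab
  have hcons : ∀ j, j + 1 < (T.crossed s(p, q)).card → _ := fun j hj =>
    (htile j (by omega)).consecutive (htile (j + 1) hj)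
      (by rw [(hK j (by omega)).2, (hK (j + 1) hj).2])
  have hpos := Finset.card_pos.2 hne
  refine ⟨(T.crossed s(p, q)).card, K, sw, se, ne, nw,
    ⟨S, E, N, W, fun j => Crosses s(p, q) s(se j, ne j)⟩,
    hpos, rfl, htile, ?_, ?_, ?_, ?_, fun j hj => (hcons j hj).2, fun j => Iff.rfl,
    fun j hj => (hlab j hj).1, fun j hj => (hlab j hj).2.1, fun j hj => (hlab j hj).2.2.1,
    fun j hj => (hlab j hj).2.2.2⟩
  · intro j
    induction j with
    | zero => exact fun hj => by simpa using (hK 0 hj).2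
    | succ j ih =>
      intro hj
      rw [(hcons j hj).1, ih (by omega), Finset.range_add_one, Finset.image_insert]
  · intro i hi j hj hij
    rw [← (hK i hi).2, ← (hK j hj).2, hij]
  · obtain ⟨r, l, hc, -⟩ := Triangulation.isTile_iff.1 (htile 0 hpos)
    exact hc.eq_of_before_eq_empty (Finset.card_eq_zero.1 (hK 0 hpos).2)
  · have hlt : (T.crossed s(p, q)).card - 1 < (T.crossed s(p, q)).card := by omega
    obtain ⟨r, l, hc, -⟩ := Triangulation.isTile_iff.1 (htile _ hlt)
    exact hc.eq_of_card (by rw [(hK _ hlt).2]; omega)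

namespace IsSnake

variable {n : ℕ} {T : Triangulation n} {p q : Fin (n + 3)} {d : ℕ} {K : ℕ → Fin n}
  {sw se ne nw : ℕ → Fin (n + 3)} {X : SnakeLabels (Label n)}

lemma ends (h : IsSnake T p q d K sw se ne nw X) {j : ℕ} (hj : j < d) :
    (T.Ends p q (K j) (se j) (nw j) ∨ T.Ends p q (K j) (nw j) (se j)) := by
  obtain ⟨r, l, hc, hif⟩ := Triangulation.isTile_iff.1 (h.tile j hj)
  split_ifs at hif <;> obtain ⟨e1, e2⟩ := hif <;> rw [e1, e2]
  · exact Or.inl hc.ends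
  · exact Or.inr hc.ends

lemma diag (h : IsSnake T p q d K sw se ne nw X) {j : ℕ} (hj : j < d) :
    T.edge (Sum.inl (K j)) = s(se j, nw j) := by
  rcases h.ends hj with h | h
  · exact h.1
  · exact h.1.trans Sym2.eq_swap

/-- The labels of a tile to the north. -/
lemma step_up (h : IsSnake T p q d K sw se ne nw X) {j : ℕ} (hj : j + 1 < d) (hu : X.up j) :
    sw (j + 1) = nw j ∧ se (j + 1) = ne j ∧ nw (j + 1) = se j ∧
      X.south (j + 1) = X.north j ∧ X.west (j + 1) = Sum.inl (K j) ∧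
      X.east j = Sum.inl (K (j + 1)) := by
  rcases h.step j hj with ⟨-, h1, h2, h3⟩ | ⟨h0, -⟩
  swap
  · exact absurd hu h0
  refine ⟨h1, h2, h3, T.edge_injective ?_, T.edge_injective ?_, T.edge_injective ?_⟩
  · rw [h.south _ hj, h.north _ (by omega), h1, h2]
  · rw [h.west _ hj, h.diag (by omega), h1, h3, Sym2.eq_swap]
  · rw [h.east _ (by omega), h.diag hj, h2, h3, Sym2.eq_swap]

/-- The labels of a tile to the east. -/
lemma step_right (h : IsSnake T p q d K sw se ne nw X) {j : ℕ} (hj : j + 1 < d) (hu : ¬ X.up j) :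
    sw (j + 1) = se j ∧ nw (j + 1) = ne j ∧ se (j + 1) = nw j ∧
      X.west (j + 1) = X.east j ∧ X.south (j + 1) = Sum.inl (K j) ∧
      X.north j = Sum.inl (K (j + 1)) := by
  rcases h.step j hj with ⟨h0, -⟩ | ⟨-, h1, h2, h3⟩
  · exact absurd h0 hu
  refine ⟨h1, h2, h3, T.edge_injective ?_, T.edge_injective ?_, T.edge_injective ?_⟩
  · rw [h.west _ hj, h.east _ (by omega), h1, h2]
  · rw [h.south _ hj, h.diag (by omega), h1, h3]
  · rw [h.north _ (by omega), h.diag hj, h2, h3, Sym2.eq_swap]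

end IsSnake

/-! ### Dimensions -/

section Dimension

variable {ι : Type*}

/-- The dimension of the convex hull of a set of lattice points. -/
noncomputable def latticeDim (A : Set (ι → ℤ)) : ℕ :=
  Module.finrank ℝ (vectorSpan ℝ ((fun (c : ι → ℤ) (i : ι) => (c i : ℝ)) '' A))

lemma latticeDim_singleton (c : ι → ℤ) : latticeDim {c} = 0 := by
  rw [latticeDim, Set.image_singleton, vectorSpan_singleton, finrank_bot]

open scoped Pointwise in
lemma latticeDim_translate (A : Set (ι → ℤ)) (u : ι → ℤ) :
    latticeDim {c | c + u ∈ A} = latticeDim A := by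
  have : (fun (c : ι → ℤ) (i : ι) => (c i : ℝ)) '' A =
      (fun i => (u i : ℝ)) +ᵥ ((fun (c : ι → ℤ) (i : ι) => (c i : ℝ)) '' {c | c + u ∈ A}) := by
    ext v
    simp only [Set.mem_image, Set.mem_vadd_set]
    constructor
    · rintro ⟨c, hc, rfl⟩
      refine ⟨_, ⟨c - u, by simpa using hc, rfl⟩, ?_⟩
      ext i
      simp
    · rintro ⟨_, ⟨c, hc, rfl⟩, rfl⟩
      refine ⟨c + u, hc, ?_⟩
      ext i
      simp [add_comm]
  rw [latticeDim, latticeDim, this, vectorSpan_vadd]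

/-- If a translate of `B` lies in `A`, and all points of `A` and `B` have the same `i`-th
coordinate, then moving `A` and `B` apart in the `i`-th coordinate yields a set whose dimension
is one more than that of `A`. -/
lemma latticeDim_union [Fintype ι] {A B : Set (ι → ℤ)} (hB : B.Nonempty) {u : ι → ℤ}
    (hu : ∀ b ∈ B, b + u ∈ A) {i : ι} (hA0 : ∀ a ∈ A, a i = 0) (hB0 : ∀ b ∈ B, b i = 0)
    {m m' : ι → ℤ} (hm : m i ≠ m' i) :
    latticeDim {c | c - m ∈ A ∨ c - m' ∈ B} = latticeDim A + 1 := by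
  obtain ⟨b₀, hb₀⟩ := hB
  let φ : (ι → ℤ) → ι → ℝ := fun c i => (c i : ℝ)
  have φadd : ∀ c c', φ (c + c') = φ c + φ c' := fun c c' => by ext; simp [φ]
  have φsub : ∀ c c', φ (c - c') = φ c - φ c' := fun c c' => by ext; simp [φ]
  set V := vectorSpan ℝ (φ '' A) with hV
  set w : ι → ℝ := φ (b₀ + m') - φ (b₀ + u + m) with hw
  -- The vector `w` joins the two shifted copies; its `i`-th coordinate is not zero, while all
  -- vectors of `V` have `i`-th coordinate zero.
  have hspan : vectorSpan ℝ (φ '' {c | c - m ∈ A ∨ c - m' ∈ B}) = V ⊔ Submodule.span ℝ {w} := by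
    have hmemA : ∀ a ∈ A, φ (a + m) ∈ φ '' {c | c - m ∈ A ∨ c - m' ∈ B} := fun a ha =>
      Set.mem_image_of_mem _ (Or.inl (by simpa using ha))
    have hmemB : ∀ b ∈ B, φ (b + m') ∈ φ '' {c | c - m ∈ A ∨ c - m' ∈ B} := fun b hb =>
      Set.mem_image_of_mem _ (Or.inr (by simpa using hb))
    apply le_antisymm
    · rw [vectorSpan_eq_span_vsub_set_right ℝ (hmemA _ (hu _ hb₀)), Submodule.span_le]
      rintro _ ⟨_, ⟨c, hc, rfl⟩, rfl⟩
      simp only [vsub_eq_sub, SetLike.mem_coe]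
      rcases hc with hc | hc
      · apply Submodule.mem_sup_left
        have := vsub_mem_vectorSpan ℝ (Set.mem_image_of_mem φ hc)
          (Set.mem_image_of_mem φ (hu _ hb₀))
        rw [vsub_eq_sub, ← φsub] at this
        rw [← φsub]
        convert this using 2
        abel
      · have := vsub_mem_vectorSpan ℝ (Set.mem_image_of_mem φ (hu _ hc))
          (Set.mem_image_of_mem φ (hu _ hb₀))
        rw [vsub_eq_sub, ← φsub] at this
        have h2 : φ c - φ (b₀ + u + m) = φ (c - m' + u - (b₀ + u)) + w := by
          rw [hw, ← φsub, ← φsub, ← φadd]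
          congr 1
          abel
        rw [h2]
        exact add_mem (Submodule.mem_sup_left this)
          (Submodule.mem_sup_right (Submodule.mem_span_singleton_self w))
    · apply sup_le
      · rw [hV, vectorSpan_eq_span_vsub_set_right ℝ (Set.mem_image_of_mem φ (hu _ hb₀)),
          Submodule.span_le]
        rintro _ ⟨_, ⟨c, hc, rfl⟩, rfl⟩
        simp only [vsub_eq_sub, SetLike.mem_coe]
        have := vsub_mem_vectorSpan ℝ (hmemA _ hc) (hmemA _ (hu _ hb₀))
        rw [vsub_eq_sub, ← φsub] at this
        rw [← φsub]
        convert this using 2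
        abel
      · rw [Submodule.span_singleton_le_iff_mem]
        exact vsub_mem_vectorSpan ℝ (hmemB _ hb₀) (hmemA _ (hu _ hb₀))
  have hnot : w ∉ V := by
    intro hmem
    have hle : V ≤ LinearMap.ker (LinearMap.proj (R := ℝ) (φ := fun _ : ι => ℝ) i) := by
      rw [hV, vectorSpan_def, Submodule.span_le]
      rintro _ ⟨_, ⟨c, hc, rfl⟩, _, ⟨c', hc', rfl⟩, rfl⟩
      simp [φ, hA0 c hc, hA0 c' hc']
    have := hle hmem
    have h1 := hA0 _ (hu _ hb₀)
    have h2 := hB0 _ hb₀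
    rw [Pi.add_apply, h2, zero_add] at h1
    rw [LinearMap.mem_ker, LinearMap.proj_apply] at this
    simp only [hw, φ, Pi.sub_apply, Pi.add_apply, h1, h2] at this
    apply hm
    have h3 : (m i : ℝ) = m' i := by push_cast at this; linarith
    exact_mod_cast h3
  change Module.finrank ℝ (vectorSpan ℝ (φ '' _)) = Module.finrank ℝ V + 1
  rw [hspan]
  exact Submodule.finrank_sup_span_singleton hnot

end Dimension

namespace SnakeLabels

variable {ι : Type*} [DecidableEq ι] (X : SnakeLabels ι)

/-- The weights of the two kinds of partial matchings of the first `j + 1` tiles, without the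
northern and eastern sides of the last tile: those which cover the south-east corner of the last
tile and avoid its north-west corner, and those which do the opposite. In terms of lambda lengths:
the exponents of the monomials of the lengths of the arcs from `p` to `se` and to `nw`, multiplied
by the variables of the diagonals crossed before. -/
def weights : ℕ → Set (ι → ℤ) × Set (ι → ℤ)
  | 0 => ({Pi.single (X.south 0) 1}, {Pi.single (X.west 0) 1})
  | j + 1 =>
    ({c | (X.up j ∧ (c - Pi.single (X.north j) 1 ∈ (weights j).1 ∨
          c - Pi.single (X.east j) 1 ∈ (weights j).2)) ∨
        (¬ X.up j ∧ c - Pi.single (X.south (j + 1)) 1 ∈ (weights j).2)},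
      {c | (¬ X.up j ∧ (c - Pi.single (X.north j) 1 ∈ (weights j).1 ∨
          c - Pi.single (X.east j) 1 ∈ (weights j).2)) ∨
        (X.up j ∧ c - Pi.single (X.west (j + 1)) 1 ∈ (weights j).1)})

/-- The weights of the perfect matchings of the first `j + 1` tiles. -/
def totalWeights (j : ℕ) : Set (ι → ℤ) :=
  {c | c - Pi.single (X.north j) 1 ∈ (X.weights j).1 ∨
    c - Pi.single (X.east j) 1 ∈ (X.weights j).2}

lemma weights_succ_of_up {j : ℕ} (h : X.up j) : X.weights (j + 1) =
    (X.totalWeights j, {c | c - Pi.single (X.west (j + 1)) 1 ∈ (X.weights j).1}) := by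
  simp [weights, totalWeights, h]

lemma weights_succ_of_not_up {j : ℕ} (h : ¬ X.up j) : X.weights (j + 1) =
    ({c | c - Pi.single (X.south (j + 1)) 1 ∈ (X.weights j).2}, X.totalWeights j) := by
  simp [weights, totalWeights, h]

/-- Each of the first `d` tiles contributes a new label: the sets `seen j` contain all labels of the
first `j + 1` tiles but those of the northern and eastern sides of the last one, and the label of
its northern side does not belong to `seen j`. -/
structure IsFresh (d : ℕ) (seen : ℕ → Set ι) : Prop where
  south_zero : X.south 0 ∈ seen 0
  west_zero : X.west 0 ∈ seen 0
  mono : ∀ j, j + 1 < d → seen j ⊆ seen (j + 1)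
  north_mem : ∀ j, j + 1 < d → X.north j ∈ seen (j + 1)
  east_mem : ∀ j, j + 1 < d → X.east j ∈ seen (j + 1)
  south_mem : ∀ j, j + 1 < d → X.south (j + 1) ∈ seen (j + 1)
  west_mem : ∀ j, j + 1 < d → X.west (j + 1) ∈ seen (j + 1)
  north_notMem : ∀ j < d, X.north j ∉ seen j
  north_ne_east : ∀ j < d, X.north j ≠ X.east j

variable {X}

lemma IsFresh.weights_eq_zero {d : ℕ} {seen : ℕ → Set ι} (h : X.IsFresh d seen) (j : ℕ)
    (hj : j < d) : ∀ c, (c ∈ (X.weights j).1 ∨ c ∈ (X.weights j).2) → ∀ i, i ∉ seen j →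
      c i = 0 := by
  have hsingle : ∀ {i i' : ι} {s : Set ι}, i' ∈ s → i ∉ s →
      (Pi.single i' 1 : ι → ℤ) i = 0 := fun h1 h2 =>
    Pi.single_eq_of_ne (by rintro rfl; exact h2 h1) _
  induction j with
  | zero =>
    rintro c (hc | hc) i hi <;> rw [weights, Set.mem_singleton_iff] at hc <;> subst hc
    · exact hsingle h.south_zero hi
    · exact hsingle h.west_zero hi
  | succ j ih =>
    have ih := ih (by omega)
    have step : ∀ c : ι → ℤ, ∀ i i', i' ∈ seen (j + 1) → i ∉ seen (j + 1) →
        (c - Pi.single i' 1 ∈ (X.weights j).1 ∨ c - Pi.single i' 1 ∈ (X.weights j).2) →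
        c i = 0 := by
      intro c i i' hi' hi hc
      have := ih _ hc i fun hh => hi (h.mono j hj hh)
      rwa [Pi.sub_apply, hsingle hi' hi, sub_zero] at this
    rintro c ((⟨-, hc | hc⟩ | ⟨-, hc⟩) | (⟨-, hc | hc⟩ | ⟨-, hc⟩)) i hi
    · exact step c i _ (h.north_mem j hj) hi (Or.inl hc)
    · exact step c i _ (h.east_mem j hj) hi (Or.inr hc)
    · exact step c i _ (h.south_mem j hj) hi (Or.inr hc)
    · exact step c i _ (h.north_mem j hj) hi (Or.inl hc)
    · exact step c i _ (h.east_mem j hj) hi (Or.inr hc)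
    · exact step c i _ (h.west_mem j hj) hi (Or.inl hc)

variable [Fintype ι]

/-- One of the two sets of weights has the largest possible dimension and contains a translate of
the other. -/
def IsFull (X : SnakeLabels ι) (j : ℕ) : Prop :=
  (X.weights j).1.Nonempty ∧ (X.weights j).2.Nonempty ∧
    ((latticeDim (X.weights j).1 = j ∧ ∃ u, ∀ b ∈ (X.weights j).2, b + u ∈ (X.weights j).1) ∨
      (latticeDim (X.weights j).2 = j ∧ ∃ u, ∀ b ∈ (X.weights j).1, b + u ∈ (X.weights j).2))

lemma IsFresh.latticeDim_of_isFull {d : ℕ} {seen : ℕ → Set ι} (h : X.IsFresh d seen) {j : ℕ}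
    (hj : j < d) (hf : X.IsFull j) : latticeDim (X.totalWeights j) = j + 1 := by
  obtain ⟨hA, hB, ⟨hd, u, hu⟩ | ⟨hd, u, hu⟩⟩ := hf
  · have := latticeDim_union hB hu (i := X.north j)
      (fun a ha => h.weights_eq_zero j hj a (Or.inl ha) _ (h.north_notMem j hj))
      (fun b hb => h.weights_eq_zero j hj b (Or.inr hb) _ (h.north_notMem j hj))
      (m := Pi.single (X.north j) 1) (m' := Pi.single (X.east j) 1)
      (by simp [h.north_ne_east j hj])
    rw [hd] at this
    exact this
  · have := latticeDim_union hA hu (i := X.north j)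
      (fun a ha => h.weights_eq_zero j hj a (Or.inr ha) _ (h.north_notMem j hj))
      (fun b hb => h.weights_eq_zero j hj b (Or.inl hb) _ (h.north_notMem j hj))
      (m := Pi.single (X.east j) 1) (m' := Pi.single (X.north j) 1)
      (by simp [h.north_ne_east j hj])
    rw [hd] at this
    rw [← this]
    congr 1
    ext c
    exact or_comm

lemma IsFresh.isFull {d : ℕ} {seen : ℕ → Set ι} (h : X.IsFresh d seen) (j : ℕ) (hj : j < d) :
    X.IsFull j := by
  induction j with
  | zero =>
    refine ⟨Set.singleton_nonempty _, Set.singleton_nonempty _, Or.inl ⟨latticeDim_singleton _,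
      Pi.single (X.south 0) 1 - Pi.single (X.west 0) 1, ?_⟩⟩
    rintro b rfl
    simp [weights]
  | succ j ih =>
    have ih := ih (by omega)
    have hd := h.latticeDim_of_isFull (by omega) ih
    obtain ⟨⟨a, ha⟩, ⟨b, hb⟩, -⟩ := ih
    have ht : (X.totalWeights j).Nonempty :=
      ⟨a + Pi.single (X.north j) 1, Or.inl (by simpa using ha)⟩
    by_cases hu : X.up j
    · rw [IsFull, weights_succ_of_up X hu]
      refine ⟨ht, ⟨a + Pi.single (X.west (j + 1)) 1, by simpa using ha⟩, Or.inl ⟨hd,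
        Pi.single (X.north j) 1 - Pi.single (X.west (j + 1)) 1, fun c hc => Or.inl ?_⟩⟩
      have hc : c - Pi.single (X.west (j + 1)) 1 ∈ (X.weights j).1 := hc
      convert hc using 1
      abel
    · rw [IsFull, weights_succ_of_not_up X hu]
      refine ⟨⟨b + Pi.single (X.south (j + 1)) 1, by simpa using hb⟩, ht, Or.inr ⟨hd,
        Pi.single (X.east j) 1 - Pi.single (X.south (j + 1)) 1, fun c hc => Or.inr ?_⟩⟩
      have hc : c - Pi.single (X.south (j + 1)) 1 ∈ (X.weights j).2 := hc
      convert hc using 1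
      abel

lemma IsFresh.latticeDim_totalWeights {d : ℕ} {seen : ℕ → Set ι} (h : X.IsFresh d seen) {j : ℕ}
    (hj : j < d) : latticeDim (X.totalWeights j) = j + 1 :=
  h.latticeDim_of_isFull hj (h.isFull j hj)

end SnakeLabels

/-- The edges of `T` no end of which lies strictly between the ends of the `j`-th crossed diagonal
on the side of `q`. -/
def seenEdges {n : ℕ} (T : Triangulation n) (p : Fin (n + 3)) (se nw : ℕ → Fin (n + 3))
    (j : ℕ) : Set (Label n) :=
  {i | ∀ u ∈ T.edge i, (u - p).val ≤ min (se j - p).val (nw j - p).val ∨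
    max (se j - p).val (nw j - p).val ≤ (u - p).val}

lemma IsSnake.isFresh {n : ℕ} {T : Triangulation n} {p q : Fin (n + 3)} {d : ℕ} {K : ℕ → Fin n}
    {sw se ne nw : ℕ → Fin (n + 3)} {X : SnakeLabels (Label n)}
    (h : IsSnake T p q d K sw se ne nw X) : X.IsFresh d (seenEdges T p se nw) := by
  have mem_pair : ∀ {i : Label n} {j : ℕ} {u w : Fin (n + 3)}, T.edge i = s(u, w) →
      (i ∈ seenEdges T p se nw j ↔
        ((u - p).val ≤ min (se j - p).val (nw j - p).val ∨
          max (se j - p).val (nw j - p).val ≤ (u - p).val) ∧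
        ((w - p).val ≤ min (se j - p).val (nw j - p).val ∨
          max (se j - p).val (nw j - p).val ≤ (w - p).val)) := by
    intro i j u w hi
    simp [seenEdges, hi]
  have hcoord : ∀ j < d,
      ((sw j - p).val ≤ min (se j - p).val (nw j - p).val ∨
        max (se j - p).val (nw j - p).val ≤ (sw j - p).val) ∧
      min (se j - p).val (nw j - p).val < (ne j - p).val ∧
      (ne j - p).val < max (se j - p).val (nw j - p).val := by
    intro j hj
    obtain ⟨r, l, hc, hif⟩ := Triangulation.isTile_iff.1 (h.tile j hj)
    have hr := hc.ends.2.1; have hl := hc.ends.2.2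
    have h1 := hc.near; have h2 := hc.far₁; have h3 := hc.far₂
    unfold IsRight at hr
    unfold IsLeft at hl
    split_ifs at hif <;> obtain ⟨e1, e2⟩ := hif <;> rw [e1, e2] <;> omega
  refine ⟨?_, ?_, ?_, ?_, ?_, ?_, ?_, ?_, ?_⟩
  · rw [mem_pair (h.south 0 h.pos)]
    have := hcoord 0 h.pos
    omega
  · rw [mem_pair (h.west 0 h.pos)]
    have := hcoord 0 h.pos
    omega
  · intro j hj i hi u hu
    have h1 := hi u hu
    have h2 := hcoord j (by omega)
    rcases h.step j hj with ⟨-, e1, e2, e3⟩ | ⟨-, e1, e2, e3⟩ <;> rw [e2, e3] <;> omega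
  · intro j hj
    rw [mem_pair (h.north j (by omega))]
    have h2 := hcoord j (by omega)
    have h3 := hcoord (j + 1) hj
    rcases h.step j hj with ⟨-, e1, e2, e3⟩ | ⟨-, e1, e2, e3⟩ <;> rw [e1, e2, e3] at h3 <;>
      rw [e2, e3] <;> omega
  · intro j hj
    rw [mem_pair (h.east j (by omega))]
    have h2 := hcoord j (by omega)
    have h3 := hcoord (j + 1) hj
    rcases h.step j hj with ⟨-, e1, e2, e3⟩ | ⟨-, e1, e2, e3⟩ <;> rw [e1, e2, e3] at h3 <;>
      rw [e2, e3] <;> omega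
  · intro j hj
    rw [mem_pair (h.south _ hj)]
    have h3 := hcoord (j + 1) hj
    omega
  · intro j hj
    rw [mem_pair (h.west _ hj)]
    have h3 := hcoord (j + 1) hj
    omega
  · intro j hj
    rw [mem_pair (h.north j hj)]
    have h2 := hcoord j hj
    omega
  · intro j hj he
    have h1 := congrArg T.edge he
    rw [h.north j hj, h.east j hj, sym2_eq_iff_coord p] at h1
    have h2 := hcoord j hj
    omega

/-! ### Laurent expansions of lambda lengths -/

/-- The Laurent monomial with a given exponent vector. -/
noncomputable def monomialOf {n : ℕ} (c : Label n → ℤ) : RatFun n := ∏ i, initialVar i ^ c i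

lemma initialVar_ne_zero {n : ℕ} (i : Label n) : initialVar i ≠ 0 :=
  (IsPos.initialVar i).ne_zero

lemma monomialOf_add {n : ℕ} (c c' : Label n → ℤ) :
    monomialOf (c + c') = monomialOf c * monomialOf c' := by
  simp only [monomialOf, ← Finset.prod_mul_distrib, Pi.add_apply]
  exact Finset.prod_congr rfl fun i _ => zpow_add₀ (initialVar_ne_zero i) _ _

lemma monomialOf_single {n : ℕ} (i : Label n) :
    monomialOf (Pi.single i 1) = initialVar i := by
  rw [monomialOf, Finset.prod_eq_single i (fun j _ hj => by simp [hj]) (by simp)]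
  simp

lemma monomialOf_zero {n : ℕ} : monomialOf (0 : Label n → ℤ) = 1 := by simp [monomialOf]

lemma monomialOf_sum {n : ℕ} (K : ℕ → Label n) (d : ℕ) :
    monomialOf (∑ j ∈ Finset.range d, Pi.single (K j) 1) =
      ∏ j ∈ Finset.range d, initialVar (K j) := by
  induction d with
  | zero => simp [monomialOf_zero]
  | succ d ih => rw [Finset.sum_range_succ, Finset.prod_range_succ, monomialOf_add, ih,
      monomialOf_single]

/-- The element `y` is a Laurent polynomial with nonnegative coefficients in which exactly the
monomials with exponents in `A` appear. -/
def IsExpansion {n : ℕ} (y : RatFun n) (A : Set (Label n → ℤ)) : Prop :=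
  ∃ g : (Label n → ℤ) →₀ ℚ, (∀ c, 0 ≤ g c) ∧ (∀ c, g c ≠ 0 ↔ c ∈ A) ∧
    g.sum (fun c a => algebraMap ℚ (RatFun n) a * monomialOf c) = y

lemma isExpansion_initialVar {n : ℕ} (i : Label n) :
    IsExpansion (initialVar i) {Pi.single i 1} := by
  classical
  refine ⟨Finsupp.single (Pi.single i 1) 1, fun c => ?_, fun c => ?_, ?_⟩
  · rw [Finsupp.single_apply]
    split_ifs <;> simp
  · rw [Finsupp.single_apply, Set.mem_singleton_iff]
    split_ifs with h
    · simp [h]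
    · simpa using fun hh => h hh.symm
  · rw [Finsupp.sum_single_index (by simp), map_one, one_mul, monomialOf_single]

/-- Nonnegativity of the coefficients prevents cancellation. -/
lemma IsExpansion.add {n : ℕ} {y y' : RatFun n} {A A' : Set (Label n → ℤ)}
    (h : IsExpansion y A) (h' : IsExpansion y' A') : IsExpansion (y + y') (A ∪ A') := by
  obtain ⟨g, hg, hA, rfl⟩ := h
  obtain ⟨g', hg', hA', rfl⟩ := h'
  refine ⟨g + g', fun c => add_nonneg (hg c) (hg' c), fun c => ?_, ?_⟩
  · rw [Set.mem_union, ← hA, ← hA', Finsupp.add_apply, Ne,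
      add_eq_zero_iff_of_nonneg (hg c) (hg' c)]
    tauto
  · exact Finsupp.sum_add_index' (by simp) (by intros; rw [map_add, add_mul])

lemma IsExpansion.mul_monomialOf {n : ℕ} {y : RatFun n} {A : Set (Label n → ℤ)}
    (h : IsExpansion y A) (u : Label n → ℤ) :
    IsExpansion (y * monomialOf u) {c | c - u ∈ A} := by
  obtain ⟨g, hg, hA, rfl⟩ := h
  refine ⟨g.equivMapDomain (Equiv.addRight u), fun c => ?_, fun c => ?_, ?_⟩
  · rw [Finsupp.equivMapDomain_apply]
    exact hg _
  · rw [Finsupp.equivMapDomain_apply, hA]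
    simp [sub_eq_add_neg]
  · rw [Finsupp.equivMapDomain_eq_mapDomain, Finsupp.sum_mapDomain_index (by simp)
      (by intros; rw [map_add, add_mul]), Finsupp.sum_mul]
    refine Finsupp.sum_congr fun c _ => ?_
    rw [Equiv.coe_addRight, monomialOf_add, mul_assoc]

lemma IsExpansion.mul_initialVar {n : ℕ} {y : RatFun n} {A : Set (Label n → ℤ)}
    (h : IsExpansion y A) (i : Label n) :
    IsExpansion (y * initialVar i) {c | c - Pi.single i 1 ∈ A} := by
  rw [← monomialOf_single]
  exact h.mul_monomialOf _

/-- The Ptolemy relation in the quadrilateral formed by `p` and the far triangle of a tile. -/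
lemma IsSnake.ptolemy {n : ℕ} {T : Triangulation n} {p q : Fin (n + 3)} {d : ℕ} {K : ℕ → Fin n}
    {sw se ne nw : ℕ → Fin (n + 3)} {X : SnakeLabels (Label n)}
    (h : IsSnake T p q d K sw se ne nw X) {L : Sym2 (Fin (n + 3)) → RatFun n}
    (hL : IsLambdaLength T initialVar L) {j : ℕ} (hj : j < d) :
    L s(p, ne j) * initialVar (Sum.inl (K j)) =
      L s(p, se j) * initialVar (X.north j) + L s(p, nw j) * initialVar (X.east j) := by
  rw [← hL.eq_of_edge (h.diag hj), ← hL.eq_of_edge (h.north j hj), ← hL.eq_of_edge (h.east j hj)]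
  obtain ⟨r, l, hc, hif⟩ := Triangulation.isTile_iff.1 (h.tile j hj)
  have hr := hc.ends.2.1
  unfold IsRight at hr
  have := hL.ptolemy p p r (ne j) l (by rw [sub_val_self]; exact hr.1) hc.far₁ hc.far₂
  split_ifs at hif <;> obtain ⟨e1, e2⟩ := hif <;> rw [e1, e2]
  · rw [Sym2.eq_swap (a := l) (b := ne j)]
    linear_combination this
  · rw [Sym2.eq_swap (a := l) (b := ne j), Sym2.eq_swap (a := l) (b := r)]
    linear_combination this

/-- The monomials of the lambda lengths of the arcs from `p` to the corners of the tiles are given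
by the weights of partial matchings, because both obey the same recursion. -/
lemma IsSnake.isExpansion {n : ℕ} {T : Triangulation n} {p q : Fin (n + 3)} {d : ℕ}
    {K : ℕ → Fin n} {sw se ne nw : ℕ → Fin (n + 3)} {X : SnakeLabels (Label n)}
    (h : IsSnake T p q d K sw se ne nw X) {L : Sym2 (Fin (n + 3)) → RatFun n}
    (hL : IsLambdaLength T initialVar L) (j : ℕ) (hj : j < d) :
    IsExpansion (L s(p, se j) * ∏ i ∈ Finset.range j, initialVar (Sum.inl (K i)))
        (X.weights j).1 ∧
      IsExpansion (L s(p, nw j) * ∏ i ∈ Finset.range j, initialVar (Sum.inl (K i)))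
        (X.weights j).2 ∧
      IsExpansion (L s(p, ne j) * ∏ i ∈ Finset.range (j + 1), initialVar (Sum.inl (K i)))
        (X.totalWeights j) := by
  have total : ∀ j < d,
      IsExpansion (L s(p, se j) * ∏ i ∈ Finset.range j, initialVar (Sum.inl (K i)))
        (X.weights j).1 →
      IsExpansion (L s(p, nw j) * ∏ i ∈ Finset.range j, initialVar (Sum.inl (K i)))
        (X.weights j).2 →
      IsExpansion (L s(p, ne j) * ∏ i ∈ Finset.range (j + 1), initialVar (Sum.inl (K i)))
        (X.totalWeights j) := by
    intro j hj h1 h2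
    have : IsExpansion _ (X.totalWeights j) :=
      (h1.mul_initialVar (X.north j)).add (h2.mul_initialVar (X.east j))
    convert this using 1
    rw [Finset.prod_range_succ]
    linear_combination (∏ i ∈ Finset.range j, initialVar (Sum.inl (K i))) * h.ptolemy hL hj
  induction j with
  | zero =>
    have h1 : L s(p, se 0) = initialVar (X.south 0) := by
      rw [← h.first]
      exact hL.eq_of_edge (h.south 0 hj)
    have h2 : L s(p, nw 0) = initialVar (X.west 0) := by
      rw [← h.first]
      exact hL.eq_of_edge (h.west 0 hj)
    have h3 : IsExpansion (L s(p, se 0) * ∏ i ∈ Finset.range 0, initialVar (Sum.inl (K i)))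
        (X.weights 0).1 := by
      rw [Finset.prod_range_zero, mul_one, h1]
      exact isExpansion_initialVar _
    have h4 : IsExpansion (L s(p, nw 0) * ∏ i ∈ Finset.range 0, initialVar (Sum.inl (K i)))
        (X.weights 0).2 := by
      rw [Finset.prod_range_zero, mul_one, h2]
      exact isExpansion_initialVar _
    exact ⟨h3, h4, total 0 hj h3 h4⟩
  | succ j ih =>
    obtain ⟨ih1, ih2, ih3⟩ := ih (by omega)
    by_cases hu : X.up j
    · obtain ⟨-, e1, e2, -, e3, -⟩ := h.step_up hj hu
      have h3 : IsExpansion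
          (L s(p, se (j + 1)) * ∏ i ∈ Finset.range (j + 1), initialVar (Sum.inl (K i)))
          (X.weights (j + 1)).1 := by
        rw [X.weights_succ_of_up hu, e1]
        exact ih3
      have h4 : IsExpansion
          (L s(p, nw (j + 1)) * ∏ i ∈ Finset.range (j + 1), initialVar (Sum.inl (K i)))
          (X.weights (j + 1)).2 := by
        rw [X.weights_succ_of_up hu, e2, Finset.prod_range_succ, ← mul_assoc, ← e3]
        exact ih1.mul_initialVar _
      exact ⟨h3, h4, total _ hj h3 h4⟩
    · obtain ⟨-, e1, e2, -, e3, -⟩ := h.step_right hj hu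
      have h3 : IsExpansion
          (L s(p, se (j + 1)) * ∏ i ∈ Finset.range (j + 1), initialVar (Sum.inl (K i)))
          (X.weights (j + 1)).1 := by
        rw [X.weights_succ_of_not_up hu, e2, Finset.prod_range_succ, ← mul_assoc, ← e3]
        exact ih2.mul_initialVar _
      have h4 : IsExpansion
          (L s(p, nw (j + 1)) * ∏ i ∈ Finset.range (j + 1), initialVar (Sum.inl (K i)))
          (X.weights (j + 1)).2 := by
        rw [X.weights_succ_of_not_up hu, e1]
        exact ih3
      exact ⟨h3, h4, total _ hj h3 h4⟩

lemma polytopeDim_convexHull {n : ℕ} (A : Set (Label n → ℤ)) :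
    polytopeDim (convexHull ℝ ((fun (c : Label n → ℤ) (i : Label n) => (c i : ℝ)) '' A)) =
      latticeDim A := by
  rw [polytopeDim, affineSpan_convexHull, direction_affineSpan, latticeDim]

/-- The `T`-expansion of `x_γ` and the dimension of its Newton polytope. -/
lemma IsSnake.exists_expansion {n : ℕ} {T : Triangulation n} {p q : Fin (n + 3)} {d : ℕ}
    {K : ℕ → Fin n} {sw se ne nw : ℕ → Fin (n + 3)} {X : SnakeLabels (Label n)}
    (h : IsSnake T p q d K sw se ne nw X) {L : Sym2 (Fin (n + 3)) → RatFun n}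
    (hL : IsLambdaLength T initialVar L) :
    ∃ f : Laurent n, f.toRatFun = L s(p, q) ∧ polytopeDim (newtonPolytope f) = d := by
  have hd := h.pos
  let D : Label n → ℤ := ∑ j ∈ Finset.range d, Pi.single (Sum.inl (K j)) 1
  have hexp := (h.isExpansion hL (d - 1) (by omega)).2.2
  rw [h.last, Nat.sub_add_cancel hd, ← monomialOf_sum (fun j => Sum.inl (K j))] at hexp
  have hexp' := hexp.mul_monomialOf (-D)
  rw [mul_assoc, ← monomialOf_add, add_neg_cancel, monomialOf_zero, mul_one] at hexp'
  obtain ⟨g, -, hA, hg⟩ := hexp'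
  refine ⟨AddMonoidAlgebra.ofCoeff g, hg, ?_⟩
  have : newtonPolytope (AddMonoidAlgebra.ofCoeff g) = convexHull ℝ
      ((fun (c : Label n → ℤ) (i : Label n) => (c i : ℝ)) ''
        {c | c + D ∈ X.totalWeights (d - 1)}) := by
    unfold newtonPolytope
    congr 1
    ext v
    constructor
    · rintro ⟨c, hc, rfl⟩
      have hc := (hA c).1 (Finsupp.mem_support_iff.1 hc)
      exact ⟨c, by simpa using hc, rfl⟩
    · rintro ⟨c, hc, rfl⟩
      exact ⟨c, Finsupp.mem_support_iff.2 ((hA c).2 (by simpa using hc)), rfl⟩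
  rw [this, polytopeDim_convexHull, latticeDim_translate,
    h.isFresh.latticeDim_totalWeights (by omega), Nat.sub_add_cancel hd]

/-! ### Matchings of the snake graph -/

/-- The number of edges in `M` at the vertex `v`. -/
noncomputable def cover (M : Finset (Sym2 (ℤ × ℤ))) (v : ℤ × ℤ) : ℕ := by
  classical exact (M.filter (v ∈ ·)).card

lemma cover_insert [DecidableEq (Sym2 (ℤ × ℤ))] {M : Finset (Sym2 (ℤ × ℤ))} {e : Sym2 (ℤ × ℤ)}
    (he : e ∉ M) (v : ℤ × ℤ) [Decidable (v ∈ e)] :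
    cover (insert e M) v = cover M v + if v ∈ e then 1 else 0 := by
  classical
  unfold cover
  rw [Finset.filter_insert]
  split_ifs with h
  · rw [Finset.card_insert_of_notMem (by simp [he])]
  · simp

lemma cover_eq_zero {M : Finset (Sym2 (ℤ × ℤ))} {v : ℤ × ℤ} :
    cover M v = 0 ↔ ∀ e ∈ M, v ∉ e := by
  classical
  simp [cover, Finset.filter_eq_empty_iff]

lemma cover_eq_one {M : Finset (Sym2 (ℤ × ℤ))} {v : ℤ × ℤ} (h : cover M v = 1) :
    ∃ e ∈ M, v ∈ e ∧ ∀ e' ∈ M, v ∈ e' → e' = e := by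
  classical
  obtain ⟨e, he⟩ := Finset.card_eq_one.1 h
  have hmem : ∀ e', e' ∈ M ∧ v ∈ e' ↔ e' = e := fun e' => by
    rw [← Finset.mem_singleton, ← he, Finset.mem_filter]
  have := (hmem e).2 rfl
  exact ⟨e, this.1, this.2, fun e' h1 h2 => (hmem e').1 ⟨h1, h2⟩⟩

namespace SnakeLabels

variable {ι : Type*} (X : SnakeLabels ι)

open Classical in
/-- The south-west corner of a tile. -/
noncomputable def corner : ℕ → ℤ × ℤ
  | 0 => 0
  | j + 1 => corner j + if X.up j then (0, 1) else (1, 0)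

lemma corner_succ_of_up {j : ℕ} (h : X.up j) : X.corner (j + 1) = X.corner j + (0, 1) := by
  simp [corner, h]

lemma corner_succ_of_not_up {j : ℕ} (h : ¬ X.up j) :
    X.corner (j + 1) = X.corner j + (1, 0) := by
  simp [corner, h]

/-- The south-west corner of the tile with index `j` lies on the antidiagonal `x + y = j`. -/
lemma corner_level (j : ℕ) : (X.corner j).1 + (X.corner j).2 = j := by
  induction j with
  | zero => simp [corner]
  | succ j ih =>
    by_cases h : X.up j
    · rw [corner_succ_of_up X h]
      simp only [Prod.fst_add, Prod.snd_add]
      push_cast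
      omega
    · rw [corner_succ_of_not_up X h]
      simp only [Prod.fst_add, Prod.snd_add]
      push_cast
      omega

/-- The southern side of a tile. -/
noncomputable def sideS (j : ℕ) : Sym2 (ℤ × ℤ) := s(X.corner j, X.corner j + (1, 0))

/-- The eastern side of a tile. -/
noncomputable def sideE (j : ℕ) : Sym2 (ℤ × ℤ) := s(X.corner j + (1, 0), X.corner j + (1, 1))

/-- The northern side of a tile. -/
noncomputable def sideN (j : ℕ) : Sym2 (ℤ × ℤ) := s(X.corner j + (0, 1), X.corner j + (1, 1))

/-- The western side of a tile. -/
noncomputable def sideW (j : ℕ) : Sym2 (ℤ × ℤ) := s(X.corner j, X.corner j + (0, 1))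

/-- The edges of the first `j + 1` tiles without the northern and eastern sides of the last one. -/
def IsLow (j : ℕ) (e : Sym2 (ℤ × ℤ)) : Prop :=
  (∃ i ≤ j, e = X.sideS i ∨ e = X.sideW i) ∨ ∃ i < j, e = X.sideE i ∨ e = X.sideN i

/-- The vertices of the first `j + 1` tiles on the antidiagonals up to `x + y = j`. -/
def IsInner (j : ℕ) (v : ℤ × ℤ) : Prop :=
  v = X.corner 0 ∨ ∃ i < j, v = X.corner i + (1, 0) ∨ v = X.corner i + (0, 1)

lemma mem_pair_coord {v a b : ℤ × ℤ} :
    v ∈ s(a, b) ↔ (v.1 = a.1 ∧ v.2 = a.2) ∨ (v.1 = b.1 ∧ v.2 = b.2) := by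
  simp [Prod.ext_iff]

variable {X}

lemma IsLow.level_le {j : ℕ} {e : Sym2 (ℤ × ℤ)} (h : X.IsLow j e) {v : ℤ × ℤ} (hv : v ∈ e) :
    v.1 + v.2 ≤ j + 1 := by
  have hc := X.corner_level
  rcases h with ⟨i, hi, rfl | rfl⟩ | ⟨i, hi, rfl | rfl⟩ <;>
    simp only [sideS, sideE, sideN, sideW, mem_pair_coord, Prod.fst_add, Prod.snd_add] at hv <;>
    have := hc i <;> omega

lemma IsInner.level_le {j : ℕ} {v : ℤ × ℤ} (h : X.IsInner j v) : v.1 + v.2 ≤ j := by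
  have hc := X.corner_level
  rcases h with rfl | ⟨i, hi, rfl | rfl⟩
  · have := hc 0; omega
  all_goals
    have := hc i
    simp only [Prod.fst_add, Prod.snd_add]
    omega

lemma isInner_succ {j : ℕ} {v : ℤ × ℤ} : X.IsInner (j + 1) v ↔
    X.IsInner j v ∨ v = X.corner j + (1, 0) ∨ v = X.corner j + (0, 1) := by
  constructor
  · rintro (h | ⟨i, hi, h⟩)
    · exact Or.inl (Or.inl h)
    · rcases Nat.lt_succ_iff_lt_or_eq.1 hi with hi | rfl
      · exact Or.inl (Or.inr ⟨i, hi, h⟩)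
      · exact Or.inr h
  · rintro ((h | ⟨i, hi, h⟩) | h)
    · exact Or.inl h
    · exact Or.inr ⟨i, by omega, h⟩
    · exact Or.inr ⟨j, by omega, h⟩

lemma isLow_succ {j : ℕ} {e : Sym2 (ℤ × ℤ)} : X.IsLow (j + 1) e ↔
    X.IsLow j e ∨ e = X.sideS (j + 1) ∨ e = X.sideW (j + 1) ∨ e = X.sideE j ∨ e = X.sideN j := by
  constructor
  · rintro (⟨i, hi, h⟩ | ⟨i, hi, h⟩)
    · rcases Nat.le_succ_iff.1 hi with hi | rfl
      · exact Or.inl (Or.inl ⟨i, hi, h⟩)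
      · tauto
    · rcases Nat.lt_succ_iff_lt_or_eq.1 hi with hi | rfl
      · exact Or.inl (Or.inr ⟨i, hi, h⟩)
      · tauto
  · rintro ((⟨i, hi, h⟩ | ⟨i, hi, h⟩) | h | h | h | h)
    · exact Or.inl ⟨i, by omega, h⟩
    · exact Or.inr ⟨i, by omega, h⟩
    · exact Or.inl ⟨j + 1, le_rfl, Or.inl h⟩
    · exact Or.inl ⟨j + 1, le_rfl, Or.inr h⟩
    · exact Or.inr ⟨j, by omega, Or.inl h⟩
    · exact Or.inr ⟨j, by omega, Or.inr h⟩

variable (X)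

/-- Partial matchings by edges with `IsLow j` that cover the inner vertices and the corner `a` of
the last tile once, and avoid its corner `b`. -/
def IsPartial (j : ℕ) (a b : ℤ × ℤ) (M : Finset (Sym2 (ℤ × ℤ))) : Prop :=
  (∀ e ∈ M, X.IsLow j e) ∧ (∀ v, X.IsInner j v → cover M v = 1) ∧ cover M a = 1 ∧ cover M b = 0

/-- Matchings by edges with `IsLow j` and the further edge `e` that cover the vertices up to the
antidiagonal `x + y = j + 1` and the vertex `b`. -/
def IsExtended (j : ℕ) (e : Sym2 (ℤ × ℤ)) (b : ℤ × ℤ) (M : Finset (Sym2 (ℤ × ℤ))) : Prop :=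
  (∀ e' ∈ M, X.IsLow j e' ∨ e' = e) ∧ (∀ v, X.IsInner (j + 1) v → cover M v = 1) ∧
    cover M b = 1

/-- Perfect matchings of the first `j + 1` tiles. -/
def IsTotal (j : ℕ) (M : Finset (Sym2 (ℤ × ℤ))) : Prop :=
  (∀ e ∈ M, X.IsLow j e ∨ e = X.sideE j ∨ e = X.sideN j) ∧
    (∀ v, X.IsInner (j + 1) v → cover M v = 1) ∧ cover M (X.corner j + (1, 1)) = 1

variable {X}

/-- The extended matchings arise from partial ones by adding the further edge. -/
lemma isExtended_iff [DecidableEq (Sym2 (ℤ × ℤ))] {j : ℕ} {x y b : ℤ × ℤ}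
    (hxy : (x = X.corner j + (1, 0) ∧ y = X.corner j + (0, 1)) ∨
      (x = X.corner j + (0, 1) ∧ y = X.corner j + (1, 0)))
    (hb : b.1 + b.2 = j + 2) {M : Finset (Sym2 (ℤ × ℤ))} :
    X.IsExtended j s(y, b) b M ↔
      ∃ M', X.IsPartial j x y M' ∧ s(y, b) ∉ M' ∧ M = insert s(y, b) M' := by
  classical
  have hc := X.corner_level j
  have hlow : ∀ e, X.IsLow j e → b ∉ e := fun e he hbe => by
    have := he.level_le hbe
    omega
  have hbe : b ∈ s(y, b) := Sym2.mem_mk_right _ _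
  have hye : y ∈ s(y, b) := Sym2.mem_mk_left _ _
  have hxe : x ∉ s(y, b) := by
    rw [mem_pair_coord]
    rcases hxy with ⟨rfl, rfl⟩ | ⟨rfl, rfl⟩ <;> simp only [Prod.fst_add, Prod.snd_add] <;> omega
  have hin : ∀ v, X.IsInner j v → v ∉ s(y, b) := fun v hv hve => by
    have := hv.level_le
    rw [mem_pair_coord] at hve
    rcases hxy with ⟨rfl, rfl⟩ | ⟨rfl, rfl⟩ <;>
      simp only [Prod.fst_add, Prod.snd_add] at hve <;> omega
  have hsucc : ∀ v, X.IsInner (j + 1) v ↔ X.IsInner j v ∨ v = x ∨ v = y := fun v => by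
    rw [isInner_succ]
    rcases hxy with ⟨rfl, rfl⟩ | ⟨rfl, rfl⟩ <;> tauto
  constructor
  · rintro ⟨h1, h2, h3⟩
    have hmem : s(y, b) ∈ M := by
      obtain ⟨e, he, hbe, -⟩ := cover_eq_one h3
      rcases h1 e he with h | h
      · exact absurd hbe (hlow e h)
      · exact h ▸ he
    have hM : M = insert s(y, b) (M.erase s(y, b)) := (Finset.insert_erase hmem).symm
    have hcov := fun v => cover_insert (Finset.notMem_erase s(y, b) M) v
    rw [← hM] at hcov
    refine ⟨M.erase s(y, b), ⟨fun e he => ?_, fun v hv => ?_, ?_, ?_⟩,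
      Finset.notMem_erase _ _, hM⟩
    · exact (h1 e (Finset.mem_of_mem_erase he)).resolve_right (Finset.ne_of_mem_erase he)
    · have := hcov v
      rw [if_neg (hin v hv), add_zero] at this
      rw [← this]
      exact h2 v ((hsucc v).2 (Or.inl hv))
    · have := hcov x
      rw [if_neg hxe, add_zero] at this
      rw [← this]
      exact h2 x ((hsucc x).2 (Or.inr (Or.inl rfl)))
    · have := hcov y
      rw [if_pos hye, h2 y ((hsucc y).2 (Or.inr (Or.inr rfl)))] at this
      omega
  · rintro ⟨M', ⟨h1, h2, h3, h4⟩, hM', rfl⟩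
    have hcov := fun v => cover_insert hM' v
    refine ⟨fun e he => ?_, fun v hv => ?_, ?_⟩
    · rcases Finset.mem_insert.1 he with he | he
      · exact Or.inr he
      · exact Or.inl (h1 e he)
    · rcases (hsucc v).1 hv with hv | rfl | rfl
      · rw [hcov, if_neg (hin v hv), h2 v hv]
      · rw [hcov, if_neg hxe, h3]
      · rw [hcov, if_pos hye, h4]
    · rw [hcov, if_pos hbe, cover_eq_zero.2 fun e he => hlow e (h1 e he)]

/-- A perfect matching contains either the northern or the eastern side of the last tile. -/
lemma isTotal_iff {j : ℕ} {M : Finset (Sym2 (ℤ × ℤ))} : X.IsTotal j M ↔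
    X.IsExtended j (X.sideN j) (X.corner j + (1, 1)) M ∨
      X.IsExtended j (X.sideE j) (X.corner j + (1, 1)) M := by
  have hc := X.corner_level j
  constructor
  · rintro ⟨h1, h2, h3⟩
    obtain ⟨e, he, hbe, huniq⟩ := cover_eq_one h3
    have hne : X.sideN j ≠ X.sideE j := by
      intro h
      have : X.corner j + (0, 1) ∈ X.sideE j := h ▸ Sym2.mem_mk_left _ _
      simp only [sideE, mem_pair_coord, Prod.fst_add, Prod.snd_add] at this
      omega
    rcases h1 e he with h | rfl | rfl
    · have := h.level_le hbe
      simp only [Prod.fst_add, Prod.snd_add] at this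
      omega
    · refine Or.inr ⟨fun e' he' => ?_, h2, h3⟩
      rcases h1 e' he' with h | rfl | rfl
      · exact Or.inl h
      · exact Or.inr rfl
      · exact absurd (huniq _ he' (Sym2.mem_mk_right _ _)) hne
    · refine Or.inl ⟨fun e' he' => ?_, h2, h3⟩
      rcases h1 e' he' with h | rfl | rfl
      · exact Or.inl h
      · exact absurd (huniq _ he' (Sym2.mem_mk_right _ _)) hne.symm
      · exact Or.inr rfl
  · rintro (⟨h1, h2, h3⟩ | ⟨h1, h2, h3⟩)
    · exact ⟨fun e he => (h1 e he).imp_right Or.inr, h2, h3⟩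
    · exact ⟨fun e he => (h1 e he).imp_right Or.inl, h2, h3⟩

/-- The north-east corner of a tile is a corner of the diagonal of the next tile. The partial
matchings that cover it and avoid the other corner `y` are the perfect matchings of the tiles up to
this one, because the only further edge `e` ends at `y`. -/
lemma isPartial_succ_iff_isTotal {j : ℕ} {y : ℤ × ℤ} {e : Sym2 (ℤ × ℤ)}
    (hlow : ∀ e', X.IsLow (j + 1) e' ↔
      X.IsLow j e' ∨ e' = e ∨ e' = X.sideE j ∨ e' = X.sideN j)
    (hye : y ∈ e) (hy : y.1 + y.2 = j + 2) (hyne : y ≠ X.corner j + (1, 1))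
    {M : Finset (Sym2 (ℤ × ℤ))} :
    X.IsPartial (j + 1) (X.corner j + (1, 1)) y M ↔ X.IsTotal j M := by
  have hc := X.corner_level j
  constructor
  · rintro ⟨h1, h2, h3, h4⟩
    refine ⟨fun e' he' => ?_, h2, h3⟩
    rcases (hlow e').1 (h1 e' he') with h | rfl | h
    · exact Or.inl h
    · exact absurd hye (cover_eq_zero.1 h4 _ he')
    · exact Or.inr h
  · rintro ⟨h1, h2, h3⟩
    refine ⟨fun e' he' => (hlow e').2 ((h1 e' he').imp_right Or.inr), h2, h3,
      cover_eq_zero.2 fun e' he' hye' => ?_⟩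
    have hne : ¬ (y.1 = (X.corner j).1 + 1 ∧ y.2 = (X.corner j).2 + 1) := fun h =>
      hyne (Prod.ext h.1 h.2)
    rcases h1 e' he' with h | rfl | rfl
    · have := h.level_le hye'
      omega
    all_goals
      simp only [sideE, sideN, mem_pair_coord, Prod.fst_add, Prod.snd_add] at hye'
      omega

/-- The partial matchings that cover the other corner `y` of the diagonal of the next tile and avoid
the north-east corner of this one contain the side `e` of the next tile that ends at `y`. -/
lemma isPartial_succ_iff_isExtended {j : ℕ} {y : ℤ × ℤ} {e : Sym2 (ℤ × ℤ)}
    (hlow : ∀ e', X.IsLow (j + 1) e' ↔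
      X.IsLow j e' ∨ e' = e ∨ e' = X.sideE j ∨ e' = X.sideN j)
    (hte : X.corner j + (1, 1) ∉ e) {M : Finset (Sym2 (ℤ × ℤ))} :
    X.IsPartial (j + 1) y (X.corner j + (1, 1)) M ↔ X.IsExtended j e y M := by
  have hc := X.corner_level j
  constructor
  · rintro ⟨h1, h2, h3, h4⟩
    refine ⟨fun e' he' => ?_, h2, h3⟩
    rcases (hlow e').1 (h1 e' he') with h | h | rfl | rfl
    · exact Or.inl h
    · exact Or.inr h
    all_goals exact absurd (Sym2.mem_mk_right _ _) (cover_eq_zero.1 h4 _ he')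
  · rintro ⟨h1, h2, h3⟩
    refine ⟨fun e' he' => (hlow e').2 ((h1 e' he').imp_right Or.inl), h2, h3,
      cover_eq_zero.2 fun e' he' hye' => ?_⟩
    rcases h1 e' he' with h | rfl
    · have := h.level_le hye'
      simp only [Prod.fst_add, Prod.snd_add] at this
      omega
    · exact hte hye'

variable [DecidableEq ι]

/-- The weight of a set of edges: the number of its edges with each label. -/
def weight (f : Sym2 (ℤ × ℤ) → ι) (M : Finset (Sym2 (ℤ × ℤ))) : ι → ℤ :=
  ∑ e ∈ M, Pi.single (f e) 1

lemma exists_weight_insert [DecidableEq (Sym2 (ℤ × ℤ))] (f : Sym2 (ℤ × ℤ) → ι)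
    {P : Finset (Sym2 (ℤ × ℤ)) → Prop} {Q : Finset (Sym2 (ℤ × ℤ)) → Prop} {e : Sym2 (ℤ × ℤ)}
    (h : ∀ M, P M ↔ ∃ M', Q M' ∧ e ∉ M' ∧ M = insert e M')
    (hQ : ∀ M', Q M' → e ∉ M') (c : ι → ℤ) :
    (∃ M, P M ∧ weight f M = c) ↔ ∃ M, Q M ∧ weight f M = c - Pi.single (f e) 1 := by
  constructor
  · rintro ⟨M, hM, rfl⟩
    obtain ⟨M', hM', he, rfl⟩ := (h M).1 hM
    exact ⟨M', hM', by rw [weight, weight, Finset.sum_insert he, add_sub_cancel_left]⟩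
  · rintro ⟨M, hM, hc⟩
    refine ⟨insert e M, (h _).2 ⟨M, hM, hQ M hM, rfl⟩, ?_⟩
    rw [weight, Finset.sum_insert (hQ M hM), ← weight, hc, add_sub_cancel]

lemma exists_isExtended (f : Sym2 (ℤ × ℤ) → ι) {j : ℕ} {x y b : ℤ × ℤ}
    (hxy : (x = X.corner j + (1, 0) ∧ y = X.corner j + (0, 1)) ∨
      (x = X.corner j + (0, 1) ∧ y = X.corner j + (1, 0)))
    (hb : b.1 + b.2 = j + 2) (c : ι → ℤ) :
    (∃ M, X.IsExtended j s(y, b) b M ∧ weight f M = c) ↔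
      ∃ M, X.IsPartial j x y M ∧ weight f M = c - Pi.single (f s(y, b)) 1 := by
  classical
  refine exists_weight_insert f (fun M => isExtended_iff hxy hb) (fun M hM he => ?_) c
  have := (hM.1 _ he).level_le (Sym2.mem_mk_right _ _)
  omega

/-- The labelling `f` of the edges of the first `d` tiles is the one given by `X`. -/
structure IsLabelling (X : SnakeLabels ι) (d : ℕ) (f : Sym2 (ℤ × ℤ) → ι) : Prop where
  south : ∀ j < d, f (X.sideS j) = X.south j
  east : ∀ j < d, f (X.sideE j) = X.east j
  north : ∀ j < d, f (X.sideN j) = X.north j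
  west : ∀ j < d, f (X.sideW j) = X.west j

lemma IsLabelling.exists_isTotal {d : ℕ} {f : Sym2 (ℤ × ℤ) → ι} (hf : X.IsLabelling d f) {j : ℕ}
    (hj : j < d)
    (hA : ∀ c, (∃ M, X.IsPartial j (X.corner j + (1, 0)) (X.corner j + (0, 1)) M ∧
      weight f M = c) ↔ c ∈ (X.weights j).1)
    (hB : ∀ c, (∃ M, X.IsPartial j (X.corner j + (0, 1)) (X.corner j + (1, 0)) M ∧
      weight f M = c) ↔ c ∈ (X.weights j).2) (c : ι → ℤ) :
    (∃ M, X.IsTotal j M ∧ weight f M = c) ↔ c ∈ X.totalWeights j := by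
  have hlev : (X.corner j + (1, 1)).1 + (X.corner j + (1, 1)).2 = (j : ℤ) + 2 := by
    have := X.corner_level j
    simp only [Prod.fst_add, Prod.snd_add]
    omega
  have h1 := exists_isExtended (X := X) f (Or.inl ⟨rfl, rfl⟩) hlev c
  have h2 := exists_isExtended (X := X) f (Or.inr ⟨rfl, rfl⟩) hlev c
  rw [hA] at h1
  rw [hB] at h2
  simp only [isTotal_iff, or_and_right, exists_or]
  refine or_congr (h1.trans ?_) (h2.trans ?_)
  · rw [← hf.north j hj]; rfl
  · rw [← hf.east j hj]; rfl

/-- The weights of matchings obey the recursion that defines `weights`. -/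
lemma IsLabelling.exists_isPartial {d : ℕ} {f : Sym2 (ℤ × ℤ) → ι} (hf : X.IsLabelling d f)
    (j : ℕ) (hj : j < d) :
    (∀ c, (∃ M, X.IsPartial j (X.corner j + (1, 0)) (X.corner j + (0, 1)) M ∧
      weight f M = c) ↔ c ∈ (X.weights j).1) ∧
    (∀ c, (∃ M, X.IsPartial j (X.corner j + (0, 1)) (X.corner j + (1, 0)) M ∧
      weight f M = c) ↔ c ∈ (X.weights j).2) := by
  classical
  induction j with
  | zero =>
    have hlow : ∀ e, X.IsLow 0 e ↔ e = X.sideS 0 ∨ e = X.sideW 0 := fun e => by simp [IsLow]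
    have hin : ∀ v, X.IsInner 0 v ↔ v = X.corner 0 := fun v => by simp [IsInner]
    have key : ∀ (e e' : Sym2 (ℤ × ℤ)) (x y : ℤ × ℤ), e = s(X.corner 0, x) →
        e' = s(X.corner 0, y) → x ≠ y → y ≠ X.corner 0 →
        (∀ e'', X.IsLow 0 e'' ↔ e'' = e ∨ e'' = e') →
        ∀ M, X.IsPartial 0 x y M ↔ M = {e} := by
      rintro e e' x y rfl rfl hxy hy hl M
      constructor
      · rintro ⟨h1, h2, h3, h4⟩
        obtain ⟨e, he, hbe, huniq⟩ := cover_eq_one h3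
        have hsub : ∀ e' ∈ M, e' = s(X.corner 0, x) := fun e' he' => by
          rcases (hl e').1 (h1 e' he') with h | h
          · exact h
          · exact absurd (h ▸ Sym2.mem_mk_right _ _) (cover_eq_zero.1 h4 _ he')
        rw [Finset.eq_singleton_iff_unique_mem]
        exact ⟨hsub e he ▸ he, hsub⟩
      · rintro rfl
        have hcov := fun v => cover_insert (Finset.notMem_empty s(X.corner 0, x)) v
        simp only [insert_empty_eq] at hcov
        refine ⟨fun e he => (hl e).2 (Or.inl (Finset.mem_singleton.1 he)), fun v hv => ?_, ?_, ?_⟩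
        · rw [(hin v).1 hv, hcov]
          simp [cover]
        · rw [hcov]
          simp [cover]
        · rw [hcov]
          simp [cover, hxy.symm, hy]
    have hA := key (X.sideS 0) (X.sideW 0) (X.corner 0 + (1, 0)) (X.corner 0 + (0, 1)) rfl rfl
      (by simp) (by simp) hlow
    have hB := key (X.sideW 0) (X.sideS 0) (X.corner 0 + (0, 1)) (X.corner 0 + (1, 0)) rfl rfl
      (by simp) (by simp) (fun e => (hlow e).trans or_comm)
    constructor
    · intro c
      simp [hA, weights, weight, hf.south 0 hj, eq_comm]
    · intro c
      simp [hB, weights, weight, hf.west 0 hj, eq_comm]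
  | succ j ih =>
    obtain ⟨hA, hB⟩ := ih (by omega)
    have hT := hf.exists_isTotal (by omega) hA hB
    have hlev := X.corner_level j
    by_cases hu : X.up j
    · have hc := X.corner_succ_of_up hu
      have hS : X.sideS (j + 1) = X.sideN j := by
        rw [sideS, sideN, hc, add_assoc]; rfl
      have hW : X.sideW (j + 1) = s(X.corner j + (0, 1), X.corner (j + 1) + (0, 1)) := by
        rw [sideW, hc]
      have hcc : X.corner (j + 1) + (1, 0) = X.corner j + (1, 1) := by rw [hc, add_assoc]; rfl
      have hlow : ∀ e', X.IsLow (j + 1) e' ↔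
          X.IsLow j e' ∨ e' = X.sideW (j + 1) ∨ e' = X.sideE j ∨ e' = X.sideN j := fun e' => by
        rw [isLow_succ, hS]
        tauto
      have hl : (X.corner (j + 1) + (0, 1)).1 + (X.corner (j + 1) + (0, 1)).2 = (j : ℤ) + 2 := by
        simp only [hc, Prod.fst_add, Prod.snd_add]
        omega
      rw [weights_succ_of_up X hu, hcc]
      constructor
      · intro c
        rw [← hT]
        have := fun M => isPartial_succ_iff_isTotal (M := M) hlow (Sym2.mem_mk_right _ _) hl
          (by simp [hc, add_assoc])
        simp only [this]
      · intro c
        have := fun M => isPartial_succ_iff_isExtended (y := X.corner (j + 1) + (0, 1)) (M := M)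
          hlow (by rw [hW, mem_pair_coord]; simp only [hc, Prod.fst_add, Prod.snd_add]; omega)
        simp only [this]
        rw [hW, exists_isExtended f (Or.inl ⟨rfl, rfl⟩) hl, hA, ← hW, hf.west _ hj]
        rfl
    · have hc := X.corner_succ_of_not_up hu
      have hW : X.sideW (j + 1) = X.sideE j := by
        rw [sideW, sideE, hc, add_assoc]; rfl
      have hS : X.sideS (j + 1) = s(X.corner j + (1, 0), X.corner (j + 1) + (1, 0)) := by
        rw [sideS, hc]
      have hcc : X.corner (j + 1) + (0, 1) = X.corner j + (1, 1) := by rw [hc, add_assoc]; rfl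
      have hlow : ∀ e', X.IsLow (j + 1) e' ↔
          X.IsLow j e' ∨ e' = X.sideS (j + 1) ∨ e' = X.sideE j ∨ e' = X.sideN j := fun e' => by
        rw [isLow_succ, hW]
        tauto
      have hl : (X.corner (j + 1) + (1, 0)).1 + (X.corner (j + 1) + (1, 0)).2 = (j : ℤ) + 2 := by
        simp only [hc, Prod.fst_add, Prod.snd_add]
        omega
      rw [weights_succ_of_not_up X hu, hcc]
      constructor
      · intro c
        have := fun M => isPartial_succ_iff_isExtended (y := X.corner (j + 1) + (1, 0)) (M := M)
          hlow (by rw [hS, mem_pair_coord]; simp only [hc, Prod.fst_add, Prod.snd_add]; omega)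
        simp only [this]
        rw [hS, exists_isExtended f (Or.inr ⟨rfl, rfl⟩) hl, hB, ← hS, hf.south _ hj]
        rfl
      · intro c
        rw [← hT]
        have := fun M => isPartial_succ_iff_isTotal (M := M) hlow (Sym2.mem_mk_right _ _) hl
          (by simp [hc, add_assoc])
        simp only [this]

end SnakeLabels

/-! ### The snake graph in lattice coordinates -/

namespace IsSnake

variable {n : ℕ} {T : Triangulation n} {p q : Fin (n + 3)} {d : ℕ} {K : ℕ → Fin n}
  {sw se ne nw : ℕ → Fin (n + 3)} {X : SnakeLabels (Label n)}

lemma exists_index (h : IsSnake T p q d K sw se ne nw X) {k : Fin n}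
    (hk : k ∈ T.crossed s(p, q)) : ∃ j < d, k = K j := by
  have hsub : (Finset.range d).image K ⊆ T.crossed s(p, q) := by
    intro k hk
    obtain ⟨j, hj, rfl⟩ := Finset.mem_image.1 hk
    exact (h.tile j (Finset.mem_range.1 hj)).mem_crossed
  have hcard : ((Finset.range d).image K).card = d := by
    rw [Finset.card_image_of_injOn (by simpa using h.inj), Finset.card_range]
  have := Finset.eq_of_subset_of_card_le hsub (by rw [hcard, h.card])
  rw [← this] at hk
  obtain ⟨j, hj, rfl⟩ := Finset.mem_image.1 hk
  exact ⟨j, Finset.mem_range.1 hj, rfl⟩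

lemma step_eq (h : IsSnake T p q d K sw se ne nw X) {j : ℕ} (hj : j < d) :
    X.corner (j + 1) = X.corner j + T.step p q (K j) := by
  by_cases hu : X.up j
  · rw [X.corner_succ_of_up hu, Triangulation.step,
      if_pos ⟨_, _, _, _, h.tile j hj, (h.up_iff j).1 hu⟩]
  · rw [X.corner_succ_of_not_up hu, Triangulation.step, if_neg]
    rintro ⟨sw', se', ne', nw', ht, hc⟩
    obtain ⟨rfl, rfl, rfl, rfl⟩ := ht.unique (h.tile j hj)
    exact hu ((h.up_iff j).2 hc)

lemma pos_eq (h : IsSnake T p q d K sw se ne nw X) {j : ℕ} (hj : j < d) :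
    T.pos p q (K j) = X.corner j := by
  rw [Triangulation.pos, h.before j hj, Finset.sum_image fun i hi i' hi' e =>
    h.inj (Set.mem_Iio.2 ((Finset.mem_range.1 hi).trans hj))
      (Set.mem_Iio.2 ((Finset.mem_range.1 hi').trans hj)) e]
  induction j with
  | zero => simp [SnakeLabels.corner]
  | succ j ih =>
    rw [Finset.sum_range_succ, ih (by omega), ← h.step_eq (by omega)]

lemma snakeEdge_iff (h : IsSnake T p q d K sw se ne nw X) {e : Sym2 (ℤ × ℤ)} {i : Label n} :
    T.SnakeEdge p q e i ↔ ∃ j < d, (e = X.sideS j ∧ i = X.south j) ∨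
      (e = X.sideE j ∧ i = X.east j) ∨ (e = X.sideN j ∧ i = X.north j) ∨
      (e = X.sideW j ∧ i = X.west j) := by
  constructor
  · rintro ⟨k, sw', se', ne', nw', ht, he⟩
    obtain ⟨j, hj, rfl⟩ := h.exists_index ht.mem_crossed
    obtain ⟨rfl, rfl, rfl, rfl⟩ := ht.unique (h.tile j hj)
    refine ⟨j, hj, ?_⟩
    rw [h.pos_eq hj, ← h.south j hj, ← h.east j hj, ← h.north j hj, ← h.west j hj] at he
    exact he.imp (And.imp_right fun hi => T.edge_injective hi)
      (Or.imp (And.imp_right fun hi => T.edge_injective hi)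
        (Or.imp (And.imp_right fun hi => T.edge_injective hi)
          (And.imp_right fun hi => T.edge_injective hi)))
  · rintro ⟨j, hj, he⟩
    refine ⟨K j, sw j, se j, ne j, nw j, h.tile j hj, ?_⟩
    rw [h.pos_eq hj, ← h.south j hj, ← h.east j hj, ← h.north j hj, ← h.west j hj]
    exact he.imp (And.imp_right fun hi => congrArg T.edge hi)
      (Or.imp (And.imp_right fun hi => congrArg T.edge hi)
        (Or.imp (And.imp_right fun hi => congrArg T.edge hi)
          (And.imp_right fun hi => congrArg T.edge hi)))

end IsSnake

lemma horizontal_inj {v w : ℤ × ℤ} (h : s(v, v + (1, 0)) = s(w, w + (1, 0))) : v = w := by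
  simp only [Sym2.eq_iff, Prod.ext_iff, Prod.fst_add, Prod.snd_add] at h ⊢
  omega

lemma vertical_inj {v w : ℤ × ℤ} (h : s(v, v + (0, 1)) = s(w, w + (0, 1))) : v = w := by
  simp only [Sym2.eq_iff, Prod.ext_iff, Prod.fst_add, Prod.snd_add] at h ⊢
  omega

lemma horizontal_ne_vertical {v w : ℤ × ℤ} : s(v, v + (1, 0)) ≠ s(w, w + (0, 1)) := by
  intro h
  simp only [Sym2.eq_iff, Prod.ext_iff, Prod.fst_add, Prod.snd_add] at h
  omega

namespace SnakeLabels

variable {ι : Type*} {X : SnakeLabels ι}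

lemma sideE_eq (j : ℕ) : X.sideE j = s(X.corner j + (1, 0), X.corner j + (1, 0) + (0, 1)) := by
  rw [sideE, add_assoc]; rfl

lemma sideN_eq (j : ℕ) : X.sideN j = s(X.corner j + (0, 1), X.corner j + (0, 1) + (1, 0)) := by
  rw [sideN, add_assoc]; rfl

lemma corner_injective : Function.Injective X.corner := by
  intro i j h
  have h1 := X.corner_level i
  have h2 := X.corner_level j
  rw [h] at h1
  omega

lemma eq_succ_of_corner_eq {i j : ℕ} {v : ℤ × ℤ} (h : X.corner i = X.corner j + v)
    (hv : v.1 + v.2 = 1) : i = j + 1 := by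
  have h1 := X.corner_level i
  have h2 := X.corner_level j
  rw [h, Prod.fst_add, Prod.snd_add] at h1
  omega

lemma up_of_corner_eq {i j : ℕ} (h : X.corner i = X.corner j + (0, 1)) : i = j + 1 ∧ X.up j := by
  obtain rfl := eq_succ_of_corner_eq h (by simp)
  refine ⟨rfl, ?_⟩
  by_contra hu
  rw [X.corner_succ_of_not_up hu] at h
  simp at h

lemma not_up_of_corner_eq {i j : ℕ} (h : X.corner i = X.corner j + (1, 0)) :
    i = j + 1 ∧ ¬ X.up j := by
  obtain rfl := eq_succ_of_corner_eq h (by simp)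
  refine ⟨rfl, fun hu => ?_⟩
  rw [X.corner_succ_of_up hu] at h
  simp at h

end SnakeLabels

namespace IsSnake

open SnakeLabels

variable {n : ℕ} {T : Triangulation n} {p q : Fin (n + 3)} {d : ℕ} {K : ℕ → Fin n}
  {sw se ne nw : ℕ → Fin (n + 3)} {X : SnakeLabels (Label n)}

/-- The labels of a segment as a side of different tiles agree. -/
lemma snakeEdge_unique (h : IsSnake T p q d K sw se ne nw X) {e : Sym2 (ℤ × ℤ)} {i i' : Label n}
    (hi : T.SnakeEdge p q e i) (hi' : T.SnakeEdge p q e i') : i = i' := by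
  have hNS : ∀ j < d, ∀ j' < d, X.sideS j = X.sideN j' → X.south j = X.north j' := by
    intro j hj j' hj' he
    rw [sideN_eq] at he
    obtain ⟨rfl, hu⟩ := up_of_corner_eq (horizontal_inj he)
    exact (h.step_up hj hu).2.2.2.1
  have hEW : ∀ j < d, ∀ j' < d, X.sideW j = X.sideE j' → X.west j = X.east j' := by
    intro j hj j' hj' he
    rw [sideE_eq] at he
    obtain ⟨rfl, hu⟩ := not_up_of_corner_eq (vertical_inj he)
    exact (h.step_right hj hu).2.2.2.1
  obtain ⟨j, hj, hi⟩ := h.snakeEdge_iff.1 hi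
  obtain ⟨j', hj', hi'⟩ := h.snakeEdge_iff.1 hi'
  rcases hi with ⟨rfl, rfl⟩ | ⟨rfl, rfl⟩ | ⟨rfl, rfl⟩ | ⟨rfl, rfl⟩ <;>
    rcases hi' with ⟨he, rfl⟩ | ⟨he, rfl⟩ | ⟨he, rfl⟩ | ⟨he, rfl⟩
  · rw [corner_injective (horizontal_inj he)]
  · rw [sideE_eq] at he
    exact absurd he horizontal_ne_vertical
  · exact hNS j hj j' hj' he
  · exact absurd he horizontal_ne_vertical
  · rw [sideE_eq] at he
    exact absurd he.symm horizontal_ne_vertical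
  · rw [sideE_eq, sideE_eq] at he
    rw [corner_injective (add_right_cancel (vertical_inj he))]
  · rw [sideE_eq, sideN_eq] at he
    exact absurd he.symm horizontal_ne_vertical
  · exact (hEW j' hj' j hj he.symm).symm
  · exact (hNS j' hj' j hj he.symm).symm
  · rw [sideE_eq, sideN_eq] at he
    exact absurd he horizontal_ne_vertical
  · rw [sideN_eq, sideN_eq] at he
    rw [corner_injective (add_right_cancel (horizontal_inj he))]
  · rw [sideN_eq] at he
    exact absurd he horizontal_ne_vertical
  · exact absurd he.symm horizontal_ne_vertical
  · exact hEW j hj j' hj' he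
  · rw [sideN_eq] at he
    exact absurd he.symm horizontal_ne_vertical
  · rw [corner_injective (vertical_inj he)]

lemma exists_isLabelling (h : IsSnake T p q d K sw se ne nw X) :
    ∃ f, X.IsLabelling d f ∧ ∀ e i, T.SnakeEdge p q e i → f e = i := by
  classical
  have : ∀ e, ∃ i, ∀ i', T.SnakeEdge p q e i' → i = i' := fun e => by
    by_cases he : ∃ i, T.SnakeEdge p q e i
    · obtain ⟨i, hi⟩ := he
      exact ⟨i, fun i' hi' => h.snakeEdge_unique hi hi'⟩
    · exact ⟨X.south 0, fun i' hi' => absurd ⟨i', hi'⟩ he⟩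
  choose f hf using this
  have hf' := fun j (hj : j < d) e i hi => hf e i (h.snakeEdge_iff.2 ⟨j, hj, hi⟩)
  refine ⟨f, ⟨fun j hj => hf' j hj _ _ (Or.inl ⟨rfl, rfl⟩),
    fun j hj => hf' j hj _ _ (Or.inr (Or.inl ⟨rfl, rfl⟩)),
    fun j hj => hf' j hj _ _ (Or.inr (Or.inr (Or.inl ⟨rfl, rfl⟩))),
    fun j hj => hf' j hj _ _ (Or.inr (Or.inr (Or.inr ⟨rfl, rfl⟩)))⟩, hf⟩

lemma exists_snakeEdge_iff (h : IsSnake T p q d K sw se ne nw X) {e : Sym2 (ℤ × ℤ)} :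
    (∃ i, T.SnakeEdge p q e i) ↔
      X.IsLow (d - 1) e ∨ e = X.sideE (d - 1) ∨ e = X.sideN (d - 1) := by
  have hd := h.pos
  simp only [h.snakeEdge_iff]
  constructor
  · rintro ⟨i, j, hj, ⟨he, -⟩ | ⟨he, -⟩ | ⟨he, -⟩ | ⟨he, -⟩⟩
    · exact Or.inl (Or.inl ⟨j, by omega, Or.inl he⟩)
    · by_cases hj' : j = d - 1
      · exact Or.inr (Or.inl (hj' ▸ he))
      · exact Or.inl (Or.inr ⟨j, by omega, Or.inl he⟩)
    · by_cases hj' : j = d - 1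
      · exact Or.inr (Or.inr (hj' ▸ he))
      · exact Or.inl (Or.inr ⟨j, by omega, Or.inr he⟩)
    · exact Or.inl (Or.inl ⟨j, by omega, Or.inr he⟩)
  · rintro ((⟨j, hj, he | he⟩ | ⟨j, hj, he | he⟩) | he | he)
    · exact ⟨_, j, by omega, Or.inl ⟨he, rfl⟩⟩
    · exact ⟨_, j, by omega, Or.inr (Or.inr (Or.inr ⟨he, rfl⟩))⟩
    · exact ⟨_, j, by omega, Or.inr (Or.inl ⟨he, rfl⟩)⟩
    · exact ⟨_, j, by omega, Or.inr (Or.inr (Or.inl ⟨he, rfl⟩))⟩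
    · exact ⟨_, d - 1, by omega, Or.inr (Or.inl ⟨he, rfl⟩)⟩
    · exact ⟨_, d - 1, by omega, Or.inr (Or.inr (Or.inl ⟨he, rfl⟩))⟩

lemma exists_snakeVertex_iff (h : IsSnake T p q d K sw se ne nw X) {v : ℤ × ℤ} :
    (∃ e i, T.SnakeEdge p q e i ∧ v ∈ e) ↔
      X.IsInner (d - 1 + 1) v ∨ v = X.corner (d - 1) + (1, 1) := by
  have hd := h.pos
  constructor
  · rintro ⟨e, i, he, hv⟩
    have hSE : ∀ j < d, X.IsInner (d - 1 + 1) (X.corner j + (1, 0)) := fun j hj =>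
      Or.inr ⟨j, by omega, Or.inl rfl⟩
    have hNW : ∀ j < d, X.IsInner (d - 1 + 1) (X.corner j + (0, 1)) := fun j hj =>
      Or.inr ⟨j, by omega, Or.inr rfl⟩
    have hSW : ∀ j < d, X.IsInner (d - 1 + 1) (X.corner j) := fun j hj => by
      rcases j with _ | j
      · exact Or.inl rfl
      · by_cases hu : X.up j
        · rw [X.corner_succ_of_up hu]
          exact hNW j (by omega)
        · rw [X.corner_succ_of_not_up hu]
          exact hSE j (by omega)
    have hNE : ∀ j < d, X.IsInner (d - 1 + 1) (X.corner j + (1, 1)) ∨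
        X.corner j + (1, 1) = X.corner (d - 1) + (1, 1) := fun j hj => by
      by_cases hj' : j = d - 1
      · exact Or.inr (by rw [hj'])
      · left
        by_cases hu : X.up j
        · have := hSE (j + 1) (by omega)
          rw [X.corner_succ_of_up hu, add_assoc] at this
          exact this
        · have := hNW (j + 1) (by omega)
          rw [X.corner_succ_of_not_up hu, add_assoc] at this
          exact this
    obtain ⟨j, hj, ⟨rfl, -⟩ | ⟨rfl, -⟩ | ⟨rfl, -⟩ | ⟨rfl, -⟩⟩ := h.snakeEdge_iff.1 he <;>
      rcases Sym2.mem_iff.1 hv with rfl | rfl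
    · exact Or.inl (hSW j hj)
    · exact Or.inl (hSE j hj)
    · exact Or.inl (hSE j hj)
    · exact hNE j hj
    · exact Or.inl (hNW j hj)
    · exact hNE j hj
    · exact Or.inl (hSW j hj)
    · exact Or.inl (hNW j hj)
  · rintro ((rfl | ⟨j, hj, rfl | rfl⟩) | rfl)
    · exact ⟨_, _, h.snakeEdge_iff.2 ⟨0, hd, Or.inl ⟨rfl, rfl⟩⟩, Sym2.mem_mk_left _ _⟩
    · exact ⟨_, _, h.snakeEdge_iff.2 ⟨j, by omega, Or.inl ⟨rfl, rfl⟩⟩, Sym2.mem_mk_right _ _⟩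
    · exact ⟨_, _, h.snakeEdge_iff.2 ⟨j, by omega, Or.inr (Or.inr (Or.inr ⟨rfl, rfl⟩))⟩,
        Sym2.mem_mk_right _ _⟩
    · exact ⟨_, _, h.snakeEdge_iff.2 ⟨d - 1, by omega, Or.inr (Or.inl ⟨rfl, rfl⟩)⟩,
        Sym2.mem_mk_right _ _⟩

lemma finite_snakeEdge (h : IsSnake T p q d K sw se ne nw X) :
    {e | ∃ i, T.SnakeEdge p q e i}.Finite := by
  classical
  refine Set.Finite.subset (Finset.finite_toSet ((Finset.range d).image X.sideS ∪
    (Finset.range d).image X.sideE ∪ (Finset.range d).image X.sideN ∪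
    (Finset.range d).image X.sideW)) ?_
  rintro e ⟨i, hi⟩
  obtain ⟨j, hj, ⟨rfl, -⟩ | ⟨rfl, -⟩ | ⟨rfl, -⟩ | ⟨rfl, -⟩⟩ := h.snakeEdge_iff.1 hi <;>
    simp only [Finset.coe_union, Set.mem_union, Finset.mem_coe]
  · exact Or.inl (Or.inl (Or.inl (Finset.mem_image_of_mem _ (Finset.mem_range.2 hj))))
  · exact Or.inl (Or.inl (Or.inr (Finset.mem_image_of_mem _ (Finset.mem_range.2 hj))))
  · exact Or.inl (Or.inr (Finset.mem_image_of_mem _ (Finset.mem_range.2 hj)))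
  · exact Or.inr (Finset.mem_image_of_mem _ (Finset.mem_range.2 hj))

end IsSnake

/-! ### The matching polytope -/

lemma weight_apply {ι : Type*} [DecidableEq ι] (f : Sym2 (ℤ × ℤ) → ι) (M : Finset (Sym2 (ℤ × ℤ)))
    (i : ι) : SnakeLabels.weight f M i = (M.filter fun e => f e = i).card := by
  rw [SnakeLabels.weight, Finset.sum_apply, Finset.card_filter]
  push_cast
  refine Finset.sum_congr rfl fun e _ => ?_
  rw [Pi.single_apply]
  simp only [eq_comm]

section Subgraph

variable {n : ℕ} {T : Triangulation n} {p q : Fin (n + 3)}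

/-- Perfect matchings of the snake graph in terms of covering numbers of lattice segments. -/
lemma isPerfectMatching_iff_cover {M : (T.snakeGraph p q).Subgraph}
    {N : Finset (Sym2 (ℤ × ℤ))}
    (hMN : (N : Set (Sym2 (ℤ × ℤ))) = Sym2.map Subtype.val '' M.edgeSet) :
    M.IsPerfectMatching ↔ ∀ v, (∃ e i, T.SnakeEdge p q e i ∧ v ∈ e) → cover N v = 1 := by
  classical
  have hcov : ∀ v : T.SnakeVertex p q, cover N v.1 = (M.neighborSet v).ncard := by
    intro v
    have himg : ((N.filter (v.1 ∈ ·) : Finset _) : Set (Sym2 (ℤ × ℤ))) =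
        (fun w : T.SnakeVertex p q => s(v.1, w.1)) '' M.neighborSet v := by
      ext e
      simp only [Finset.coe_filter, ← Finset.mem_coe, hMN]
      constructor
      · rintro ⟨⟨e', he', rfl⟩, hv⟩
        obtain ⟨w, hw, hwv⟩ := Sym2.mem_map.1 hv
        obtain rfl : w = v := Subtype.ext hwv
        obtain ⟨u, rfl⟩ := Sym2.mem_iff_exists.1 hw
        exact ⟨u, M.mem_edgeSet.1 he', rfl⟩
      · rintro ⟨w, hw, rfl⟩
        exact ⟨⟨s(v, w), M.mem_edgeSet.2 hw, rfl⟩, Sym2.mem_mk_left _ _⟩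
    rw [cover, ← Set.ncard_coe_finset, himg, Set.ncard_image_of_injective]
    intro w w' hww'
    exact Subtype.ext (Sym2.congr_right.1 hww')
  rw [SimpleGraph.Subgraph.isPerfectMatching_iff]
  constructor
  · intro hM v hv
    rw [hcov ⟨v, hv⟩, Set.ncard_eq_one]
    obtain ⟨w, hw, huniq⟩ := hM ⟨v, hv⟩
    exact ⟨w, Set.eq_singleton_iff_unique_mem.2 ⟨hw, huniq⟩⟩
  · intro hM v
    have := hM v.1 v.2
    rw [hcov, Set.ncard_eq_one] at this
    obtain ⟨w, hw⟩ := this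
    obtain ⟨h1, h2⟩ := Set.eq_singleton_iff_unique_mem.1 hw
    exact ⟨w, h1, h2⟩

/-- If the lattice segments in `N` are the edges of `M`, then the weight of `N` is the characteristic
vector of `M`. -/
lemma charVec_eq_weight {M : (T.snakeGraph p q).Subgraph} {N : Finset (Sym2 (ℤ × ℤ))}
    (hMN : (N : Set (Sym2 (ℤ × ℤ))) = Sym2.map Subtype.val '' M.edgeSet)
    (hN : ∀ e ∈ N, ∃ i, T.SnakeEdge p q e i) {f : Sym2 (ℤ × ℤ) → Label n}
    (hf : ∀ e i, T.SnakeEdge p q e i → f e = i) :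
    T.charVec p q M = fun i => (SnakeLabels.weight f N i : ℝ) := by
  classical
  funext i
  rw [weight_apply, Triangulation.charVec, ← Set.ncard_coe_finset,
    ← Set.ncard_image_of_injective _ (Sym2.map.injective
      (Subtype.val_injective (p := fun v => ∃ e i, T.SnakeEdge p q e i ∧ v ∈ e)))]
  have : Sym2.map Subtype.val '' {e ∈ M.edgeSet | T.SnakeEdge p q (e.map Subtype.val) i} =
      ((N.filter fun e => f e = i : Finset _) : Set (Sym2 (ℤ × ℤ))) := by
    ext e
    simp only [Finset.coe_filter, ← Finset.mem_coe (s := N), hMN]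
    constructor
    · rintro ⟨e', ⟨he', hi⟩, rfl⟩
      exact ⟨⟨e', he', rfl⟩, hf _ _ hi⟩
    · rintro ⟨⟨e', he', rfl⟩, hi⟩
      refine ⟨e', ⟨he', ?_⟩, rfl⟩
      obtain ⟨i', hi'⟩ := hN (e'.map Subtype.val) (by
        rw [← Finset.mem_coe, hMN]; exact ⟨e', he', rfl⟩)
      rw [← hi, hf _ _ hi']
      exact hi'
  rw [this]
  simp

/-- Every set of edges of the snake graph, given as lattice segments, is the edge set of a spanning
subgraph. -/
lemma exists_subgraph {N : Finset (Sym2 (ℤ × ℤ))} (hN : ∀ e ∈ N, ∃ i, T.SnakeEdge p q e i)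
    (hdiag : ∀ e ∈ N, ¬ e.IsDiag) : ∃ M : (T.snakeGraph p q).Subgraph,
      (N : Set (Sym2 (ℤ × ℤ))) = Sym2.map Subtype.val '' M.edgeSet := by
  refine ⟨{ verts := Set.univ
            Adj := fun u v => s(u.1, v.1) ∈ N
            adj_sub := ?_
            edge_vert := fun _ => Set.mem_univ _
            symm := ⟨fun u v h => by rwa [Sym2.eq_swap]⟩ }, ?_⟩
  · intro u v huv
    rw [Triangulation.snakeGraph, SimpleGraph.fromEdgeSet_adj]
    refine ⟨hN _ huv, ?_⟩
    rintro rfl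
    exact hdiag _ huv (by simp)
  · ext e
    constructor
    · intro he
      obtain ⟨i, hi⟩ := hN e he
      induction e with | _ a b
      exact ⟨s(⟨a, _, i, hi, Sym2.mem_mk_left _ _⟩, ⟨b, _, i, hi, Sym2.mem_mk_right _ _⟩), he, rfl⟩
    · rintro ⟨e', he', rfl⟩
      induction e' with | _ a b
      exact he'

end Subgraph

lemma IsSnake.not_isDiag {n : ℕ} {T : Triangulation n} {p q : Fin (n + 3)} {d : ℕ}
    {K : ℕ → Fin n} {sw se ne nw : ℕ → Fin (n + 3)} {X : SnakeLabels (Label n)}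
    (h : IsSnake T p q d K sw se ne nw X) {e : Sym2 (ℤ × ℤ)} {i : Label n}
    (hi : T.SnakeEdge p q e i) : ¬ e.IsDiag := by
  obtain ⟨j, hj, ⟨rfl, -⟩ | ⟨rfl, -⟩ | ⟨rfl, -⟩ | ⟨rfl, -⟩⟩ := h.snakeEdge_iff.1 hi <;>
    simp [SnakeLabels.sideS, SnakeLabels.sideE, SnakeLabels.sideN, SnakeLabels.sideW]

/-- The matching polytope is spanned by the weights of the perfect matchings. -/
lemma IsSnake.matchingPolytope_eq {n : ℕ} {T : Triangulation n} {p q : Fin (n + 3)} {d : ℕ}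
    {K : ℕ → Fin n} {sw se ne nw : ℕ → Fin (n + 3)} {X : SnakeLabels (Label n)}
    (h : IsSnake T p q d K sw se ne nw X) : T.matchingPolytope p q = convexHull ℝ
      ((fun (c : Label n → ℤ) (i : Label n) => (c i : ℝ)) '' X.totalWeights (d - 1)) := by
  classical
  obtain ⟨f, hf, hf'⟩ := h.exists_isLabelling
  have hlt : d - 1 < d := Nat.sub_lt h.pos one_pos
  have htot := hf.exists_isTotal hlt (hf.exists_isPartial _ hlt).1 (hf.exists_isPartial _ hlt).2
  have hiff : ∀ N, X.IsTotal (d - 1) N ↔ (∀ e ∈ N, ∃ i, T.SnakeEdge p q e i) ∧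
      ∀ v, (∃ e i, T.SnakeEdge p q e i ∧ v ∈ e) → cover N v = 1 := by
    intro N
    simp only [SnakeLabels.IsTotal, h.exists_snakeEdge_iff, h.exists_snakeVertex_iff]
    refine and_congr_right fun _ => ⟨?_, fun hv => ⟨fun v h => hv v (Or.inl h), hv _ (Or.inr rfl)⟩⟩
    rintro ⟨h1, h2⟩ v (hv | rfl)
    · exact h1 v hv
    · exact h2
  unfold Triangulation.matchingPolytope
  congr 1
  ext v
  constructor
  · rintro ⟨M, hM, rfl⟩
    have hedge : ∀ e ∈ Sym2.map Subtype.val '' M.edgeSet, ∃ i, T.SnakeEdge p q e i := by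
      rintro _ ⟨e, he, rfl⟩
      have := M.edgeSet_subset he
      rw [Triangulation.snakeGraph, SimpleGraph.edgeSet_fromEdgeSet] at this
      exact this.1
    have hfin : (Sym2.map Subtype.val '' M.edgeSet).Finite := h.finite_snakeEdge.subset hedge
    have hMN : (hfin.toFinset : Set (Sym2 (ℤ × ℤ))) = Sym2.map Subtype.val '' M.edgeSet :=
      hfin.coe_toFinset
    have hN : ∀ e ∈ hfin.toFinset, ∃ i, T.SnakeEdge p q e i := fun e he =>
      hedge e (hfin.mem_toFinset.1 he)
    refine ⟨SnakeLabels.weight f hfin.toFinset, (htot _).1 ⟨_, (hiff _).2 ⟨hN, ?_⟩, rfl⟩,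
      (charVec_eq_weight hMN hN hf').symm⟩
    exact (isPerfectMatching_iff_cover hMN).1 hM
  · rintro ⟨c, hc, rfl⟩
    obtain ⟨N, hN, rfl⟩ := (htot c).2 hc
    obtain ⟨hN1, hN2⟩ := (hiff N).1 hN
    obtain ⟨M, hMN⟩ := exists_subgraph hN1 fun e he => by
      obtain ⟨i, hi⟩ := hN1 e he
      exact h.not_isDiag hi
    exact ⟨M, (isPerfectMatching_iff_cover hMN).2 hN2, (charVec_eq_weight hMN hN1 hf').symm⟩

end SnakePolytope

theorem mainTheorem7 {n : ℕ} (T : SnakePolytope.Triangulation n) (p q : Fin (n + 3))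
    (hγ : SnakePolytope.IsDiagonal s(p, q)) (hT : ∀ i, T.diag i ≠ s(p, q)) :
    ∃ f : SnakePolytope.Laurent n, SnakePolytope.IsTExpansion T s(p, q) f ∧
      SnakePolytope.polytopeDim (SnakePolytope.newtonPolytope f) = (T.crossed s(p, q)).card ∧
      SnakePolytope.polytopeDim (T.matchingPolytope p q) = (T.crossed s(p, q)).card := by
  obtain ⟨L, hL⟩ := SnakePolytope.exists_isLambdaLength T SnakePolytope.initialVar
    SnakePolytope.initialVar_ne_zero
  obtain ⟨d, K, sw, se, ne, nw, X, h⟩ := SnakePolytope.exists_isSnake T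
    (SnakePolytope.Triangulation.crossed_nonempty hγ hT)
  obtain ⟨f, hf, hdim⟩ := h.exists_expansion hL
  have hd := h.pos
  refine ⟨f, fun x => ⟨fun hx => (hx.eq hL).trans hf.symm, ?_⟩, hdim.trans h.card.symm, ?_⟩
  · rintro rfl
    obtain ⟨x, hx⟩ := SnakePolytope.exists_isClusterVariable T hγ
    rw [hf, ← hx.eq hL]
    exact hx
  · rw [h.matchingPolytope_eq, SnakePolytope.polytopeDim_convexHull,
      h.isFresh.latticeDim_totalWeights (by omega), h.card, Nat.sub_add_cancel hd]
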